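/- Let $\Lambda$ be an even $2$-elementary lattice: a free $\mathbf Z$-module of finite rank with a non-degenerate symmetric bilinear form $\langle\cdot,\cdot\rangle$ with values in $\mathbf Z$ such that $\langle x,x\rangle\in2\mathbf Z$ for all $x\in\Lambda$, whose discriminant group $A_\Lambda=\Lambda^\vee/\Lambda$ is isomorphic to $(\mathbf Z/2\mathbf Z)^{l(\Lambda)}$. Here $\Lambda^\vee\subset\Lambda\otimes\mathbf Q$ is the dual lattice; $(b^+(\Lambda),b^-(\Lambda))$ is the signature of $\Lambda$ and $\sigma(\Lambda)=b^+(\Lambda)-b^-(\Lambda)$. For $\gamma,\delta\in A_\Lambda$ write $\gamma^2\in\mathbf Q/2\mathbf Z$ and $\langle\gamma,\delta\rangle\in\mathbf Q/\mathbf Z$ for the discriminant forms. Let $\mathbf 1_\Lambda\in A_\Lambda$ be the unique element with $\langle\gamma,\mathbf 1_\Lambda\rangle\equiv\gamma^2\bmod\mathbf Z$ for all $\gamma\in A_\Lambda$, let $\{\mathbf e_\gamma\}$ be the standard basis of $\mathbf C[A_\Lambda]$, and put $\mathbf v_k=\sum_{\delta^2\equiv k/2\bmod 2}\mathbf e_\delta$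 for $k=0,1,2,3$. Let $\mathfrak H$ be the upper half-plane, and let $Mp_2(\mathbf Z)$ be the group of pairs $g=\left(\binom{a\ b}{c\ d},j(g,\cdot)\right)$ with $\binom{a\ b}{c\ d}\in SL_2(\mathbf Z)$ and $j(g,\cdot)$ holomorphic on $\mathfrak H$ with $j(g,\tau)^2=c\tau+d$, with product $(A,\varphi)(B,\psi)=(AB,\varphi(B\tau)\psi(\tau))$. Let $S=\left(\binom{0\ -1}{1\ \ \ 0},\sqrt\tau\right)$, $T=\left(\binom{1\ 1}{0\ 1},1\right)$, and let $M\Gamma_0(4)\subset Mp_2(\mathbf Z)$ be the subgroup defined by $c\equiv0\bmod4$. The Weil representation $\rho_\Lambda\colon Mp_2(\mathbf Z)\to GL(\mathbf C[A_\Lambda])$ is the representation, which exists and is unique, such that $$\rho_\Lambda(T)\mathbf e_\gamma=e^{\pi i\gamma^2}\mathbf e_\gamma,\qquad \rho_\Lambda(S)\mathbf e_\gamma=\frac{e^{-\pi i\sigma(\Lambda)/4}}{|A_\Lambda|^{1/2}}\sum_{\delta\in A_\Lambda}e^{-2\pi i\langle\gamma,\delta\rangle}\mathbf e_\delta .$$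 Let $q=e^{2\pi i\tau}$, let $\eta$ be the Dedekind $\eta$-function, $\eta_{1^{-8}2^84^{-8}}(\tau)=\eta(\tau)^{-8}\eta(2\tau)^8\eta(4\tau)^{-8}$, $\theta_{\mathbb A_1^+}(\tau)=\sum_{n\in\mathbf Z}q^{n^2}$ and $\theta_{\mathbb A_1^++1/2}(\tau)=\sum_{n\in\mathbf Z}q^{(n+1/2)^2}$. For $k\in\mathbf Z$ set $$f_k^{(0)}(\tau)=\frac{\eta(2\tau)^8\theta_{\mathbb A_1^+}(\tau)^k}{\eta(\tau)^8\eta(4\tau)^8}=\sum_{m\in\mathbf Z}c_k^{(0)}(m)q^m,\quad f_k^{(1)}(\tau)=-16\,\frac{\eta(4\tau)^8\theta_{\mathbb A_1^++1/2}(\tau)^k}{\eta(2\tau)^{16}},\quad g_k^{(i)}(\tau)=\sum_{m\equiv i\bmod4}c_k^{(0)}(m)q^{m/4},$$ and define $F_\Lambda\colon\mathfrak H\to\mathbf C[A_\Lambda]$ by $$F_\Lambda=f^{(0)}_{8+\sigma(\Lambda)}\,\mathbf e_0+2^{\frac{4-\sigma(\Lambda)-l(\Lambda)}2}\sum_{i=0}^3g^{(i)}_{8+\sigma(\Lambda)}\,\mathbf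 v_i+f^{(1)}_{8+\sigma(\Lambda)}\,\mathbf e_{\mathbf 1_\Lambda}.$$ Then the following hold. (1) For $\phi=\eta_{1^{-8}2^84^{-8}}\,\theta_{\mathbb A_1^+}^{8+\sigma(\Lambda)}$ and every choice of representatives $g$ of the cosets, $$F_\Lambda(\tau)=\mathcal B_\Lambda[\phi](\tau):=\sum_{g\in M\Gamma_0(4)\backslash Mp_2(\mathbf Z)}\phi(g\cdot\tau)\,j(g,\tau)^{-\sigma(\Lambda)}\,\rho_\Lambda(g^{-1})\,\mathbf e_0 .$$ In particular, $F_\Lambda$ is a modular form for $Mp_2(\mathbf Z)$ of type $\rho_\Lambda$ and weight $\sigma(\Lambda)/2$: it is holomorphic on $\mathfrak H$, it satisfies $F_\Lambda(g\cdot\tau)=j(g,\tau)^{\sigma(\Lambda)}\rho_\Lambda(g)F_\Lambda(\tau)$ for all $g\in Mp_2(\mathbf Z)$ and $\tau\in\mathfrak H$, and it has a Fourier expansion $F_\Lambda(\tau)=\sum_{\gamma\in A_\Lambda}\mathbf e_\gamma\sum_{k\in\frac1N\mathbf Z}c_\gamma(k)e^{2\pi ik\tau}$ with $c_\gamma(k)\in\mathbf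 C$ and $c_\gamma(k)=0$ for $k\ll0$, where $N$ is the level of $\Lambda$, i.e. the smallest positive integer such that $N\lambda^2/2\in\mathbf Z$ for all $\lambda\in\Lambda^\vee$. (2) The isometry group $O(\Lambda)$, acting on $\mathbf C[A_\Lambda]$ by $g(\mathbf e_\gamma)=\mathbf e_{\bar g(\gamma)}$ with $\bar g$ the map induced by $g$ on $A_\Lambda$, preserves $F_\Lambda$: $\mathrm{Aut}(\Lambda,F_\Lambda):=\{g\in O(\Lambda):g(F_\Lambda)=F_\Lambda\}=O(\Lambda)$. (3) If $b^+(\Lambda)\le2$ and $\sigma(\Lambda)\ge-12$, then all Fourier coefficients $c_\gamma(k)$ of $F_\Lambda$ are integers. -/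

import Mathlib

open UpperHalfPlane hiding I
open Complex
open scoped MatrixGroups TensorProduct Manifold Real

noncomputable section

/-! ### The metaplectic group -/

/-- The metaplectic double cover of `SL₂(ℤ)`: pairs consisting of a matrix `(a b; c d)` in
`SL₂(ℤ)` and a holomorphic function on the upper half-plane with square `cτ + d`. -/
@[ext]
structure Mp2Z where
  mat : SL(2, ℤ)
  j : ℍ → ℂ
  holo : MDifferentiable 𝓘(ℂ) 𝓘(ℂ) j
  sq : ∀ τ : ℍ, j τ ^ 2 = denom (mat : GL (Fin 2) ℝ) τ

namespace Mp2Z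

theorem j_ne_zero (g : Mp2Z) (τ : ℍ) : g.j τ ≠ 0 := by
  intro h
  have := g.sq τ
  rw [h] at this
  exact denom_ne_zero _ τ (by rw [← this]; simp)

theorem denom_mul_SL (g h : SL(2, ℤ)) (τ : ℍ) :
    denom ((g * h : SL(2, ℤ)) : GL (Fin 2) ℝ) τ
      = denom (g : GL (Fin 2) ℝ) (h • τ : ℍ) * denom (h : GL (Fin 2) ℝ) τ := by
  have := denom_cocycle_σ (g : GL (Fin 2) ℝ) (h : GL (Fin 2) ℝ) τ
  simpa [UpperHalfPlane.σ] using this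

theorem holo_smul (g : SL(2, ℤ)) : MDifferentiable 𝓘(ℂ) 𝓘(ℂ) (fun τ : ℍ => g • τ) :=
  mdifferentiable_smul (g := (g : GL (Fin 2) ℝ)) (by simp)

/-- `(A, φ) (B, ψ) = (A B, φ(B τ) ψ(τ))`. -/
instance : Mul Mp2Z where
  mul g h :=
    { mat := g.mat * h.mat
      j := fun τ => g.j (h.mat • τ) * h.j τ
      holo := (g.holo.comp (holo_smul h.mat)).mul h.holo
      sq := fun τ => by rw [mul_pow, g.sq, h.sq, denom_mul_SL] }

instance : One Mp2Z where
  one :=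
    { mat := 1
      j := fun _ => 1
      holo := mdifferentiable_const
      sq := fun τ => by simp }

instance : Inv Mp2Z where
  inv g :=
    { mat := g.mat⁻¹
      j := fun τ => (g.j (g.mat⁻¹ • τ))⁻¹
      holo := by
        have h1 : MDifferentiable 𝓘(ℂ) 𝓘(ℂ) (fun τ : ℍ => g.j (g.mat⁻¹ • τ)) :=
          g.holo.comp (holo_smul g.mat⁻¹)
        rw [UpperHalfPlane.mdifferentiable_iff] at h1 ⊢
        exact h1.inv (fun z _ => g.j_ne_zero _)
      sq := fun τ => by
        have h := denom_mul_SL g.mat g.mat⁻¹ τ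
        rw [inv_pow, g.sq]
        rw [mul_inv_cancel] at h
        refine (eq_inv_of_mul_eq_one_right (h.symm.trans ?_)).symm
        simp }

@[simp] theorem mul_mat (g h : Mp2Z) : (g * h).mat = g.mat * h.mat := rfl
@[simp] theorem mul_j (g h : Mp2Z) (τ : ℍ) : (g * h).j τ = g.j (h.mat • τ) * h.j τ := rfl
@[simp] theorem one_mat : (1 : Mp2Z).mat = 1 := rfl
@[simp] theorem one_j (τ : ℍ) : (1 : Mp2Z).j τ = 1 := rfl
@[simp] theorem inv_mat (g : Mp2Z) : (g⁻¹).mat = g.mat⁻¹ := rfl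
@[simp] theorem inv_j (g : Mp2Z) (τ : ℍ) : (g⁻¹).j τ = (g.j (g.mat⁻¹ • τ))⁻¹ := rfl

instance : Group Mp2Z :=
  Group.ofLeftAxioms
    (fun a b c => Mp2Z.ext (by simp [mul_assoc]) (by funext τ; simp [mul_assoc, mul_smul]))
    (fun a => Mp2Z.ext (by simp) (by funext τ; simp))
    (fun a => Mp2Z.ext (by simp) (by
      funext τ
      simp [inv_mul_cancel₀ (a.j_ne_zero τ)]))

/-- The projection to `SL₂(ℤ)`. -/
def toSL : Mp2Z →* SL(2, ℤ) where
  toFun := Mp2Z.mat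
  map_one' := rfl
  map_mul' _ _ := rfl

/-- `S = ((0 -1; 1 0), √τ)`, with the principal branch of the square root. -/
def S : Mp2Z where
  mat := ModularGroup.S
  j := fun τ => (τ : ℂ) ^ (1 / 2 : ℂ)
  holo := by
    rw [UpperHalfPlane.mdifferentiable_iff]
    have : DifferentiableOn ℂ (fun z : ℂ => z ^ (1 / 2 : ℂ)) {z | 0 < z.im} := by
      intro z hz
      exact (DifferentiableAt.cpow_const differentiableAt_id
        (Or.inr (ne_of_gt hz))).differentiableWithinAt
    refine this.congr (fun z hz => ?_)
    simp [Function.comp, ofComplex_apply_of_im_pos hz]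
  sq := fun τ => by
    rw [← Complex.cpow_nat_mul]
    simp

/-- `T = ((1 1; 0 1), 1)`. -/
def T : Mp2Z where
  mat := ModularGroup.T
  j := fun _ => 1
  holo := mdifferentiable_const
  sq := fun τ => by
    rw [ModularGroup.denom_apply]
    simp [ModularGroup.T]

end Mp2Z

/-- The subgroup `MΓ₀(4)` of `Mp₂(ℤ)` of the elements with `c ≡ 0 mod 4`. -/
def MGamma04 : Subgroup Mp2Z := (CongruenceSubgroup.Gamma0 4).comap Mp2Z.toSL

/-! ### Even lattices and discriminant forms -/

/-- A non-degenerate even integral symmetric bilinear form on an abelian group `Λ`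
(in the sequel `Λ` is free of finite rank). -/
structure EvenLattice (Λ : Type*) [AddCommGroup Λ] where
  form : LinearMap.BilinForm ℤ Λ
  symm : ∀ x y, form x y = form y x
  nondegenerate : form.Nondegenerate
  even : ∀ x, Even (form x x)

namespace EvenLattice

variable {Λ : Type*} [AddCommGroup Λ] (L : EvenLattice Λ)

/-- The form on `Λ ⊗ ℚ`. -/
def formQ : LinearMap.BilinForm ℚ (ℚ ⊗[ℤ] Λ) := L.form.baseChange ℚ

/-- The quadratic form `x ↦ ⟨x, x⟩` on `Λ ⊗ ℝ`. -/
def quadR : QuadraticForm ℝ (ℝ ⊗[ℤ] Λ) := (L.form.baseChange ℝ).toQuadraticMap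

/-- `b⁺(Λ)`. -/
def bPlus : ℕ := sigPos L.quadR

/-- `b⁻(Λ)`. -/
def bMinus : ℕ := sigNeg L.quadR

/-- `σ(Λ) = b⁺(Λ) - b⁻(Λ)`. -/
def sigma : ℤ := (L.bPlus : ℤ) - L.bMinus

/-- `Λ` as a subgroup of `Λ ⊗ ℚ`. -/
def lat (_ : EvenLattice Λ) : AddSubgroup (ℚ ⊗[ℤ] Λ) :=
  (TensorProduct.mk ℤ ℚ Λ 1).toAddMonoidHom.range

/-- The dual lattice `Λ^∨ ⊂ Λ ⊗ ℚ`. -/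
def dual : AddSubgroup (ℚ ⊗[ℤ] Λ) where
  carrier := {x | ∀ y ∈ L.lat, ∃ n : ℤ, L.formQ x y = n}
  zero_mem' := fun y _ => ⟨0, by simp⟩
  add_mem' := fun {a c} ha hc y hy => by
    obtain ⟨m, hm⟩ := ha y hy
    obtain ⟨n, hn⟩ := hc y hy
    exact ⟨m + n, by simp [hm, hn]⟩
  neg_mem' := fun {a} ha y hy => by
    obtain ⟨m, hm⟩ := ha y hy
    exact ⟨-m, by simp [hm]⟩

/-- The discriminant group `A_Λ = Λ^∨ / Λ`. -/
abbrev DiscGroup : Type _ := L.dual ⧸ L.lat.addSubgroupOf L.dual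

theorem formQ_tmul (v w : Λ) : L.formQ (1 ⊗ₜ v) (1 ⊗ₜ w) = L.form v w := by
  simp [formQ]

theorem formQ_comm (x y : ℚ ⊗[ℤ] Λ) : L.formQ x y = L.formQ y x := by
  induction x using TensorProduct.induction_on with
  | zero => simp
  | add x x' hx hx' => simp [hx, hx']
  | tmul a v =>
    induction y using TensorProduct.induction_on with
    | zero => simp
    | add y y' hy hy' => simp [hy, hy']
    | tmul c w => simp [formQ, L.symm v w, mul_comm]

theorem formQ_lat {x : ℚ ⊗[ℤ] Λ} (hx : x ∈ L.lat) : ∃ n : ℤ, L.formQ x x = 2 * n := by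
  obtain ⟨v, rfl⟩ := hx
  obtain ⟨n, hn⟩ := L.even v
  refine ⟨n, ?_⟩
  refine (L.formQ_tmul v v).trans ?_
  rw [hn]
  push_cast
  ring

theorem lat_le_dual : L.lat ≤ L.dual := by
  rintro _ ⟨v, rfl⟩ _ ⟨w, rfl⟩
  exact ⟨L.form v w, L.formQ_tmul v w⟩

theorem sub_mem_lat {x y : L.dual} (h : QuotientAddGroup.leftRel (L.lat.addSubgroupOf L.dual) x y) :
    (y : ℚ ⊗[ℤ] Λ) - x ∈ L.lat := by
  have := QuotientAddGroup.leftRel_apply.mp h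
  rw [AddSubgroup.mem_addSubgroupOf] at this
  simpa [sub_eq_neg_add] using this

/-- The discriminant quadratic form `A_Λ → ℚ/2ℤ`, `γ ↦ γ²`. -/
def q : L.DiscGroup → AddCircle (2 : ℚ) :=
  Quotient.lift (fun x : L.dual => ((L.formQ x x : ℚ) : AddCircle (2 : ℚ))) (by
    intro x y hxy
    have h := L.sub_mem_lat hxy
    obtain ⟨m, hm⟩ := x.2 _ h
    obtain ⟨n, hn⟩ := L.formQ_lat h
    have key : L.formQ y y = L.formQ x x + ((m + n : ℤ) : ℚ) * 2 := by
      have hc := L.formQ_comm x y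
      simp only [map_sub, LinearMap.sub_apply] at hm hn
      push_cast
      linarith
    change ((L.formQ x x : ℚ) : AddCircle (2 : ℚ)) = ((L.formQ y y : ℚ) : AddCircle (2 : ℚ))
    rw [key, AddCircle.coe_add, left_eq_add, AddCircle.coe_eq_zero_iff]
    exact ⟨m + n, by simp⟩)

/-- The discriminant bilinear form `A_Λ × A_Λ → ℚ/ℤ`. -/
def b : L.DiscGroup → L.DiscGroup → AddCircle (1 : ℚ) :=
  Quotient.lift₂ (fun x y : L.dual => ((L.formQ x y : ℚ) : AddCircle (1 : ℚ))) (by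
    intro x y x' y' hx hy
    obtain ⟨m, hm⟩ := y.2 _ (L.sub_mem_lat hx)
    obtain ⟨n, hn⟩ := x'.2 _ (L.sub_mem_lat hy)
    have key : L.formQ x' y' = L.formQ x y + ((m + n : ℤ) : ℚ) * 1 := by
      have h1 := L.formQ_comm x y
      have h2 := L.formQ_comm x' y
      simp only [map_sub] at hm hn
      push_cast
      linarith
    change ((L.formQ x y : ℚ) : AddCircle (1 : ℚ)) = ((L.formQ x' y' : ℚ) : AddCircle (1 : ℚ))
    rw [key, AddCircle.coe_add, left_eq_add, AddCircle.coe_eq_zero_iff]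
    exact ⟨m + n, by simp⟩)

@[simp] theorem q_mk (x : L.dual) :
    L.q (QuotientAddGroup.mk x) = ((L.formQ x x : ℚ) : AddCircle (2 : ℚ)) := rfl

@[simp] theorem b_mk (x y : L.dual) :
    L.b (QuotientAddGroup.mk x) (QuotientAddGroup.mk y)
      = ((L.formQ x y : ℚ) : AddCircle (1 : ℚ)) := rfl

/-- The level: the smallest positive integer `l` with `l λ² / 2 ∈ ℤ` for all `λ ∈ Λ^∨`. -/
def level : ℕ :=
  sInf {l : ℕ | 0 < l ∧ ∀ x ∈ L.dual, ∃ m : ℤ, (l : ℚ) * L.formQ x x / 2 = m}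

/-- `Λ` is 2-elementary: `A_Λ ≅ (ℤ/2ℤ)^l` for some `l`. -/
def IsTwoElementary : Prop := ∃ l : ℕ, Nonempty (L.DiscGroup ≃+ (Fin l → ZMod 2))

/-- `l(Λ) = dim A_Λ` over `ℤ/2ℤ` (for a 2-elementary lattice). -/
def len : ℕ := Nat.log 2 (Nat.card L.DiscGroup)

theorem len_eq {l : ℕ} (e : L.DiscGroup ≃+ (Fin l → ZMod 2)) : L.len = l := by
  rw [len, Nat.card_congr e.toEquiv]
  simp [Nat.log_pow]


/-! ### The characteristic element of a 2-elementary discriminant form -/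

theorem b_add_left (x y z : L.DiscGroup) : L.b (x + y) z = L.b x z + L.b y z := by
  induction x using QuotientAddGroup.induction_on with | _ x
  induction y using QuotientAddGroup.induction_on with | _ y
  induction z using QuotientAddGroup.induction_on with | _ z
  rw [← QuotientAddGroup.mk_add, b_mk, b_mk, b_mk, ← AddCircle.coe_add]
  simp

theorem b_comm (x y : L.DiscGroup) : L.b x y = L.b y x := by
  induction x using QuotientAddGroup.induction_on with | _ x
  induction y using QuotientAddGroup.induction_on with | _ y
  rw [b_mk, b_mk, L.formQ_comm]

theorem b_add_right (x y z : L.DiscGroup) : L.b x (y + z) = L.b x y + L.b x z := by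
  rw [b_comm, b_add_left, b_comm, L.b_comm z]

theorem b_zero_left (y : L.DiscGroup) : L.b 0 y = 0 := by
  have := L.b_add_left 0 0 y
  simpa using this

theorem formQ_nondegenerate [Module.Free ℤ Λ] [Module.Finite ℤ Λ] : L.formQ.Nondegenerate := by
  classical
  let bas := Module.Free.chooseBasis ℤ Λ
  rw [LinearMap.BilinForm.nondegenerate_iff_det_ne_zero (bas.baseChange ℚ)]
  have h := (LinearMap.BilinForm.nondegenerate_iff_det_ne_zero bas).mp L.nondegenerate
  have key : LinearMap.BilinForm.toMatrix (bas.baseChange ℚ) L.formQ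
      = (LinearMap.BilinForm.toMatrix bas L.form).map (Int.castRingHom ℚ) := by
    ext i j
    simp [LinearMap.BilinForm.toMatrix_apply, formQ]
  rw [key, ← RingHom.mapMatrix_apply, ← RingHom.map_det]
  simpa using h

theorem eq_zero_of_b_eq_zero [Module.Free ℤ Λ] [Module.Finite ℤ Λ] {x : L.DiscGroup}
    (h : ∀ y, L.b y x = 0) : x = 0 := by
  classical
  induction x using QuotientAddGroup.induction_on with | _ x
  rw [QuotientAddGroup.eq_zero_iff, AddSubgroup.mem_addSubgroupOf]
  let bas := (Module.Free.chooseBasis ℤ Λ).baseChange ℚ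
  have hint : ∀ y ∈ L.dual, ∃ n : ℤ, L.formQ y x = n := by
    intro y hy
    have h1 := h (QuotientAddGroup.mk ⟨y, hy⟩)
    rw [b_mk, AddCircle.coe_eq_zero_iff] at h1
    obtain ⟨n, hn⟩ := h1
    exact ⟨n, by rw [← hn]; simp⟩
  let d := L.formQ.dualBasis L.formQ_nondegenerate bas
  have hd : ∀ i, d i ∈ L.dual := by
    rintro i _ ⟨v, rfl⟩
    refine ⟨(Module.Free.chooseBasis ℤ Λ).repr v i, ?_⟩
    have h1 : ((TensorProduct.mk ℤ ℚ Λ 1).toAddMonoidHom v)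
        = ∑ j, ((Module.Free.chooseBasis ℤ Λ).repr v j : ℚ) • bas j := by
      conv_lhs => rw [← (Module.Free.chooseBasis ℤ Λ).sum_repr v]
      rw [map_sum]
      refine Finset.sum_congr rfl fun j _ => ?_
      rw [map_zsmul, Int.cast_smul_eq_zsmul]
      simp [bas]
    rw [h1]
    simp [d, LinearMap.BilinForm.apply_dualBasis_left]
  choose n hn using fun i => hint (d i) (hd i)
  refine ⟨∑ i, n i • Module.Free.chooseBasis ℤ Λ i, ?_⟩
  rw [map_sum, ← bas.sum_repr (x : ℚ ⊗[ℤ] Λ)]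
  refine Finset.sum_congr rfl fun i _ => ?_
  have h2 : bas.repr (x : ℚ ⊗[ℤ] Λ) i = n i := by
    rw [← hn]
    conv_rhs => rw [← bas.sum_repr (x : ℚ ⊗[ℤ] Λ)]
    rw [map_sum]
    simp only [map_smul, d, LinearMap.BilinForm.apply_dualBasis_left, smul_eq_mul]
    simp
  rw [h2, map_zsmul, Int.cast_smul_eq_zsmul]
  simp [bas]

end EvenLattice

/-- `x ↦ e^{2πix}` on `ℚ/ℤ`. -/
def eOne : AddCircle (1 : ℚ) → ℂ :=
  Function.Periodic.lift (f := fun x : ℚ => cexp (2 * π * I * x)) (c := 1) (by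
    intro x
    push_cast
    rw [mul_add, Complex.exp_add, mul_one, Complex.exp_two_pi_mul_I, mul_one])

/-- `x ↦ e^{πix}` on `ℚ/2ℤ`. -/
def eHalf : AddCircle (2 : ℚ) → ℂ :=
  Function.Periodic.lift (f := fun x : ℚ => cexp (π * I * x)) (c := 2) (by
    intro x
    push_cast
    rw [mul_add, Complex.exp_add, show (π * I * 2 : ℂ) = 2 * π * I by ring,
      Complex.exp_two_pi_mul_I, mul_one])

@[simp] theorem eOne_coe (x : ℚ) : eOne (x : AddCircle (1 : ℚ)) = cexp (2 * π * I * x) := rfl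

@[simp] theorem eHalf_coe (x : ℚ) : eHalf (x : AddCircle (2 : ℚ)) = cexp (π * I * x) := rfl

theorem eOne_zero : eOne 0 = 1 := by
  have := eOne_coe 0
  simpa using this

theorem eOne_add (x y : AddCircle (1 : ℚ)) : eOne (x + y) = eOne x * eOne y := by
  induction x using QuotientAddGroup.induction_on with | _ x
  induction y using QuotientAddGroup.induction_on with | _ y
  change eOne ((x + y : ℚ) : AddCircle (1 : ℚ)) = eOne (x : AddCircle (1 : ℚ)) * eOne y
  rw [eOne_coe, eOne_coe, eOne_coe, ← Complex.exp_add]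
  push_cast
  ring_nf

theorem eq_zero_of_eOne_eq_one {x : AddCircle (1 : ℚ)} (h : eOne x = 1) : x = 0 := by
  induction x using QuotientAddGroup.induction_on with | _ x
  change eOne (x : AddCircle (1 : ℚ)) = 1 at h
  rw [eOne_coe, Complex.exp_eq_one_iff] at h
  obtain ⟨n, hn⟩ := h
  have h2 : (x : ℂ) = n := by
    have : (2 * π * I : ℂ) ≠ 0 := Complex.two_pi_I_ne_zero
    apply mul_left_cancel₀ this
    rw [hn]
    ring
  have h3 : x = n := by exact_mod_cast h2
  change (x : AddCircle (1 : ℚ)) = 0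
  rw [AddCircle.coe_eq_zero_iff]
  exact ⟨n, by simp [h3]⟩

theorem eOne_injective : Function.Injective eOne := by
  intro x y h
  have h1 : eOne (x - y) * eOne y = eOne y := by rw [← eOne_add, sub_add_cancel, h]
  have h2 : eOne y ≠ 0 := by
    induction y using QuotientAddGroup.induction_on with | _ y
    exact Complex.exp_ne_zero _
  have h3 := eq_zero_of_eOne_eq_one (mul_right_cancel₀ h2 (h1.trans (one_mul _).symm))
  exact sub_eq_zero.mp h3

namespace EvenLattice

variable {Λ : Type*} [AddCommGroup Λ] (L : EvenLattice Λ)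

/-- The defining property of the element `1_Λ`: `⟨γ, 1_Λ⟩ ≡ γ² mod ℤ` for all `γ`. -/
def IsCharacteristic (x : L.DiscGroup) : Prop := ∀ γ, L.b γ x = L.b γ γ

theorem existsUnique_isCharacteristic [Module.Free ℤ Λ] [Module.Finite ℤ Λ]
    (hL : L.IsTwoElementary) : ∃! x, L.IsCharacteristic x := by
  obtain ⟨l, ⟨e⟩⟩ := hL
  have htor : ∀ γ : L.DiscGroup, γ + γ = 0 := by
    intro γ
    apply e.injective
    rw [map_add, map_zero]
    funext i
    exact CharTwo.add_self_eq_zero _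
  have : Fintype L.DiscGroup := Fintype.ofEquiv _ e.toEquiv.symm
  let χ : L.DiscGroup → AddChar L.DiscGroup ℂ := fun x =>
    { toFun := fun γ => eOne (L.b γ x)
      map_zero_eq_one' := by rw [b_zero_left, eOne_zero]
      map_add_eq_mul' := fun γ δ => by rw [b_add_left, eOne_add] }
  have hinj : ∀ x y : L.DiscGroup, (∀ γ, L.b γ x = L.b γ y) → x = y := by
    intro x y h
    rw [← sub_eq_zero]
    apply L.eq_zero_of_b_eq_zero
    intro γ
    have h1 := L.b_add_right γ (x - y) y
    rw [sub_add_cancel, h γ] at h1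
    exact right_eq_add.mp h1
  have hχ : Function.Injective χ := fun x y h => hinj x y fun γ =>
    eOne_injective (DFunLike.congr_fun h γ)
  have hbij : Function.Bijective χ :=
    (Fintype.bijective_iff_injective_and_card χ).mpr ⟨hχ, AddChar.card_eq.symm⟩
  let ψ : AddChar L.DiscGroup ℂ :=
    { toFun := fun γ => eOne (L.b γ γ)
      map_zero_eq_one' := by rw [b_zero_left, eOne_zero]
      map_add_eq_mul' := fun γ δ => by
        rw [← eOne_add]
        congr 1
        have h2 : L.b γ δ + L.b γ δ = 0 := by rw [← b_add_left, htor, b_zero_left]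
        rw [b_add_left, b_add_right, b_add_right, L.b_comm δ γ,
          show L.b γ γ + L.b γ δ + (L.b γ δ + L.b δ δ)
            = L.b γ γ + L.b δ δ + (L.b γ δ + L.b γ δ) by abel, h2, add_zero] }
  obtain ⟨x, hx⟩ := hbij.2 ψ
  have hx' : L.IsCharacteristic x := fun γ => eOne_injective (DFunLike.congr_fun hx γ)
  exact ⟨x, hx', fun y hy => hinj y x fun γ => (hy γ).trans (hx' γ).symm⟩

open Classical in
/-- The element `1_Λ` of `A_Λ`. -/
def one : L.DiscGroup := if h : ∃ x, L.IsCharacteristic x then h.choose else 0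

theorem one_spec [Module.Free ℤ Λ] [Module.Finite ℤ Λ] (hL : L.IsTwoElementary) :
    L.IsCharacteristic L.one := by
  have h := (L.existsUnique_isCharacteristic hL).exists
  rw [one, dif_pos h]
  exact h.choose_spec

/-! ### The space `ℂ[A_Λ]` and the Weil representation

`A_Λ` is finite, and `ℂ[A_Λ]` is identified with the space of functions `A_Λ → ℂ`:
the function `u` stands for `∑_γ u(γ) e_γ`. -/

open Classical in
/-- The basis vector `e_γ`. -/
def e (γ : L.DiscGroup) : L.DiscGroup → ℂ := fun δ => if δ = γ then 1 else 0

open Classical in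
/-- `v_k = ∑ e_δ` over the `δ` with `δ² ≡ k/2 mod 2`. -/
def v (k : ℕ) : L.DiscGroup → ℂ :=
  fun δ => if L.q δ = (((k : ℚ) / 2 : ℚ) : AddCircle (2 : ℚ)) then 1 else 0

/-- The formulas for the generators `T` and `S` that determine the Weil representation:
`ρ(T) e_γ = e^{πiγ²} e_γ` and
`ρ(S) e_γ = i^{-σ/2} |A|^{-1/2} ∑_δ e^{-2πi⟨γ,δ⟩} e_δ`. -/
def IsWeilRep (ρ : Mp2Z →* Module.End ℂ (L.DiscGroup → ℂ)) : Prop :=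
  (∀ γ, ρ Mp2Z.T (L.e γ) = eHalf (L.q γ) • L.e γ) ∧
  (∀ γ, ρ Mp2Z.S (L.e γ) =
    (cexp (-(π * I * L.sigma / 4)) / (Real.sqrt (Nat.card L.DiscGroup) : ℂ)) •
      (fun δ => eOne (-(L.b γ δ))))

open Classical in
/-- The Weil representation `ρ_Λ`: the homomorphism given by the formulas for `T` and `S`. -/
def weilRep : Mp2Z →* Module.End ℂ (L.DiscGroup → ℂ) :=
  if h : ∃ ρ, L.IsWeilRep ρ then h.choose else 1

/-! ### Modular forms of type `ρ_Λ` -/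

/-- `F_γ(τ) = ∑_{k ∈ (1/l)ℤ} c_γ(k) e^{2πikτ}` with `c_γ(k) = 0` for `k ≪ 0`, where `l` is the
level; `c γ n` is the coefficient with `k = n / l`. -/
def HasFourierExpansion (F : ℍ → L.DiscGroup → ℂ) (c : L.DiscGroup → ℤ → ℂ) : Prop :=
  (∃ N : ℤ, ∀ γ, ∀ n < N, c γ n = 0) ∧
  ∀ (τ : ℍ) (γ : L.DiscGroup),
    HasSum (fun n : ℤ => c γ n * cexp (2 * π * I * (n / L.level) * τ)) (F τ γ)

/-- `F` is a modular form for `Mp₂(ℤ)` of type `ρ_Λ` and weight `m / 2`. -/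
structure IsModularFormOfType (m : ℤ) (F : ℍ → L.DiscGroup → ℂ) : Prop where
  holo : ∀ γ, MDifferentiable 𝓘(ℂ) 𝓘(ℂ) (fun τ => F τ γ)
  transform : ∀ (g : Mp2Z) (τ : ℍ), F (g.mat • τ) = g.j τ ^ m • L.weilRep g (F τ)
  fourier : ∃ c, L.HasFourierExpansion F c

/-- `F` has integral Fourier coefficients. -/
def HasIntegralFourierCoefficients (F : ℍ → L.DiscGroup → ℂ) : Prop :=
  ∃ c : L.DiscGroup → ℤ → ℤ, L.HasFourierExpansion F (fun γ n => (c γ n : ℂ))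

/-! ### The induction from `MΓ₀(4)` to `Mp₂(ℤ)` -/

/-- `φ|_g(τ) = φ(gτ) j(g, τ)^{-m}` for `φ` of weight `m / 2`. -/
def _root_.slashMp (m : ℤ) (φ : ℍ → ℂ) (g : Mp2Z) (τ : ℍ) : ℂ :=
  φ (g.mat • τ) * g.j τ ^ (-m)

/-- The set of cosets `MΓ₀(4) \ Mp₂(ℤ)`. -/
abbrev _root_.Cosets : Type := Quotient (QuotientGroup.rightRel MGamma04)

/-- `𝓑_Λ[φ](τ) = ∑_{g ∈ MΓ₀(4) \ Mp₂(ℤ)} φ|_g(τ) ρ_Λ(g⁻¹) e_0` for `φ` of weight `m / 2`, computed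
with the representatives `s c` of the cosets `c`. -/
def induced (s : Cosets → Mp2Z) (m : ℤ) (φ : ℍ → ℂ) (τ : ℍ) : L.DiscGroup → ℂ :=
  ∑ᶠ c : Cosets, slashMp m φ (s c) τ • L.weilRep (s c)⁻¹ (L.e 0)

/-! ### The action of the orthogonal group -/

/-- The group of isometries of `Λ`. -/
abbrev O : Type _ := L.form.IsometryEquiv L.form

/-- The extension of an isometry to `Λ ⊗ ℚ`. -/
def extend (g : L.O) : (ℚ ⊗[ℤ] Λ) →ₗ[ℚ] (ℚ ⊗[ℤ] Λ) :=
  g.toLinearEquiv.toLinearMap.baseChange ℚ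

theorem extend_tmul (g : L.O) (a : ℚ) (x : Λ) : L.extend g (a ⊗ₜ x) = a ⊗ₜ (g x) := rfl

theorem extend_lat (g : L.O) {x : ℚ ⊗[ℤ] Λ} (hx : x ∈ L.lat) : L.extend g x ∈ L.lat := by
  obtain ⟨w, rfl⟩ := hx
  exact ⟨g w, rfl⟩

theorem formQ_extend (g : L.O) (x y : ℚ ⊗[ℤ] Λ) :
    L.formQ (L.extend g x) (L.extend g y) = L.formQ x y := by
  induction x using TensorProduct.induction_on with
  | zero => simp
  | add x x' hx hx' => simp [hx, hx']
  | tmul a v =>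
    induction y using TensorProduct.induction_on with
    | zero => simp
    | add y y' hy hy' => simp [hy, hy']
    | tmul c w => simp [extend_tmul, formQ]

theorem extend_symm (g : L.O) (x : ℚ ⊗[ℤ] Λ) : L.extend g ((L.extend g.symm) x) = x := by
  induction x using TensorProduct.induction_on with
  | zero => simp
  | add x x' hx hx' => simp [hx, hx']
  | tmul a v =>
    rw [extend_tmul, extend_tmul]
    exact congrArg _ (g.toLinearEquiv.apply_symm_apply v)

theorem extend_dual (g : L.O) {x : ℚ ⊗[ℤ] Λ} (hx : x ∈ L.dual) : L.extend g x ∈ L.dual := by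
  intro y hy
  obtain ⟨n, hn⟩ := hx _ (L.extend_lat g.symm hy)
  refine ⟨n, ?_⟩
  rw [← hn, ← L.formQ_extend g x, L.extend_symm]

/-- The map `ḡ` induced by `g ∈ O(Λ)` on `A_Λ`. -/
def disc (g : L.O) : L.DiscGroup →+ L.DiscGroup :=
  QuotientAddGroup.map _ _
    (((L.extend g).toAddMonoidHom.comp L.dual.subtype).codRestrict L.dual
      (fun x => L.extend_dual g x.2))
    (fun _ hx => L.extend_lat g hx)

theorem disc_mk (g : L.O) (x : L.dual) :
    L.disc g (QuotientAddGroup.mk x) = QuotientAddGroup.mk ⟨L.extend g x, L.extend_dual g x.2⟩ := rfl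

theorem disc_symm (g : L.O) (γ : L.DiscGroup) : L.disc g ((L.disc g.symm) γ) = γ := by
  induction γ using QuotientAddGroup.induction_on with | _ x
  rw [disc_mk, disc_mk]
  congr 1
  exact Subtype.ext (L.extend_symm g x)

/-- The action of `g ∈ O(Λ)` on `ℂ[A_Λ]`, i.e. the linear map with `g(e_γ) = e_{ḡ(γ)}`
(see `act_e`). -/
def act (g : L.O) : (L.DiscGroup → ℂ) →ₗ[ℂ] (L.DiscGroup → ℂ) :=
  LinearMap.funLeft ℂ ℂ (L.disc g.symm)

theorem act_e (g : L.O) (γ : L.DiscGroup) : L.act g (L.e γ) = L.e (L.disc g γ) := by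
  funext δ
  have : (L.disc g.symm) δ = γ ↔ δ = L.disc g γ :=
    ⟨fun h => by rw [← h, disc_symm], fun h => by rw [h]; exact L.disc_symm g.symm γ⟩
  classical
  exact if_congr this rfl rfl

/-- `Aut(Λ, F) = {g ∈ O(Λ) ; g(F) = F}`. -/
def autSet (F : ℍ → L.DiscGroup → ℂ) : Set L.O := {g | ∀ τ, L.act g (F τ) = F τ}

end EvenLattice

/-! ### The scalar-valued functions -/

/-- `ϑ₂(τ) = ∑_{n ∈ ℤ} q^{(n+1/2)²/2}` with `q = e^{2πiτ}`. -/
def jacobiTheta2 (τ : ℂ) : ℂ := ∑' n : ℤ, cexp (π * I * ((n : ℂ) + 1 / 2) ^ 2 * τ)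

/-- `ϑ₃(τ) = ∑_{n ∈ ℤ} q^{n²/2}` with `q = e^{2πiτ}`. -/
def jacobiTheta3 (τ : ℂ) : ℂ := ∑' n : ℤ, cexp (π * I * (n : ℂ) ^ 2 * τ)

/-- The theta function of the lattice `A₁⁺ = ⟨2⟩`. -/
def thetaA1 (τ : ℂ) : ℂ := jacobiTheta3 (2 * τ)

/-- The theta function of the coset `A₁⁺ + 1/2`. -/
def thetaA1Half (τ : ℂ) : ℂ := jacobiTheta2 (2 * τ)

/-- `η_{1^{-8} 2^8 4^{-8}}(τ) = η(τ)^{-8} η(2τ)^8 η(4τ)^{-8}`. -/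
def etaQuot (τ : ℂ) : ℂ :=
  ModularForm.eta τ ^ (-8 : ℤ) * ModularForm.eta (2 * τ) ^ 8 * ModularForm.eta (4 * τ) ^ (-8 : ℤ)

/-- `f_k^{(0)}`. -/
def f0 (k : ℤ) (τ : ℂ) : ℂ :=
  ModularForm.eta (2 * τ) ^ 8 * thetaA1 τ ^ k / (ModularForm.eta τ ^ 8 * ModularForm.eta (4 * τ) ^ 8)

/-- `f_k^{(1)}`. -/
def f1 (k : ℤ) (τ : ℂ) : ℂ :=
  -16 * (ModularForm.eta (4 * τ) ^ 8 * thetaA1Half τ ^ k / ModularForm.eta (2 * τ) ^ 16)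

/-- The coefficient of `q^l` in the Fourier expansion of `f_k^{(0)}` (as the Fourier integral over
the segment from `i` to `i + 1`). -/
def c0 (k l : ℤ) : ℂ :=
  ∫ x in (0 : ℝ)..1, f0 k ((x : ℂ) + I) * cexp (-(2 * π * I * l * ((x : ℂ) + I)))

/-- `g_k^{(i)}(τ) = ∑_{l ≡ i mod 4} c_k^{(0)}(l) q^{l/4}`. -/
def gFun (k : ℤ) (i : ℕ) (τ : ℂ) : ℂ :=
  ∑' l : {l : ℤ // l ≡ i [ZMOD 4]}, c0 k l * cexp (2 * π * I * ((l : ℤ) / 4) * τ)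

/-- The `ℂ[A_Λ]`-valued function `F_Λ` on the upper half-plane. -/
def EvenLattice.F {Λ : Type*} [AddCommGroup Λ] (L : EvenLattice Λ) (τ : ℍ) : L.DiscGroup → ℂ :=
  f0 (8 + L.sigma) τ • L.e 0
    + (((2 : ℝ) ^ (((4 - L.sigma - L.len : ℤ) : ℝ) / 2) : ℝ) : ℂ) •
        ∑ l ∈ Finset.range 4, gFun (8 + L.sigma) l τ • L.v l
    + f1 (8 + L.sigma) τ • L.e L.one

end

/-!
The function `F_Λ` is the explicit form of a sum over the six cosets of `MΓ₀(4)` in `Mp₂(ℤ)`, and a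
sum over cosets is modular for formal reasons. The work is in the existence of the Weil
representation, in the evaluation of the six summands, and in the integrality of the coefficients.

**The Weil representation.** `Mp₂(ℤ)` is presented by `S` and `T` with the relations `S⁸ = 1` and
`STS = T⁻¹ST⁻¹` (`Mp2Z.exists_monoidHom`): words have a normal form built from positive words in `T`
and `TST`, whose matrices are non-negative. Hence the given operators on `ℂ[A_Λ]` define a
representation as soon as they satisfy these relations (`EvenLattice.exists_isWeilRep`). Completing
the square turns the second relation into Milgram's formula `∑_γ e^{πiγ²} = √|A_Λ| e^{πiσ/4}`
(`EvenLattice.gaussSum_eq`). It is proved by comparison with an orthogonal sublattice of finite index,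
whose Gauss sum is a product of one-dimensional ones (`gauss_sum_even`), which come from the
transformation formula of the theta function.

**The sum over cosets.** The group `MΓ₀(4)` is generated by `T`, `ST⁴S⁻¹` and `S²`, and its six cosets
are represented by `1`, `S`, `ST`, `ST²`, `ST³` and `ST²S` (`Mp2Z.MGamma04_eq`,
`Mp2Z.cosetRep_bijective`). Each generator acts by the same scalar on `e_0` and, through the slash
action of weight `σ/2`, on `φ = f^{(0)}` (`EvenLattice.isStab_of_mem`). So the summands depend on
cosets only, and the sum transforms as required (`EvenLattice.indFun_smul`).

**The summands.** The Jacobi triple product (`hasSum_jacobi_triple_product`) implies Gauss' identities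
for the theta constants, and with these
`f_k^{(0)}(τ) = 16 ϑ₃(2τ)^k / (ϑ₂ϑ₄(2τ))⁴` and `f_k^{(1)}(τ) = -16 ϑ₂(2τ)^k / (ϑ₃ϑ₄(2τ))⁴`
(`f0_eq`, `f1_eq`). The behaviour of `ϑ₂, ϑ₃, ϑ₄` under `τ ↦ τ + 1` and `τ ↦ -1/τ` shows that `φ|STʲ`
is a multiple of `f^{(0)}((τ + j)/4)` and `φ|ST²S` one of `f^{(1)}`. On the side of the representation,
`(STʲ)⁻¹` maps `e_0` to a multiple of `∑_γ e^{-πijγ²} e_γ`, and `(ST²S)⁻¹` maps it to a multiple of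
`e_{1_Λ}`. The sum over `j` then extracts the part of the `q`-expansion with exponents `≡ 2γ²` modulo
`4`, that is, `g^{(i)}` for `γ² ≡ i/2` (`gFun_eq`), and the sum over cosets is `F_Λ`
(`EvenLattice.F_eq_indFun`).

**Fourier coefficients and symmetry.** The theta constants and their reciprocals have integral
`q`-expansions up to powers of `q` and `2` (`IsIntSeries`). The exponents of `F_Λ` lie in `(1/N) ℤ`
because `1_Λ² ≡ σ/2` (`EvenLattice.eHalf_q_one`), obtained by shifting the Gauss sum by `1_Λ`. For the
powers of `2`, the Gauss sum is a Gaussian integer, which forces `l ≡ σ` modulo `2`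
(`EvenLattice.even_len_add_sigma`); as `l` is at most the rank `b⁺ + b⁻`, the exponent
`(4 - σ - l)/2` is at least `2 - b⁺ ≥ 0`, and `12 + σ ≥ 0` takes care of `f^{(1)}`. Finally, the
component of `F_Λ` at `γ` depends only on `γ²` and on whether `γ` is `0` or `1_Λ`, so `F_Λ` is invariant
under all isometries.
-/

noncomputable section

/-! ### Square roots on the upper half-plane -/

/-- The principal square root maps the upper half-plane into the open first quadrant. -/
theorem cpow_half_mem_quadrant {z : ℂ} (hz : 0 < z.im) :
    0 < (z ^ (1 / 2 : ℂ)).re ∧ 0 < (z ^ (1 / 2 : ℂ)).im := by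
  have hz0 : z ≠ 0 := by rintro rfl; simp at hz
  have h1 : 0 < z.arg := by
    rcases (Complex.arg_nonneg_iff.mpr hz.le).lt_or_eq with h | h
    · exact h
    · have := Complex.arg_eq_zero_iff.mp h.symm
      linarith [this.2]
  have h2 : z.arg < π := by
    rcases (Complex.arg_le_pi z).lt_or_eq with h | h
    · exact h
    · have := Complex.arg_eq_pi_iff.mp h
      linarith [this.2]
  have him : (Complex.log z * (1 / 2)).im = z.arg / 2 := by
    simp [Complex.log_im, Complex.mul_im]; ring
  rw [Complex.cpow_def_of_ne_zero hz0]
  refine ⟨?_, ?_⟩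
  · rw [Complex.exp_re, him]
    exact mul_pos (Real.exp_pos _) (Real.cos_pos_of_mem_Ioo ⟨by linarith, by linarith⟩)
  · rw [Complex.exp_im, him]
    exact mul_pos (Real.exp_pos _) (Real.sin_pos_of_pos_of_lt_pi (by linarith) (by linarith))

theorem cpow_half_sq (z : ℂ) : (z ^ (1 / 2 : ℂ)) ^ 2 = z := by
  rw [← Complex.cpow_nat_mul]; simp

/-- Two complex numbers with the same square and positive imaginary parts agree. -/
theorem eq_of_sq_eq_of_im_pos {x y : ℂ} (h : x ^ 2 = y ^ 2) (hx : 0 < x.im) (hy : 0 < y.im) :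
    x = y := by
  rcases sq_eq_sq_iff_eq_or_eq_neg.mp h with h | h
  · exact h
  · rw [h, Complex.neg_im] at hx
    linarith

theorem im_mul_pos_of_quadrant {x y : ℂ} (hx : 0 < x.re ∧ 0 < x.im) (hy : 0 < y.re ∧ 0 < y.im) :
    0 < (x * y).im := by
  rw [Complex.mul_im]
  have := mul_pos hx.1 hy.2
  have := mul_pos hx.2 hy.1
  linarith

/-- The cocycle relation of the principal square root when the product stays in the upper
half-plane. -/
theorem cpow_half_mul {z w : ℂ} (hz : 0 < z.im) (hw : 0 < w.im) (hzw : 0 < (z * w).im) :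
    z ^ (1 / 2 : ℂ) * w ^ (1 / 2 : ℂ) = (z * w) ^ (1 / 2 : ℂ) := by
  refine eq_of_sq_eq_of_im_pos ?_
    (im_mul_pos_of_quadrant (cpow_half_mem_quadrant hz) (cpow_half_mem_quadrant hw))
    (cpow_half_mem_quadrant hzw).2
  rw [mul_pow, cpow_half_sq, cpow_half_sq, cpow_half_sq]

/-- The sheet of the square root picked by `S²` has the constant value `√(-1/z) √z = i`. -/
theorem cpow_half_mul_neg_inv {z : ℂ} (hz : 0 < z.im) :
    (-z⁻¹) ^ (1 / 2 : ℂ) * z ^ (1 / 2 : ℂ) = I := by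
  have hz0 : z ≠ 0 := by rintro rfl; simp at hz
  have hz' : 0 < (-z⁻¹).im := by
    rw [Complex.neg_im, Complex.inv_im]
    have := Complex.normSq_pos.mpr hz0
    rw [neg_div, neg_neg]; positivity
  refine eq_of_sq_eq_of_im_pos ?_
    (im_mul_pos_of_quadrant (cpow_half_mem_quadrant hz') (cpow_half_mem_quadrant hz)) (by simp)
  rw [mul_pow, cpow_half_sq, cpow_half_sq]
  simp [hz0]

/-! ### Generators and relations of the metaplectic group -/

namespace Mp2Z

theorem S_smul_coe (τ : ℍ) : ((S.mat • τ : ℍ) : ℂ) = -(τ : ℂ)⁻¹ := by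
  change ((ModularGroup.S • τ : ℍ) : ℂ) = _
  rw [UpperHalfPlane.modular_S_smul]
  simp [inv_neg]

theorem T_smul_coe (τ : ℍ) : ((T.mat • τ : ℍ) : ℂ) = τ + 1 := by
  change ((ModularGroup.T • τ : ℍ) : ℂ) = _
  rw [UpperHalfPlane.modular_T_smul]
  simp [add_comm]

theorem S_j (τ : ℍ) : S.j τ = (τ : ℂ) ^ (1 / 2 : ℂ) := rfl
theorem T_j (τ : ℍ) : T.j τ = 1 := rfl
theorem S_mat : S.mat = ModularGroup.S := rfl
theorem T_mat : T.mat = ModularGroup.T := rfl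

theorem S_sq_mat : (S ^ 2).mat = -1 := by
  rw [pow_two, mul_mat, S_mat]
  ext i j; fin_cases i <;> fin_cases j <;> simp [ModularGroup.coe_S]

theorem S_sq_j (τ : ℍ) : (S ^ 2).j τ = I := by
  rw [pow_two, mul_j, S_j, S_j, S_smul_coe]
  exact cpow_half_mul_neg_inv τ.im_pos

theorem SL_neg_one_smul (τ : ℍ) : (-1 : SL(2, ℤ)) • τ = τ := by
  rw [ModularGroup.SL_neg_smul, one_smul]

theorem S_pow_four_mat : (S ^ 4).mat = 1 := by
  rw [show 4 = 2 + 2 from rfl, pow_add, mul_mat, S_sq_mat]; simp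

theorem S_pow_four_j (τ : ℍ) : (S ^ 4).j τ = -1 := by
  rw [show 4 = 2 + 2 from rfl, pow_add, mul_j, S_sq_j, S_sq_j]; simp

theorem S_pow_eight : S ^ 8 = 1 := by
  rw [show 8 = 4 + 4 from rfl, pow_add]
  refine Mp2Z.ext ?_ ?_
  · rw [mul_mat, S_pow_four_mat]; simp
  · funext τ; rw [mul_j, S_pow_four_j, S_pow_four_j]; simp

/-- The relation holds in `SL₂(ℤ)`; the square roots agree because both sides have positive
imaginary part. -/
theorem S_mul_T_mul_S : S * T * S = T⁻¹ * S * T⁻¹ := by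
  refine Mp2Z.ext ?_ ?_
  · simp only [mul_mat, inv_mat, S_mat, T_mat]
    ext i j; fin_cases i <;> fin_cases j <;> simp [ModularGroup.coe_S, ModularGroup.coe_T,
      Matrix.mul_apply, Fin.sum_univ_two]
  · funext τ
    have hT : ((T⁻¹.mat • τ : ℍ) : ℂ) = τ - 1 := by
      have := T_smul_coe (T⁻¹.mat • τ)
      rw [inv_mat, smul_inv_smul] at this
      rw [inv_mat, this]; ring
    have hTj : ∀ τ, T⁻¹.j τ = 1 := by intro τ; rw [inv_j, T_j, inv_one]
    simp only [mul_j, T_j, hTj, mul_one, one_mul, S_j, T_smul_coe, S_smul_coe, hT]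
    have h0 : (τ : ℂ) ≠ 0 := τ.ne_zero
    rw [cpow_half_mul]
    · congr 1; field_simp; ring
    · have := (S.mat • τ).im_pos
      rw [← UpperHalfPlane.coe_im, S_smul_coe] at this
      simpa using this
    · exact τ.im_pos
    · rw [show (-(τ : ℂ)⁻¹ + 1) * τ = τ - 1 by field_simp; ring]
      simpa using τ.im_pos

/-- The kernel of `Mp₂(ℤ) → SL₂(ℤ)` has two elements: a continuous square root of `1` on the
connected upper half-plane is constant. -/
theorem eq_one_or_S_pow_four {g : Mp2Z} (hg : g.mat = 1) : g = 1 ∨ g = S ^ 4 := by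
  have hsq : ∀ τ : ℍ, g.j τ ^ 2 = 1 := fun τ => by rw [g.sq, hg]; simp
  have hc : ContinuousOn g.j Set.univ := g.holo.continuous.continuousOn
  have := (isPreconnected_univ (α := ℍ)).eq_or_eq_neg_of_sq_eq hc
    (continuousOn_const (c := (1 : ℂ))) (fun τ _ => by simp [hsq]) (by simp)
  rcases this with h | h
  · left
    exact Mp2Z.ext hg (funext fun τ => h (Set.mem_univ τ))
  · right
    refine Mp2Z.ext (hg.trans S_pow_four_mat.symm) (funext fun τ => ?_)
    rw [S_pow_four_j, h (Set.mem_univ τ)]; simp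

theorem closure_S_T : Subgroup.closure {S, T} = ⊤ := by
  rw [eq_top_iff]
  intro g _
  have h1 : (Subgroup.closure {S, T}).map toSL = ⊤ := by
    rw [MonoidHom.map_closure, Set.image_pair]
    exact SpecialLinearGroup.SL2Z_generators
  have h2 : toSL g ∈ (Subgroup.closure {S, T}).map toSL := by rw [h1]; trivial
  obtain ⟨h, hh, hgh⟩ := h2
  have hm : (h⁻¹ * g).mat = 1 := by
    have : h.mat = g.mat := hgh
    rw [mul_mat, inv_mat, this, inv_mul_cancel]
  have hS : S ∈ Subgroup.closure {S, T} := Subgroup.subset_closure (by simp)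
  have : h⁻¹ * g ∈ Subgroup.closure {S, T} := by
    rcases eq_one_or_S_pow_four hm with h | h
    · rw [h]; exact one_mem _
    · rw [h]; exact pow_mem hS 4
  simpa using mul_mem hh this

end Mp2Z

section NormalForm

variable {P : Type*} [Group P] {s t : P}

theorem pow_three_of_braid (h : s * t * s = t⁻¹ * s * t⁻¹) : (s * t) ^ 3 = s ^ 2 := by
  have : t * (s * t * s) * t = s := by rw [h]; group
  calc (s * t) ^ 3 = s * (t * (s * t * s) * t) := by simp only [pow_succ, pow_zero]; group
    _ = s ^ 2 := by rw [this, pow_two]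

theorem commute_sq_of_braid (h : s * t * s = t⁻¹ * s * t⁻¹) : Commute (s ^ 2) t := by
  have h1 : Commute (s ^ 2) (s * t) := by
    rw [← pow_three_of_braid h]; exact (Commute.refl _).pow_left 3
  have h2 : Commute (s ^ 2) s⁻¹ := ((Commute.refl s).pow_left 2).inv_right
  simpa using h2.mul_right h1

/-- Words `s^{2k} (st)^a w s^b` with `w` a positive word in `t` and `tst`. -/
def IsNormalForm (s t x : P) : Prop :=
  ∃ k a b : ℕ, ∃ w ∈ Submonoid.closure {t, t * s * t}, a < 3 ∧ b < 2 ∧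
    x = (s ^ 2) ^ k * (s * t) ^ a * w * s ^ b

theorem mem_closure_pair_cases {t r w : P} (hw : w ∈ Submonoid.closure {t, r}) :
    w = 1 ∨ ∃ w' ∈ Submonoid.closure {t, r}, w = t * w' ∨ w = r * w' := by
  induction hw using Submonoid.closure_induction_left with
  | one => exact Or.inl rfl
  | mul_left x hx y hy _ =>
    refine Or.inr ⟨y, hy, ?_⟩
    rcases hx with rfl | hx
    · exact Or.inl rfl
    · rw [Set.mem_singleton_iff] at hx; subst hx; exact Or.inr rfl

theorem IsNormalForm.sq_mul {x : P} (hx : IsNormalForm s t x) : IsNormalForm s t (s ^ 2 * x) := by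
  obtain ⟨k, a, b, w, hw, ha, hb, rfl⟩ := hx
  exact ⟨k + 1, a, b, w, hw, ha, hb, by rw [pow_succ' (s ^ 2) k]; group⟩

theorem IsNormalForm.st_mul (h : s * t * s = t⁻¹ * s * t⁻¹) {x : P} (hx : IsNormalForm s t x) :
    IsNormalForm s t (s * t * x) := by
  obtain ⟨k, a, b, w, hw, ha, hb, rfl⟩ := hx
  have hc : s * t * (s ^ 2) ^ k = (s ^ 2) ^ k * (s * t) := by
    have h1 : Commute (s ^ 2) (s * t) := by
      rw [← pow_three_of_braid h]; exact (Commute.refl _).pow_left 3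
    exact (h1.pow_left k).eq.symm
  have e : s * t * ((s ^ 2) ^ k * (s * t) ^ a * w * s ^ b)
      = (s ^ 2) ^ k * (s * t) ^ (a + 1) * w * s ^ b := by
    rw [pow_succ' (s * t) a, ← mul_assoc, ← mul_assoc, ← mul_assoc, hc]
    simp only [mul_assoc]
  rw [e]
  by_cases ha2 : a + 1 < 3
  · exact ⟨k, a + 1, b, w, hw, ha2, hb, rfl⟩
  · have : a + 1 = 3 := by omega
    refine ⟨k + 1, 0, b, w, hw, by norm_num, hb, ?_⟩
    rw [this, pow_three_of_braid h, pow_succ (s ^ 2) k, pow_zero, mul_one]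

/-- Prefixing `s` to a normal form: for `a = 0` a leading `t` or `tst` of `w` combines with `s` to `st`
or `(st)²`, and for `a > 0` the identity `s · st = s² t` puts a new letter in front of `w`. -/
theorem IsNormalForm.s_mul {x : P} (hx : IsNormalForm s t x) :
    IsNormalForm s t (s * x) := by
  obtain ⟨k, a, b, w, hw, ha, hb, rfl⟩ := hx
  have hc : s * (s ^ 2) ^ k = (s ^ 2) ^ k * s := by
    rw [← pow_mul, ← pow_succ, ← pow_succ']
  have ht : t ∈ Submonoid.closure {t, t * s * t} := Submonoid.subset_closure (by simp)
  have hr : t * s * t ∈ Submonoid.closure {t, t * s * t} := Submonoid.subset_closure (by simp)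
  have e : s * ((s ^ 2) ^ k * (s * t) ^ a * w * s ^ b)
      = (s ^ 2) ^ k * (s * (s * t) ^ a * w * s ^ b) := by
    rw [← mul_assoc, ← mul_assoc, ← mul_assoc, hc]; group
  rw [e]
  interval_cases a
  · rcases mem_closure_pair_cases hw with rfl | ⟨w', hw', rfl | rfl⟩
    · interval_cases b
      · exact ⟨k, 0, 1, 1, one_mem _, by norm_num, by norm_num, by simp⟩
      · exact ⟨k + 1, 0, 0, 1, one_mem _, by norm_num, by norm_num, by
          rw [pow_succ (s ^ 2) k]; simp [pow_two]⟩
    · exact ⟨k, 1, b, w', hw', by norm_num, hb, by simp [mul_assoc]⟩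
    · exact ⟨k, 2, b, w', hw', by norm_num, hb, by simp [mul_assoc, pow_two]⟩
  · exact ⟨k + 1, 0, b, t * w, mul_mem ht hw, by norm_num, hb, by
      rw [pow_succ (s ^ 2) k]; simp [mul_assoc, pow_two]⟩
  · exact ⟨k + 1, 0, b, t * s * t * w, mul_mem hr hw, by norm_num, hb, by
      rw [pow_succ (s ^ 2) k]; simp [mul_assoc, pow_two]⟩

/-- In a group with `s⁸ = 1` and `sts = t⁻¹st⁻¹`, every element of `⟨s, t⟩` has a normal form. -/
theorem isNormalForm_of_mem_closure (h8 : s ^ 8 = 1) (h : s * t * s = t⁻¹ * s * t⁻¹) {x : P}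
    (hx : x ∈ Subgroup.closure {s, t}) : IsNormalForm s t x := by
  have hs3 : s⁻¹ = s ^ 2 * (s ^ 2 * (s ^ 2 * s)) := by
    rw [inv_eq_iff_mul_eq_one, ← h8]
    simp only [pow_succ, pow_zero]; group
  have hu : (s * t)⁻¹ = s ^ 2 * (s ^ 2 * (s ^ 2 * ((s * t) * (s * t)))) := by
    rw [inv_eq_iff_mul_eq_one, ← h8]
    have h3 := pow_three_of_braid h
    have hc : Commute (s ^ 2) (s * t) := by
      rw [← h3]; exact (Commute.refl _).pow_left 3
    calc s * t * (s ^ 2 * (s ^ 2 * (s ^ 2 * ((s * t) * (s * t)))))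
        = (s * t) * (s ^ 2) ^ 3 * (s * t) * (s * t) := by
          simp only [pow_succ, pow_zero]; group
      _ = (s ^ 2) ^ 3 * (s * t) ^ 3 := by
          rw [← (hc.pow_left 3).eq, pow_succ (s * t) 2, pow_two (s * t)]; simp only [mul_assoc]
      _ = s ^ 8 := by rw [h3, ← pow_succ, ← pow_mul]
  have hS : ∀ x, IsNormalForm s t x → IsNormalForm s t (s * x) := fun _ hx => hx.s_mul
  have hSi : ∀ x, IsNormalForm s t x → IsNormalForm s t (s⁻¹ * x) := by
    intro x hx
    rw [hs3]; simp only [mul_assoc]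
    exact (((hx.s_mul).sq_mul).sq_mul).sq_mul
  induction hx using Subgroup.closure_induction_left with
  | one => exact ⟨0, 0, 0, 1, one_mem _, by norm_num, by norm_num, by simp⟩
  | mul_left x hx y _ ih =>
    rcases hx with rfl | hx
    · exact hS _ ih
    · rw [Set.mem_singleton_iff] at hx; subst hx
      have := hSi _ (ih.st_mul h)
      simpa [mul_assoc] using this
  | inv_mul_cancel x hx y _ ih =>
    rcases hx with rfl | hx
    · exact hSi _ ih
    · rw [Set.mem_singleton_iff] at hx; subst hx
      have e : x⁻¹ * y = (s * x)⁻¹ * (s * y) := by group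
      rw [e, hu]
      have := ((((((ih.s_mul).st_mul h).st_mul h).sq_mul).sq_mul).sq_mul)
      simpa [mul_assoc] using this

end NormalForm

/-- Positive words in `T` and `TST` have non-negative matrices, which are not diagonal unless the
word is empty. -/
theorem positive_word_matrix {G : Type*} [Group G] (t : G) (s : G) {w : Mp2Z × G}
    (hw : w ∈ Submonoid.closure {((Mp2Z.T, t) : Mp2Z × G), (Mp2Z.T, t) * (Mp2Z.S, s) * (Mp2Z.T, t)}) :
    (1 ≤ w.1.mat 0 0 ∧ 1 ≤ w.1.mat 1 1 ∧ 0 ≤ w.1.mat 0 1 ∧ 0 ≤ w.1.mat 1 0) ∧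
      (w = 1 ∨ 0 < w.1.mat 0 1 + w.1.mat 1 0) := by
  induction hw using Submonoid.closure_induction_left with
  | one => simp
  | mul_left x hx y _ ih =>
    obtain ⟨⟨h1, h2, h3, h4⟩, _⟩ := ih
    rcases hx with rfl | hx
    · have e : ((((Mp2Z.T, t) : Mp2Z × G) * y).1.mat : Matrix (Fin 2) (Fin 2) ℤ)
          = !![1, 1; 0, 1] * (y.1.mat : Matrix (Fin 2) (Fin 2) ℤ) := by
        simp [Mp2Z.T_mat, ModularGroup.coe_T]
      simp only [e, Matrix.mul_apply, Fin.sum_univ_two]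
      simp
      omega
    · rw [Set.mem_singleton_iff] at hx; subst hx
      have e : ((((Mp2Z.T, t) : Mp2Z × G) * (Mp2Z.S, s) * (Mp2Z.T, t) * y).1.mat :
            Matrix (Fin 2) (Fin 2) ℤ)
          = !![1, 0; 1, 1] * (y.1.mat : Matrix (Fin 2) (Fin 2) ℤ) := by
        simp [Mp2Z.T_mat, Mp2Z.S_mat, ModularGroup.coe_T, ModularGroup.coe_S]
      simp only [e, Matrix.mul_apply, Fin.sum_univ_two]
      simp
      omega

namespace Mp2Z

/-- `Mp₂(ℤ)` is presented by the generators `S`, `T` and the relations `S⁸ = 1`,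
`STS = T⁻¹ST⁻¹`. The subgroup of `Mp₂(ℤ) × G` generated by `(S, s)` and `(T, t)` is the graph of the
homomorphism: an element of it over `1` has a normal form, whose positive word has a non-negative
matrix, and this forces the word to be a power of `S⁸`. -/
theorem exists_monoidHom {G : Type*} [Group G] (s t : G) (h8 : s ^ 8 = 1)
    (h : s * t * s = t⁻¹ * s * t⁻¹) : ∃ f : Mp2Z →* G, f S = s ∧ f T = t := by
  let R : Subgroup (Mp2Z × G) := Subgroup.closure {(S, s), (T, t)}
  have hS : (S, s) ∈ R := Subgroup.subset_closure (by simp)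
  have hT : (T, t) ∈ R := Subgroup.subset_closure (by simp)
  have H8 : ((S, s) : Mp2Z × G) ^ 8 = 1 := by
    rw [Prod.pow_mk, S_pow_eight, h8]; rfl
  have Hb : ((S, s) : Mp2Z × G) * (T, t) * (S, s) = (T, t)⁻¹ * (S, s) * (T, t)⁻¹ := by
    simp only [Prod.mk_mul_mk, Prod.inv_mk, S_mul_T_mul_S, h]
  let p : R →* Mp2Z := (MonoidHom.fst Mp2Z G).comp R.subtype
  have hinj : Function.Injective p := by
    rw [injective_iff_map_eq_one]
    rintro ⟨x, hx⟩ hx1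
    have hx1 : x.1 = 1 := hx1
    obtain ⟨k, a, b, w, hw, ha, hb, e⟩ := isNormalForm_of_mem_closure H8 Hb hx
    have hp := positive_word_matrix t s hw
    obtain ⟨⟨p1, p2, p3, p4⟩, p5⟩ := hp
    have em := congrArg (fun y : Mp2Z × G => (y.1.mat : Matrix (Fin 2) (Fin 2) ℤ)) e
    have hz : ((((S, s) : Mp2Z × G) ^ 2) ^ k).1.mat = (-1) ^ k := by
      rw [Prod.pow_fst, Prod.pow_fst]
      change toSL ((S ^ 2) ^ k) = _
      rw [map_pow]
      congr 1
      exact S_sq_mat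
    -- the matrix of `(ST)^a w S^b` is `±1`, which a non-negative `w` allows only if all is trivial
    have hab : a = 0 ∧ b = 0 ∧ w = 1 := by
      have em2 : (1 : Matrix (Fin 2) (Fin 2) ℤ) = (((-1) ^ k : SL(2, ℤ)) : Matrix (Fin 2) (Fin 2) ℤ)
          * ((((S, s) * (T, t)) ^ a * w * (S, s) ^ b : Mp2Z × G)).1.mat := by
        rw [← hz, ← Matrix.SpecialLinearGroup.coe_mul, ← mul_mat, ← Prod.fst_mul]
        rw [show ((S, s) ^ 2) ^ k * (((S, s) * (T, t)) ^ a * w * (S, s) ^ b) = x by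
          rw [e]; group]
        rw [hx1]; simp
      have h0 : ((((S, s) * (T, t)) ^ a * w * (S, s) ^ b : Mp2Z × G)).1.mat 0 1 = 0 ∧
          ((((S, s) * (T, t)) ^ a * w * (S, s) ^ b : Mp2Z × G)).1.mat 1 0 = 0 := by
        generalize (((S, s) * (T, t)) ^ a * w * (S, s) ^ b : Mp2Z × G).1.mat = M at em2 ⊢
        have e1 := congrFun (congrFun em2 0) 1
        have e2 := congrFun (congrFun em2 1) 0
        rcases neg_one_pow_eq_or SL(2, ℤ) k with h | h <;> rw [h] at e1 e2 <;>
          simp at e1 e2 <;> exact ⟨by omega, by omega⟩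
      obtain ⟨h01, h10⟩ := h0
      interval_cases a <;> interval_cases b <;>
        simp [pow_two, S_mat, T_mat, ModularGroup.coe_S, ModularGroup.coe_T, Matrix.mul_apply,
          Fin.sum_univ_two, Matrix.vecMul, dotProduct] at h01 h10
      · refine ⟨rfl, rfl, ?_⟩
        rcases p5 with p5 | p5
        · exact p5
        · omega
      all_goals omega
    obtain ⟨rfl, rfl, rfl⟩ := hab
    have e' : x = (S ^ (2 * k), s ^ (2 * k)) := by
      rw [e]; simp [pow_mul]
    have hk : 8 ∣ 2 * k := by
      have h1 : (S : Mp2Z) ^ (2 * k) = 1 := by rw [← hx1, e']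
      have hord : orderOf (S : Mp2Z) = 2 ^ (2 + 1) := by
        refine orderOf_eq_prime_pow ?_ (by simpa using S_pow_eight)
        intro h4
        have := congrFun (congrArg Mp2Z.j h4) UpperHalfPlane.I
        rw [show (2 : ℕ) ^ 2 = 4 by norm_num, S_pow_four_j] at this
        norm_num at this
      have := orderOf_dvd_of_pow_eq_one h1
      rwa [hord] at this
    obtain ⟨m, hm⟩ := hk
    refine Subtype.ext ?_
    change x = 1
    rw [e', hm, pow_mul, pow_mul, S_pow_eight, h8]; simp
  have hsurj : Function.Surjective p := by
    rw [← MonoidHom.range_eq_top, eq_top_iff, ← closure_S_T, Subgroup.closure_le]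
    rintro x (rfl | hx)
    · exact ⟨⟨_, hS⟩, rfl⟩
    · rw [Set.mem_singleton_iff] at hx; subst hx; exact ⟨⟨_, hT⟩, rfl⟩
  let E : R ≃* Mp2Z := MulEquiv.ofBijective p ⟨hinj, hsurj⟩
  refine ⟨((MonoidHom.snd Mp2Z G).comp R.subtype).comp E.symm.toMonoidHom, ?_, ?_⟩
  · have : E.symm S = ⟨_, hS⟩ := by rw [MulEquiv.symm_apply_eq]; rfl
    change ((E.symm S : R) : Mp2Z × G).2 = s
    rw [this]
  · have : E.symm T = ⟨_, hT⟩ := by rw [MulEquiv.symm_apply_eq]; rfl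
    change ((E.symm T : R) : Mp2Z × G).2 = t
    rw [this]

/-! ### Cosets of `MΓ₀(4)` -/

/-- Representatives of `MΓ₀(4) \ Mp₂(ℤ)`. -/
def cosetRep : Fin 6 → Mp2Z := ![1, S, S * T, S * T * T, S * T * T * T, S * T * T * S]

/-- The subgroup of `Mp₂(ℤ)` generated by `T`, `ST⁴S⁻¹` and `S²`; it equals `MΓ₀(4)`. -/
def gammaGen : Subgroup Mp2Z := Subgroup.closure {T, S * T ^ 4 * S⁻¹, S ^ 2}

theorem gammaGen_le : gammaGen ≤ MGamma04 := by
  rw [gammaGen, Subgroup.closure_le]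
  intro x hx
  change toSL x ∈ CongruenceSubgroup.Gamma0 4
  rw [CongruenceSubgroup.Gamma0_mem]
  change (((x.mat : SL(2, ℤ)) 1 0 : ℤ) : ZMod 4) = 0
  rcases hx with rfl | rfl | hx
  · simp [T_mat, ModularGroup.T]
  · simp [S_mat, T_mat, pow_succ, ModularGroup.S, ModularGroup.T]
    decide
  · rw [Set.mem_singleton_iff] at hx; subst hx
    rw [S_sq_mat]; simp

/-- Right multiplication by `S^{±1}` and `T^{±1}` permutes the six cosets `⟨T, ST⁴S⁻¹, S²⟩ gᵢ`. -/
theorem exists_gammaGen_mul_cosetRep (g : Mp2Z) : ∃ h ∈ gammaGen, ∃ i, g = h * cosetRep i := by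
  have hT : T ∈ gammaGen := Subgroup.subset_closure (by simp)
  have hU : S * T ^ 4 * S⁻¹ ∈ gammaGen := Subgroup.subset_closure (by simp)
  have hZ : S ^ 2 ∈ gammaGen := Subgroup.subset_closure (by simp)
  have br := S_mul_T_mul_S
  have br' : T * S * T = S * T⁻¹ * S⁻¹ := by
    have h1 : T * (S * T * S) * T = S := by rw [br]; group
    have h2 : T * S * T = (S * T⁻¹) * (T * (S * T * S) * T) * (S⁻¹ * S⁻¹) * S ^ 2 * (S ^ 2)⁻¹ := by
      have : S * T⁻¹ * (T * (S * T * S) * T) = S ^ 2 * (T * S * T) := by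
        simp only [pow_two]; group
      rw [this, (((commute_sq_of_braid br).mul_right ((Commute.refl S).pow_left 2)).mul_right
        (commute_sq_of_braid br)).eq]
      simp only [pow_two]; group
    rw [h2, h1]; simp only [pow_two]; group
  have step : ∀ i, (∃ h ∈ gammaGen, ∃ j, cosetRep i * S = h * cosetRep j) ∧
      (∃ h ∈ gammaGen, ∃ j, cosetRep i * T = h * cosetRep j) ∧
      (∃ h ∈ gammaGen, ∃ j, cosetRep i * T⁻¹ = h * cosetRep j) := by
    have zc : ∀ x : Mp2Z, x = S ∨ x = T → S ^ 2 * x = x * S ^ 2 := by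
      rintro x (rfl | rfl)
      · exact ((Commute.refl S).pow_left 2).eq
      · exact (commute_sq_of_braid br).eq
    have r6 : S * T * T * S * T
        = T⁻¹ * (S * T ^ 4 * S⁻¹)⁻¹ * (S ^ 2)⁻¹ * (S * T * T * S) := by
      have e1 : S * T * T * S * T = S * T * (T * S * T) := by group
      rw [e1, br']
      have e2 : S * T * (S * T⁻¹ * S⁻¹) = (S * T * S) * T⁻¹ * S⁻¹ := by group
      rw [e2, br]
      have e3 : (S ^ 2)⁻¹ * (S * T * T * S) = S * T * T * S⁻¹ := by
        rw [inv_mul_eq_iff_eq_mul]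
        have z1 := zc T (Or.inr rfl)
        calc S * T * T * S = S * T * T * S ^ 2 * S⁻¹ := by simp only [pow_two]; group
          _ = S * T * (S ^ 2 * T) * S⁻¹ := by rw [z1]; group
          _ = S * (T * S ^ 2) * T * S⁻¹ := by group
          _ = S * (S ^ 2 * T) * T * S⁻¹ := by rw [z1]
          _ = S ^ 2 * (S * T * T * S⁻¹) := by simp only [pow_two]; group
      rw [mul_assoc (T⁻¹ * (S * T ^ 4 * S⁻¹)⁻¹), e3]
      group
    intro i
    fin_cases i
    · exact ⟨⟨1, one_mem _, 1, by simp [cosetRep]⟩, ⟨T, hT, 0, by simp [cosetRep]⟩,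
        ⟨T⁻¹, inv_mem hT, 0, by simp [cosetRep]⟩⟩
    · refine ⟨⟨S ^ 2, hZ, 0, by simp [cosetRep, pow_two]⟩, ⟨1, one_mem _, 2, by simp [cosetRep]⟩,
        ⟨(S * T ^ 4 * S⁻¹)⁻¹, inv_mem hU, 4, ?_⟩⟩
      simp [cosetRep]; group
    · refine ⟨⟨T⁻¹ * (S * T ^ 4 * S⁻¹)⁻¹, mul_mem (inv_mem hT) (inv_mem hU), 4, ?_⟩,
        ⟨1, one_mem _, 3, by simp [cosetRep]⟩, ⟨1, one_mem _, 1, by simp [cosetRep]⟩⟩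
      simp [cosetRep]
      rw [br]; group
    · exact ⟨⟨1, one_mem _, 5, by simp [cosetRep]⟩, ⟨1, one_mem _, 4, by simp [cosetRep]⟩,
        ⟨1, one_mem _, 2, by simp [cosetRep]⟩⟩
    · refine ⟨⟨(S * T ^ 4 * S⁻¹) * (S ^ 2 * T), mul_mem hU (mul_mem hZ hT), 2, ?_⟩,
        ⟨S * T ^ 4 * S⁻¹, hU, 1, ?_⟩, ⟨1, one_mem _, 3, by simp [cosetRep]⟩⟩
      · have : S * T⁻¹ * S = S ^ 2 * T * (S * T) := by
          have h1 : S * T⁻¹ * S = S * T⁻¹ * S⁻¹ * S ^ 2 := by simp only [pow_two]; group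
          rw [h1, ← br']
          have := (((commute_sq_of_braid br).mul_right ((Commute.refl S).pow_left 2)).mul_right
            (commute_sq_of_braid br)).eq
          rw [← this]; group
        have e : S * T * T * T * S = S * T ^ 4 * S⁻¹ * (S * T⁻¹ * S) := by
          simp only [pow_succ, pow_zero]; group
        simp [cosetRep]
        rw [e, this]; group
      · simp [cosetRep, pow_succ, mul_assoc]
    · refine ⟨⟨S ^ 2, hZ, 3, ?_⟩, ⟨_, mul_mem (mul_mem (inv_mem hT) (inv_mem hU)) (inv_mem hZ), 5,
        r6⟩, ⟨_, inv_mem (mul_mem (mul_mem (inv_mem hT) (inv_mem hU)) (inv_mem hZ)), 5, ?_⟩⟩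
      · simp only [cosetRep]
        change S * T * T * S * S = S ^ 2 * (S * T * T)
        have z1 := zc T (Or.inr rfl)
        calc S * T * T * S * S = S * T * (T * S ^ 2) := by simp only [pow_two]; group
          _ = S * T * (S ^ 2 * T) := by rw [z1]
          _ = S * (T * S ^ 2) * T := by simp only [mul_assoc]
          _ = S * (S ^ 2 * T) * T := by rw [z1]
          _ = S ^ 2 * (S * T * T) := by simp only [pow_two, mul_assoc]
      · change S * T * T * S * T⁻¹ = _ * (S * T * T * S)
        rw [eq_inv_mul_iff_mul_eq, ← mul_assoc, ← r6]; group
  have key : ∀ x : Mp2Z, (∀ i, ∃ h ∈ gammaGen, ∃ j, cosetRep i * x = h * cosetRep j) →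
      ∀ y, (∃ h ∈ gammaGen, ∃ i, y = h * cosetRep i) →
      ∃ h ∈ gammaGen, ∃ i, y * x = h * cosetRep i := by
    rintro x hx _ ⟨h, hh, i, rfl⟩
    obtain ⟨h', hh', j, e⟩ := hx i
    exact ⟨h * h', mul_mem hh hh', j, by rw [mul_assoc, e, mul_assoc]⟩
  have kS := key S fun i => (step i).1
  have kT := key T fun i => (step i).2.1
  have kT' := key T⁻¹ fun i => (step i).2.2
  have hg : g ∈ Subgroup.closure {S, T} := by rw [closure_S_T]; trivial
  induction hg using Subgroup.closure_induction_right with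
  | one => exact ⟨1, one_mem _, 0, by simp [cosetRep]⟩
  | mul_right x hx y hy ih =>
    rcases hy with rfl | hy
    · exact kS _ ih
    · rw [Set.mem_singleton_iff] at hy; subst hy; exact kT _ ih
  | mul_inv_cancel x hx y hy ih =>
    rcases hy with rfl | hy
    · have : (S : Mp2Z)⁻¹ = S ^ 7 := by
        rw [inv_eq_iff_mul_eq_one, ← pow_succ', S_pow_eight]
      rw [this]
      have := kS _ (kS _ (kS _ (kS _ (kS _ (kS _ (kS _ ih))))))
      simpa [pow_succ, mul_assoc] using this
    · rw [Set.mem_singleton_iff] at hy; subst hy; exact kT' _ ih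

theorem lowerLeft_mod_four_of_mem {g : Mp2Z} : g ∈ MGamma04 ↔ ((g.mat 1 0 : ℤ) : ZMod 4) = 0 := by
  change toSL g ∈ CongruenceSubgroup.Gamma0 4 ↔ _
  rw [CongruenceSubgroup.Gamma0_mem]; rfl

/-- The six representatives are told apart by the lower rows of their matrices modulo `4`. -/
theorem cosetRep_mul_inv_mem {i j : Fin 6} (h : cosetRep i * (cosetRep j)⁻¹ ∈ MGamma04) :
    i = j := by
  rw [lowerLeft_mod_four_of_mem] at h
  revert h
  fin_cases i <;> fin_cases j <;>
    simp [cosetRep, S_mat, T_mat, ModularGroup.S, ModularGroup.T,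
      Matrix.mul_apply, Fin.sum_univ_two] <;> decide

theorem MGamma04_eq : MGamma04 = gammaGen := by
  refine le_antisymm (fun g hg => ?_) gammaGen_le
  obtain ⟨h, hh, i, rfl⟩ := exists_gammaGen_mul_cosetRep g
  have : cosetRep i * (cosetRep 0)⁻¹ ∈ MGamma04 := by
    have := mul_mem (inv_mem (gammaGen_le hh)) hg
    simpa [cosetRep] using this
  rw [cosetRep_mul_inv_mem this]
  simpa [cosetRep] using hh

/-- The six coset representatives enumerate `MΓ₀(4) \ Mp₂(ℤ)`. -/
theorem cosetRep_bijective :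
    Function.Bijective (fun i : Fin 6 => (Quotient.mk _ (cosetRep i) : Cosets)) := by
  refine ⟨fun i j hij => ?_, fun c => ?_⟩
  · have := Quotient.exact hij
    have := QuotientGroup.rightRel_apply.mp this
    exact (cosetRep_mul_inv_mem this).symm
  · induction c using Quotient.inductionOn with | _ g
    obtain ⟨h, hh, i, rfl⟩ := exists_gammaGen_mul_cosetRep g
    refine ⟨i, Quotient.sound ?_⟩
    refine QuotientGroup.rightRel_apply.mpr ?_
    simpa using gammaGen_le hh

end Mp2Z

/-! ### The quadratic Gauss sum of even modulus -/

theorem sum_range_shift_of_periodic {a : ℕ} {f : ℤ → ℂ} (hf : ∀ k, f (k + a) = f k) (l : ℤ) :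
    ∑ k ∈ Finset.range a, f (k + l) = ∑ k ∈ Finset.range a, f k := by
  have step : ∀ l : ℤ, ∑ k ∈ Finset.range a, f (k + (l + 1)) = ∑ k ∈ Finset.range a, f (k + l) := by
    intro l
    have h1 := Finset.sum_range_succ (fun k : ℕ => f (k + l)) a
    have h2 := Finset.sum_range_succ' (fun k : ℕ => f (k + l)) a
    have h3 : f ((a : ℤ) + l) = f (((0 : ℕ) : ℤ) + l) := by
      rw [add_comm, hf]; simp
    rw [h1, h3] at h2
    have h4 := add_right_cancel h2
    rw [h4]
    refine Finset.sum_congr rfl fun k _ => ?_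
    congr 1
    push_cast
    ring
  induction l using Int.induction_on with
  | zero => simp
  | succ n ih => rw [step, ih]
  | pred n ih => rw [← ih, ← step]; simp

theorem exp_sq_div_periodic {a : ℕ} (ha : Even a) (ha0 : 0 < a) (k : ℤ) :
    cexp (π * I * ((k + a : ℤ) : ℂ) ^ 2 / a) = cexp (π * I * (k : ℂ) ^ 2 / a) := by
  obtain ⟨b, rfl⟩ := ha
  have hb : (b : ℂ) ≠ 0 := by
    have : b ≠ 0 := by omega
    exact_mod_cast this
  have : (π * I * ((k + (b + b : ℕ) : ℤ) : ℂ) ^ 2 / (b + b : ℕ))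
      = π * I * (k : ℂ) ^ 2 / (b + b : ℕ) + (k + b : ℤ) * (2 * π * I) := by
    push_cast
    field_simp
    ring
  rw [this, Complex.exp_add, Complex.exp_int_mul_two_pi_mul_I, mul_one]

/-- Far from the real line the term `n = 0` dominates the series. -/
theorem jacobiTheta_ne_zero_of_half_le {τ : ℂ} (h : 1 ≤ τ.im) : jacobiTheta τ ≠ 0 := by
  intro h0
  have h1 := norm_jacobiTheta_sub_one_le (τ := τ) (by linarith)
  rw [h0] at h1
  have h2 : rexp (-π * τ.im) ≤ 1 / 4 := by
    have h3 : rexp (-π * τ.im) ≤ rexp (-3) := by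
      apply Real.exp_le_exp.mpr
      nlinarith [Real.pi_gt_three]
    have h4 : rexp (-3) ≤ 1 / 4 := by
      rw [Real.exp_neg, inv_eq_one_div]
      have := Real.add_one_le_exp 3
      gcongr
      linarith
    linarith
  have h5 : 2 / (1 - rexp (-π * τ.im)) * rexp (-π * τ.im) < 1 := by
    have := Real.exp_pos (-π * τ.im)
    rw [div_mul_eq_mul_div, div_lt_one (by linarith)]
    linarith
  simp at h1
  norm_num at h5
  linarith

theorem neg_I_mul_cpow_half {w : ℂ} (hw : 0 < w.im) :
    w ^ (1 / 2 : ℂ) = cexp (π * I / 4) * (-I * w) ^ (1 / 2 : ℂ) := by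
  have hw0 : w ≠ 0 := by rintro rfl; simp at hw
  have hI : -I = cexp (-(π / 2) * I) := by
    rw [neg_mul, Complex.exp_neg, Complex.exp_pi_div_two_mul_I, Complex.inv_I]
  have hlog : Complex.log (-I * w) = Complex.log w - π / 2 * I := by
    have h1 : 0 ≤ w.arg := Complex.arg_nonneg_iff.mpr hw.le
    have h2 := Complex.arg_le_pi w
    have hpi := Real.pi_pos
    rw [← Complex.log_exp (x := Complex.log w - π / 2 * I)]
    · congr 1
      rw [sub_eq_add_neg, Complex.exp_add, Complex.exp_log hw0, hI]
      ring_nf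
    · simp [Complex.log_im]; linarith
    · simp [Complex.log_im]; linarith
  rw [Complex.cpow_def_of_ne_zero hw0, Complex.cpow_def_of_ne_zero (by simp [hw0]), hlog,
    ← Complex.exp_add]
  congr 1
  ring

/-- The quadratic Gauss sum of even modulus, from the action of `S` on `∑ₙ e^{πin²w}` at
`w = (1 + i)/a`: splitting the series into residue classes modulo `a` and applying Poisson
summation to each class produces the Gauss sum. -/
theorem gauss_sum_even {a : ℕ} (ha : Even a) (ha0 : 0 < a) :
    ∑ k ∈ Finset.range a, cexp (π * I * (k : ℂ) ^ 2 / a) = √a * cexp (π * I / 4) := by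
  have haR : (0 : ℝ) < a := by exact_mod_cast ha0
  have haC : (a : ℂ) ≠ 0 := by exact_mod_cast ha0.ne'
  have : NeZero a := ⟨ha0.ne'⟩
  set G := ∑ k ∈ Finset.range a, cexp (π * I * (k : ℂ) ^ 2 / a) with hG
  set w : ℂ := (1 + I) / a with hw
  set v : ℂ := (-1 + I) / a with hv
  have hwim : 0 < w.im := by simp [hw, ← Complex.ofReal_natCast, Complex.div_ofReal_im]; positivity
  have hvim : 0 < v.im := by simp [hv, ← Complex.ofReal_natCast, Complex.div_ofReal_im]; positivity
  have hII : I * I = -1 := Complex.I_mul_I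
  -- Poisson summation on the class of `k`
  have hk : ∀ k : ℕ, ∑' m : ℤ, cexp (π * I * ((m : ℂ) * a + k) ^ 2 * w)
      = (√a : ℂ)⁻¹ * (cexp (π * I * (k : ℂ) ^ 2 / a) *
          ∑' l : ℤ, cexp (2 * π * I * l * (k / a) + π * I * (l : ℂ) ^ 2 * (I / a))) := by
    intro k
    have h1 := jacobiTheta₂_functional_equation (I * k) (I * a)
    have e1 : ∑' m : ℤ, cexp (π * I * ((m : ℂ) * a + k) ^ 2 * w)
        = cexp (π * I * (k : ℂ) ^ 2 / a) * cexp (-(π * (k : ℂ) ^ 2 / a)) * jacobiTheta₂ (I * k) (I * a) := by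
      rw [jacobiTheta₂, ← tsum_mul_left]
      refine tsum_congr fun m => ?_
      obtain ⟨b, hb⟩ := ha
      have : (π * I * ((m : ℂ) * a + k) ^ 2 * w) = π * I * (k : ℂ) ^ 2 / a + -(π * (k : ℂ) ^ 2 / a)
          + (2 * π * I * m * (I * k) + π * I * (m : ℂ) ^ 2 * (I * a)) +
            (m * k + b * m ^ 2 : ℤ) * (2 * π * I) := by
        have hb' : (b : ℂ) = a / 2 := by rw [hb]; push_cast; ring
        push_cast
        rw [hb', hw]
        field_simp
        linear_combination (k : ℂ) ^ 2 * hII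
      rw [this, Complex.exp_add _ (_ * (2 * π * I)), Complex.exp_int_mul_two_pi_mul_I, mul_one,
        Complex.exp_add, Complex.exp_add]
      rfl
    have e2 : (-I * (I * a)) ^ (1 / 2 : ℂ) = (√a : ℂ) := by
      rw [show -I * (I * a) = ((a : ℝ) : ℂ) by push_cast; linear_combination -(a : ℂ) * hII,
        Real.sqrt_eq_rpow, Complex.ofReal_cpow haR.le]
      norm_num
    have e3 : cexp (-π * I * (I * k) ^ 2 / (I * a)) = cexp (π * (k : ℂ) ^ 2 / a) := by
      congr 1
      field_simp
      linear_combination -(k : ℂ) ^ 2 * hII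
    have e4 : (I * k) / (I * a) = (k : ℂ) / a := by field_simp
    have e5 : -1 / (I * a) = I / a := by field_simp; linear_combination -hII
    rw [e1, h1, e2, e3, e4, e5, Complex.exp_neg]
    have := Complex.exp_ne_zero (π * (k : ℂ) ^ 2 / a)
    simp only [jacobiTheta₂, jacobiTheta₂_term]
    field_simp
  -- the theta function at `w`, split into residue classes
  have hsumw : Summable fun n : ℤ => cexp (π * I * (n : ℂ) ^ 2 * w) := by
    have := (summable_jacobiTheta₂_term_iff 0 w).mpr hwim
    simpa [jacobiTheta₂_term] using this
  have h1 : jacobiTheta w = ∑ k ∈ Finset.range a, ∑' m : ℤ, cexp (π * I * ((m : ℂ) * a + k) ^ 2 * w) := by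
    rw [jacobiTheta, ← (Int.divModEquiv a).symm.tsum_eq, Finset.sum_range]
    have hs : Summable fun p : ℤ × Fin a => cexp (π * I * (((Int.divModEquiv a).symm p : ℤ) : ℂ) ^ 2 * w) :=
      (Int.divModEquiv a).symm.summable_iff.mpr hsumw
    have hs' : Summable fun p : Fin a × ℤ =>
        cexp (π * I * (((Int.divModEquiv a).symm (Equiv.prodComm (Fin a) ℤ p) : ℤ) : ℂ) ^ 2 * w) :=
      (Equiv.prodComm (Fin a) ℤ).summable_iff.mpr hs
    rw [← (Equiv.prodComm (Fin a) ℤ).tsum_eq, hs'.tsum_prod, tsum_fintype]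
    refine Finset.sum_congr rfl fun k _ => tsum_congr fun m => ?_
    simp [Int.divModEquiv]
  have hsuml : ∀ k : ℕ, Summable fun l : ℤ =>
      cexp (2 * π * I * l * (k / a) + π * I * (l : ℂ) ^ 2 * (I / a)) := by
    intro k
    refine (summable_jacobiTheta₂_term_iff (k / a : ℂ) (I / a)).mpr ?_
    simp [← Complex.ofReal_natCast, Complex.div_ofReal_im]; positivity
  have h2 : jacobiTheta w = (√a : ℂ)⁻¹ * (G * jacobiTheta v) := by
    rw [h1, Finset.sum_congr rfl fun k _ => hk k, ← Finset.mul_sum]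
    congr 1
    rw [Finset.sum_congr rfl fun k _ => (tsum_mul_left).symm,
      ← Summable.tsum_finsetSum (fun k _ => (hsuml k).mul_left _), jacobiTheta, ← tsum_mul_left]
    refine tsum_congr fun l => ?_
    have h3 := sum_range_shift_of_periodic (a := a) (f := fun k => cexp (π * I * (k : ℂ) ^ 2 / a))
      (exp_sq_div_periodic ha ha0) l
    simp only [Int.cast_natCast] at h3
    rw [hG, ← h3, Finset.sum_mul]
    refine Finset.sum_congr rfl fun k _ => ?_
    rw [← Complex.exp_add, ← Complex.exp_add]
    congr 1
    rw [hv]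
    push_cast
    field_simp
    ring
  -- the action of `S` on both sides
  have hS : ∀ z : ℂ, jacobiTheta z = 1 / (-I * z) ^ (1 / 2 : ℂ) * jacobiTheta (-1 / z) := by
    intro z
    have := jacobiTheta₂_functional_equation 0 z
    simpa [jacobiTheta_eq_jacobiTheta₂] using this
  have hper : jacobiTheta (-1 / w) = jacobiTheta (-1 / v) := by
    obtain ⟨b, hb⟩ := ha
    have hab : (a : ℂ) = 2 * b := by rw [hb]; push_cast; ring
    have hper : ∀ (n : ℕ) (z : ℂ), jacobiTheta (z + n * 2) = jacobiTheta z := by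
      intro n
      induction n with
      | zero => simp
      | succ n ih =>
        intro z
        rw [← ih z, ← jacobiTheta_two_add (z + n * 2)]
        congr 1; push_cast; ring
    rw [← hper b (-1 / w)]
    congr 1
    have n1 : (1 + I) ≠ 0 := by intro h; simpa using congrArg Complex.re h
    have n2 : (-1 + I) ≠ 0 := by intro h; simpa using congrArg Complex.re h
    rw [hw, hv]
    field_simp
    rw [hab]
    linear_combination (2 * (b : ℂ)) * hII
  have hvw : v = I * w := by
    rw [hv, hw, mul_div_assoc']
    congr 1
    linear_combination -hII
  have hne : jacobiTheta (-1 / v) ≠ 0 := by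
    refine jacobiTheta_ne_zero_of_half_le ?_
    have : -1 / v = ((a / 2 : ℝ) : ℂ) * (1 + I) := by
      have n2 : (-1 + I) ≠ 0 := by intro h; simpa using congrArg Complex.re h
      rw [hv]; push_cast; field_simp
      linear_combination (-1 : ℂ) * hII
    rw [this, Complex.im_ofReal_mul]
    obtain ⟨b, hb⟩ := ha
    have : (1 : ℝ) ≤ b := by
      have : 1 ≤ b := by omega
      exact_mod_cast this
    rw [hb]; simp; linarith
  rw [hS w, hS v, hper, hvw, show -I * (I * w) = w by linear_combination -w * hII,
    neg_I_mul_cpow_half hwim] at h2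
  rw [← hvw] at h2
  have hroot : (-I * w) ^ (1 / 2 : ℂ) ≠ 0 := by
    have hw0 : w ≠ 0 := by rintro h; rw [h] at hwim; simp at hwim
    rw [Ne, Complex.cpow_eq_zero_iff]; simp [hw0]
  have hsa : (√a : ℂ) ≠ 0 := by
    have := Real.sqrt_pos.mpr haR
    exact_mod_cast this.ne'
  have hexp := Complex.exp_ne_zero (π * I / 4)
  generalize cexp (π * I / 4) = E at h2 hexp ⊢
  generalize (-I * w) ^ (1 / 2 : ℂ) = R at h2 hroot
  generalize jacobiTheta (-1 / v) = J at h2 hne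
  generalize (√a : ℂ) = s at h2 hsa ⊢
  have h3 : J * (s * E * R) = G * (J * R) := by
    field_simp at h2
    linear_combination R * J * h2
  refine mul_right_cancel₀ (mul_ne_zero hne hroot) ?_
  linear_combination -h3

/-! ### Sums over boxes -/

theorem sum_zmod_val {a : ℕ} [NeZero a] (f : ℕ → ℂ) :
    ∑ y : ZMod a, f y.val = ∑ k ∈ Finset.range a, f k := by
  obtain ⟨m, rfl⟩ : ∃ m, a = m + 1 := ⟨a - 1, by have := NeZero.pos a; omega⟩
  exact Fin.sum_univ_eq_sum_range f (m + 1)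

theorem sum_box_prod {n : ℕ} (a : Fin n → ℕ) [∀ i, NeZero (a i)] (f : Fin n → ℕ → ℂ) :
    ∑ x : ∀ i, ZMod (a i), ∏ i, f i (x i).val = ∏ i, ∑ k ∈ Finset.range (a i), f i k := by
  rw [← Fintype.piFinset_univ, ← Finset.prod_univ_sum (fun _ => Finset.univ)
    (fun i (y : ZMod (a i)) => f i y.val)]
  exact Finset.prod_congr rfl fun i _ => sum_zmod_val (f i)

theorem sum_box_shift {n : ℕ} (a : Fin n → ℕ) [∀ i, NeZero (a i)] {g : (Fin n → ℤ) → ℂ}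
    (hg : ∀ k l : Fin n → ℤ, (∀ i, (a i : ℤ) ∣ l i) → g (k + l) = g k) (l : Fin n → ℤ) :
    ∑ x : ∀ i, ZMod (a i), g ((fun i => ((x i).val : ℤ)) + l)
      = ∑ x : ∀ i, ZMod (a i), g (fun i => ((x i).val : ℤ)) := by
  rw [← Equiv.sum_comp (Equiv.addRight (fun i => (l i : ZMod (a i))))
    (fun x : ∀ i, ZMod (a i) => g (fun i => ((x i).val : ℤ)))]
  refine Finset.sum_congr rfl fun x _ => ?_
  have : (fun i => ((x i).val : ℤ)) + l
      = (fun i => (((Equiv.addRight (fun i => (l i : ZMod (a i)))) x i).val : ℤ)) +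
        fun i => ((x i).val : ℤ) + l i - (((Equiv.addRight (fun i => (l i : ZMod (a i)))) x i).val : ℤ) := by
    funext i; simp
  rw [this]
  refine hg _ _ fun i => ?_
  rw [← ZMod.intCast_zmod_eq_zero_iff_dvd]
  simp

namespace EvenLattice

variable {Λ : Type*} [AddCommGroup Λ] (L : EvenLattice Λ)

/-! ### The Gauss sum of the discriminant form -/

/-- `γ ↦ e^{πiγ²}` is a quadratic function whose polarization is `e^{2πi⟨γ, δ⟩}`. -/
theorem eHalf_q_add (x y : L.DiscGroup) :
    eHalf (L.q (x + y)) = eHalf (L.q x) * eHalf (L.q y) * eOne (L.b x y) := by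
  induction x using QuotientAddGroup.induction_on with | _ x
  induction y using QuotientAddGroup.induction_on with | _ y
  rw [← QuotientAddGroup.mk_add, q_mk, q_mk, q_mk, b_mk, eHalf_coe, eHalf_coe, eHalf_coe, eOne_coe,
    ← Complex.exp_add, ← Complex.exp_add]
  congr 1
  have := L.formQ_comm y x
  simp only [AddSubgroup.coe_add, map_add, LinearMap.add_apply, this]
  push_cast
  ring

theorem eHalf_q_zero : eHalf (L.q 0) = 1 := by
  have : (0 : L.DiscGroup) = QuotientAddGroup.mk 0 := rfl
  rw [this, q_mk, eHalf_coe]; simp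

theorem norm_eHalf (x : AddCircle (2 : ℚ)) : ‖eHalf x‖ = 1 := by
  induction x using QuotientAddGroup.induction_on with | _ x
  rw [eHalf_coe, Complex.norm_exp]; simp

theorem eHalf_mul_conj (x : AddCircle (2 : ℚ)) : eHalf x * starRingEnd ℂ (eHalf x) = 1 := by
  rw [Complex.mul_conj, Complex.normSq_eq_norm_sq, norm_eHalf]; simp

/-- The additive characters `γ ↦ e^{2πi⟨γ, x⟩}` of the discriminant group. -/
def discChar (x : L.DiscGroup) : AddChar L.DiscGroup ℂ where
  toFun γ := eOne (L.b γ x)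
  map_zero_eq_one' := by rw [b_zero_left, eOne_zero]
  map_add_eq_mul' γ δ := by rw [b_add_left, eOne_add]

/-- Orthogonality of characters, as the discriminant form is non-degenerate. -/
theorem sum_eOne_b [Module.Free ℤ Λ] [Module.Finite ℤ Λ] [Fintype L.DiscGroup]
    [DecidableEq L.DiscGroup] (x : L.DiscGroup) :
    ∑ γ, eOne (L.b γ x) = if x = 0 then (Fintype.card L.DiscGroup : ℂ) else 0 := by
  classical
  have h := AddChar.sum_eq_ite (L.discChar x)
  have hx : L.discChar x = 0 ↔ x = 0 := by
    constructor
    · intro h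
      refine L.eq_zero_of_b_eq_zero fun y => eq_zero_of_eOne_eq_one ?_
      exact DFunLike.congr_fun h y
    · rintro rfl
      ext γ
      change eOne (L.b γ 0) = 1
      rw [b_comm, b_zero_left, eOne_zero]
  simp only [hx] at h
  exact h

/-- `∑_γ e^{πiγ²}`. -/
def gaussSum [Fintype L.DiscGroup] : ℂ := ∑ γ, eHalf (L.q γ)

/-- `|∑_γ e^{πiγ²}|² = |A_Λ|`. -/
theorem gaussSum_mul_conj [Module.Free ℤ Λ] [Module.Finite ℤ Λ] [Fintype L.DiscGroup] :
    L.gaussSum * starRingEnd ℂ L.gaussSum = Fintype.card L.DiscGroup := by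
  classical
  rw [gaussSum, map_sum, Finset.mul_sum]
  have h1 : ∀ δ : L.DiscGroup, (∑ γ, eHalf (L.q γ)) * starRingEnd ℂ (eHalf (L.q δ))
      = ∑ ε, eHalf (L.q ε) * eOne (L.b δ ε) := by
    intro δ
    rw [← Equiv.sum_comp (Equiv.addLeft δ) (fun γ => eHalf (L.q γ)), Finset.sum_mul]
    refine Finset.sum_congr rfl fun ε _ => ?_
    rw [Equiv.coe_addLeft, eHalf_q_add]
    linear_combination (eHalf (L.q ε) * eOne (L.b δ ε)) * eHalf_mul_conj (L.q δ)
  rw [Finset.sum_congr rfl fun δ _ => h1 δ, Finset.sum_comm]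
  simp_rw [← Finset.mul_sum, sum_eOne_b]
  simp [eHalf_q_zero]

/-! ### Orthogonal sublattices and the signature -/

theorem lat_clear_denominators (x : ℚ ⊗[ℤ] Λ) : ∃ d : ℤ, d ≠ 0 ∧ ∃ v : Λ, (d : ℚ) • x = 1 ⊗ₜ v := by
  induction x using TensorProduct.induction_on with
  | zero => exact ⟨1, one_ne_zero, 0, by simp⟩
  | tmul a v =>
    refine ⟨a.den, by exact_mod_cast a.den_ne_zero, a.num • v, ?_⟩
    rw [TensorProduct.smul_tmul', TensorProduct.tmul_smul, TensorProduct.smul_tmul']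
    congr 1
    simp [Rat.den_mul_eq_num]
  | add x y hx hy =>
    obtain ⟨d, hd, v, hv⟩ := hx
    obtain ⟨d', hd', v', hv'⟩ := hy
    refine ⟨d * d', mul_ne_zero hd hd', d' • v + d • v', ?_⟩
    have h1 : ((d * d' : ℤ) : ℚ) • x = (d' : ℚ) • ((d : ℚ) • x) := by
      rw [smul_smul]; push_cast; rw [mul_comm]
    have h2 : ((d * d' : ℤ) : ℚ) • y = (d : ℚ) • ((d' : ℚ) • y) := by
      rw [smul_smul]; push_cast; rfl
    rw [smul_add, h1, h2, hv, hv', TensorProduct.tmul_add, TensorProduct.tmul_smul,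
      TensorProduct.tmul_smul, Int.cast_smul_eq_zsmul, Int.cast_smul_eq_zsmul]

theorem finrank_baseChange (K : Type*) [Field K] [Module.Free ℤ Λ] [Module.Finite ℤ Λ] :
    Module.finrank K (K ⊗[ℤ] Λ) = Module.finrank ℤ Λ := Module.finrank_baseChange

/-- A non-degenerate lattice contains an orthogonal sublattice of finite index. -/
theorem exists_orthogonal [Module.Free ℤ Λ] [Module.Finite ℤ Λ] :
    ∃ w : Fin (Module.finrank ℤ Λ) → Λ, (∀ i j, i ≠ j → L.form (w i) (w j) = 0) ∧
      ∀ i, L.form (w i) (w i) ≠ 0 := by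
  have : Invertible (2 : ℚ) := invertibleOfNonzero two_ne_zero
  obtain ⟨u, hu⟩ := LinearMap.BilinForm.exists_orthogonal_basis (B := L.formQ)
    ⟨fun x y => L.formQ_comm x y⟩
  have hn := hu.not_isOrtho_basis_self_of_separatingLeft L.formQ_nondegenerate.1
  choose d hd v hv using fun i => lat_clear_denominators (u i)
  have hvv : ∀ i j, (L.form (v i) (v j) : ℚ) = d i * d j * L.formQ (u i) (u j) := by
    intro i j
    rw [← formQ_tmul, ← hv, ← hv]
    simp only [map_smul, LinearMap.smul_apply, smul_eq_mul]
    ring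
  let e := finCongr (finrank_baseChange (Λ := Λ) ℚ)
  refine ⟨fun i => v (e.symm i), fun i j hij => ?_, fun i => ?_⟩
  · have h0 : L.formQ (u (e.symm i)) (u (e.symm j)) = 0 := hu (fun h => hij (e.symm.injective h))
    have := hvv (e.symm i) (e.symm j)
    rw [h0, mul_zero] at this
    exact_mod_cast this
  · have h1 : L.formQ (u (e.symm i)) (u (e.symm i)) ≠ 0 := hn _
    have := hvv (e.symm i) (e.symm i)
    intro h0
    rw [h0] at this
    have h2 : (d (e.symm i) : ℚ) ≠ 0 := by exact_mod_cast hd _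
    exact mul_ne_zero (mul_ne_zero h2 h2) h1 (by rw [← this]; simp)

section Orthogonal

variable {n : ℕ} {w : Fin n → Λ}

theorem baseChange_tmul (K : Type*) [Field K] (x y : Λ) :
    L.form.baseChange K (1 ⊗ₜ x) (1 ⊗ₜ y) = (L.form x y : K) := by
  simp

theorem linearIndependent_tmul (K : Type*) [Field K] [CharZero K]
    (ho : ∀ i j, i ≠ j → L.form (w i) (w j) = 0) (hne : ∀ i, L.form (w i) (w i) ≠ 0) :
    LinearIndependent K (fun i => (1 : K) ⊗ₜ[ℤ] w i) := by
  refine LinearMap.linearIndependent_of_isOrthoᵢ (B := L.form.baseChange K) ?_ ?_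
  · intro i j hij
    change L.form.baseChange K (1 ⊗ₜ w i) (1 ⊗ₜ w j) = 0
    rw [baseChange_tmul, ho i j hij]; simp
  · intro i
    change L.form.baseChange K (1 ⊗ₜ w i) (1 ⊗ₜ w i) ≠ 0
    rw [baseChange_tmul]
    exact_mod_cast hne i

/-- The basis of `Λ ⊗ K` given by an orthogonal sublattice of finite index. -/
def orthBasis (K : Type*) [Field K] [CharZero K] [Module.Free ℤ Λ] [Module.Finite ℤ Λ]
    (hn : n = Module.finrank ℤ Λ)
    (ho : ∀ i j, i ≠ j → L.form (w i) (w j) = 0) (hne : ∀ i, L.form (w i) (w i) ≠ 0) :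
    Module.Basis (Fin n) K (K ⊗[ℤ] Λ) :=
  basisOfLinearIndependentOfCardEqFinrank' _ (L.linearIndependent_tmul K ho hne)
    (by rw [finrank_baseChange, Fintype.card_fin, hn])

theorem orthBasis_apply (K : Type*) [Field K] [CharZero K] [Module.Free ℤ Λ] [Module.Finite ℤ Λ]
    (hn : n = Module.finrank ℤ Λ)
    (ho : ∀ i j, i ≠ j → L.form (w i) (w j) = 0) (hne : ∀ i, L.form (w i) (w i) ≠ 0) (i : Fin n) :
    L.orthBasis K hn ho hne i = 1 ⊗ₜ w i := by
  simp [orthBasis]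

theorem equivalent_weightedSumSquares [Module.Free ℤ Λ] [Module.Finite ℤ Λ]
    (hn : n = Module.finrank ℤ Λ)
    (ho : ∀ i j, i ≠ j → L.form (w i) (w j) = 0) (hne : ∀ i, L.form (w i) (w i) ≠ 0) :
    L.quadR.Equivalent
      (QuadraticMap.weightedSumSquares ℝ (fun i => (L.form (w i) (w i) : ℝ))) := by
  have : Invertible (2 : ℝ) := invertibleOfNonzero two_ne_zero
  let v := L.orthBasis ℝ hn ho hne
  have hv : (QuadraticMap.associated (R := ℝ) L.quadR).IsOrthoᵢ v := by
    intro i j hij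
    change (QuadraticMap.associated (R := ℝ) L.quadR) (v i) (v j) = 0
    rw [quadR, QuadraticMap.associated_toQuadraticMap]
    simp only [v, orthBasis_apply, baseChange_tmul, ho i j hij, ho j i hij.symm]
    simp
  have h1 := QuadraticMap.basisRepr_eq_of_iIsOrtho L.quadR v hv
  have h2 : (fun i => L.quadR (v i)) = fun i => (L.form (w i) (w i) : ℝ) := by
    funext i
    change L.form.baseChange ℝ (v i) (v i) = _
    simp only [v, orthBasis_apply, baseChange_tmul]
  rw [h2] at h1
  rw [← h1]
  exact ⟨L.quadR.isometryEquivBasisRepr v⟩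

/-- The signature is read off from any orthogonal sublattice of finite index, by the law of inertia. -/
theorem sigma_eq_sum_sign [Module.Free ℤ Λ] [Module.Finite ℤ Λ]
    (hn : n = Module.finrank ℤ Λ)
    (ho : ∀ i j, i ≠ j → L.form (w i) (w j) = 0) (hne : ∀ i, L.form (w i) (w i) ≠ 0) :
    L.sigma = ∑ i, (L.form (w i) (w i)).sign := by
  classical
  have h := L.equivalent_weightedSumSquares hn ho hne
  have hs : ∀ i, (L.form (w i) (w i)).sign
      = (if 0 < L.form (w i) (w i) then 1 else 0) - (if L.form (w i) (w i) < 0 then 1 else 0) := by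
    intro i
    rcases lt_trichotomy (L.form (w i) (w i)) 0 with h | h | h
    · rw [Int.sign_eq_neg_one_of_neg h, if_neg (by omega), if_pos h]; simp
    · exact absurd h (hne i)
    · rw [Int.sign_eq_one_of_pos h, if_pos h, if_neg (by omega)]; simp
  rw [sigma, bPlus, bMinus, QuadraticForm.sigPos_of_equiv_weightedSumSquares h,
    QuadraticForm.sigNeg_of_equiv_weightedSumSquares h, Finset.sum_congr rfl fun i _ => hs i,
    Finset.sum_sub_distrib, Finset.sum_boole, Finset.sum_boole, Set.ncard_eq_toFinset_card',
    Set.ncard_eq_toFinset_card']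
  simp

theorem bPlus_add_bMinus [Module.Free ℤ Λ] [Module.Finite ℤ Λ] :
    L.bPlus + L.bMinus = Module.finrank ℤ Λ := by
  classical
  obtain ⟨w, ho, hne⟩ := L.exists_orthogonal
  have h := L.equivalent_weightedSumSquares rfl ho hne
  rw [bPlus, bMinus, QuadraticForm.sigPos_of_equiv_weightedSumSquares h,
    QuadraticForm.sigNeg_of_equiv_weightedSumSquares h, ← Set.ncard_union_eq]
  · rw [show {i | 0 < (L.form (w i) (w i) : ℝ)} ∪ {i | (L.form (w i) (w i) : ℝ) < 0} = Set.univ by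
      ext i
      have : (L.form (w i) (w i) : ℝ) ≠ 0 := by exact_mod_cast hne i
      simp only [Set.mem_union, Set.mem_ofPred_eq, Set.mem_univ, iff_true]
      exact (lt_or_gt_of_ne this).symm, Set.ncard_univ, Nat.card_fin]
  · rw [Set.disjoint_left]
    intro i hi hi'
    simp only [Set.mem_ofPred_eq] at hi hi'
    linarith

/-- The vectors of `M^∨` for the orthogonal sublattice `M = ⨁ ℤ wᵢ`, in coordinates: `k` stands for
`∑ (kᵢ / ⟨wᵢ, wᵢ⟩) wᵢ`. -/
def orthDualVec (w : Fin n → Λ) (k : Fin n → ℤ) : ℚ ⊗[ℤ] Λ :=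
  ∑ i, ((k i : ℚ) / (L.form (w i) (w i) : ℚ)) • ((1 : ℚ) ⊗ₜ[ℤ] w i)

theorem orthDualVec_add (k l : Fin n → ℤ) :
    L.orthDualVec w (k + l) = L.orthDualVec w k + L.orthDualVec w l := by
  simp only [orthDualVec, ← Finset.sum_add_distrib, ← add_smul]
  refine Finset.sum_congr rfl fun i _ => ?_
  congr 1
  rw [Pi.add_apply]
  push_cast
  ring

theorem formQ_orthDualVec_basis (ho : ∀ i j, i ≠ j → L.form (w i) (w j) = 0)
    (hne : ∀ i, L.form (w i) (w i) ≠ 0) (k : Fin n → ℤ) (i : Fin n) :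
    L.formQ (L.orthDualVec w k) (1 ⊗ₜ w i) = k i := by
  rw [orthDualVec, map_sum, LinearMap.sum_apply, Finset.sum_eq_single i]
  · rw [map_smul, LinearMap.smul_apply, formQ_tmul, smul_eq_mul, div_mul_cancel₀]
    exact_mod_cast hne i
  · intro j _ hj
    rw [map_smul, LinearMap.smul_apply, formQ_tmul, ho j i hj]; simp
  · simp

theorem formQ_orthDualVec (ho : ∀ i j, i ≠ j → L.form (w i) (w j) = 0)
    (hne : ∀ i, L.form (w i) (w i) ≠ 0) (k l : Fin n → ℤ) :
    L.formQ (L.orthDualVec w k) (L.orthDualVec w l)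
      = ∑ i, (k i : ℚ) * l i / (L.form (w i) (w i) : ℚ) := by
  have hl : L.orthDualVec w l
      = ∑ i, ((l i : ℚ) / (L.form (w i) (w i) : ℚ)) • ((1 : ℚ) ⊗ₜ[ℤ] w i) := rfl
  rw [hl, map_sum]
  refine Finset.sum_congr rfl fun i _ => ?_
  rw [map_smul, L.formQ_orthDualVec_basis ho hne, smul_eq_mul]
  ring

theorem orthDualVec_mem_lat (hne : ∀ i, L.form (w i) (w i) ≠ 0) {k : Fin n → ℤ}
    (hk : ∀ i, L.form (w i) (w i) ∣ k i) : L.orthDualVec w k ∈ L.lat := by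
  refine sum_mem fun i _ => ?_
  obtain ⟨m, hm⟩ := hk i
  refine ⟨m • w i, ?_⟩
  have : (L.form (w i) (w i) : ℚ) ≠ 0 := by exact_mod_cast hne i
  rw [hm]
  push_cast
  rw [mul_div_cancel_left₀ _ this, Int.cast_smul_eq_zsmul]
  simp

/-- `Λ^∨` lies in the dual of the orthogonal sublattice. -/
theorem exists_orthDualVec_eq [Module.Free ℤ Λ] [Module.Finite ℤ Λ]
    (hn : n = Module.finrank ℤ Λ) (ho : ∀ i j, i ≠ j → L.form (w i) (w j) = 0)
    (hne : ∀ i, L.form (w i) (w i) ≠ 0) {x : ℚ ⊗[ℤ] Λ} (hx : x ∈ L.dual) :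
    ∃ k, L.orthDualVec w k = x := by
  choose k hk using fun i => hx (1 ⊗ₜ w i) ⟨w i, rfl⟩
  refine ⟨k, ?_⟩
  let v := L.orthBasis ℚ hn ho hne
  have hv : ∀ i, v i = 1 ⊗ₜ w i := fun i => L.orthBasis_apply ℚ hn ho hne i
  have h0 : ∀ y, L.formQ (L.orthDualVec w k - x) y = 0 := by
    intro y
    have : L.formQ (L.orthDualVec w k - x) = 0 := by
      refine v.ext fun i => ?_
      rw [hv, map_sub, LinearMap.sub_apply, L.formQ_orthDualVec_basis ho hne, hk]; simp
    rw [this]; rfl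
  exact sub_eq_zero.mp (L.formQ_nondegenerate.1 _ h0)

end Orthogonal

/-- `x ↦ e^{πi⟨x, x⟩}` on `Λ ⊗ ℚ`. -/
def expQ (x : ℚ ⊗[ℤ] Λ) : ℂ := cexp (π * I * L.formQ x x)

theorem expQ_add_lat {x y : ℚ ⊗[ℤ] Λ} (hy : y ∈ L.lat) :
    L.expQ (x + y) = L.expQ x * cexp (2 * π * I * L.formQ x y) := by
  obtain ⟨m, hm⟩ := L.formQ_lat hy
  rw [expQ, expQ, ← Complex.exp_add]
  have hc := L.formQ_comm y x
  have : (π * I * (L.formQ (x + y) (x + y) : ℚ) : ℂ)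
      = π * I * L.formQ x x + 2 * π * I * L.formQ x y + m * (2 * π * I) := by
    simp only [map_add, LinearMap.add_apply, hc, hm]
    push_cast
    ring
  rw [this, Complex.exp_add _ (_ * (2 * π * I)), Complex.exp_int_mul_two_pi_mul_I, mul_one]

theorem exp_two_pi_eq_one_iff (x : ℚ) : cexp (2 * π * I * x) = 1 ↔ ∃ m : ℤ, x = m := by
  rw [Complex.exp_eq_one_iff]
  constructor
  · rintro ⟨m, hm⟩
    refine ⟨m, ?_⟩
    have : (x : ℂ) = m := by
      apply mul_left_cancel₀ Complex.two_pi_I_ne_zero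
      rw [hm]; ring
    exact_mod_cast this
  · rintro ⟨m, rfl⟩
    exact ⟨m, by push_cast; ring⟩

theorem mem_dual_iff_basis [Module.Free ℤ Λ] [Module.Finite ℤ Λ] {ι : Type*}
    (b : Module.Basis ι ℤ Λ) {x : ℚ ⊗[ℤ] Λ} :
    x ∈ L.dual ↔ ∀ j, ∃ m : ℤ, L.formQ x (1 ⊗ₜ b j) = m := by
  refine ⟨fun h j => h _ ⟨b j, rfl⟩, fun h => ?_⟩
  rintro _ ⟨v, rfl⟩
  change ∃ m : ℤ, L.formQ x (1 ⊗ₜ v) = m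
  induction b.mem_span v using Submodule.span_induction with
  | mem x hx =>
    obtain ⟨j, rfl⟩ := hx
    exact h j
  | zero => exact ⟨0, by simp⟩
  | add v v' _ _ hv hv' =>
    obtain ⟨m, hm⟩ := hv
    obtain ⟨m', hm'⟩ := hv'
    exact ⟨m + m', by rw [TensorProduct.tmul_add, map_add, hm, hm']; push_cast; rfl⟩
  | smul c v _ hv =>
    obtain ⟨m, hm⟩ := hv
    refine ⟨c * m, ?_⟩
    rw [TensorProduct.tmul_smul, map_zsmul, hm]
    simp

section Milgram

variable {n : ℕ} {w : Fin n → Λ} [Module.Free ℤ Λ] [Module.Finite ℤ Λ]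

/-- For negative modulus the Gauss sum is the complex conjugate. -/
theorem gauss_sum_even_int {a : ℤ} (ha : Even a) (ha0 : a ≠ 0) :
    ∑ k ∈ Finset.range a.natAbs, cexp (π * I * (k : ℂ) ^ 2 / a)
      = √(a.natAbs : ℝ) * cexp (π * I * a.sign / 4) := by
  have he : Even a.natAbs := Int.natAbs_even.mpr ha
  have h0 : 0 < a.natAbs := Int.natAbs_pos.mpr ha0
  have h := gauss_sum_even he h0
  rcases lt_or_gt_of_ne ha0 with hneg | hpos
  · have hc := congrArg (starRingEnd ℂ) h
    rw [map_sum, map_mul, Complex.conj_ofReal, ← Complex.exp_conj] at hc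
    have ha' : (a : ℂ) = -(a.natAbs : ℂ) := by
      have : (a : ℤ) = -(a.natAbs : ℤ) := by omega
      rw [← Int.cast_natCast, ← Int.cast_neg, ← this]
    rw [Int.sign_eq_neg_one_of_neg hneg]
    convert hc using 1
    · refine Finset.sum_congr rfl fun k _ => ?_
      rw [← Complex.exp_conj, ha']
      congr 1
      simp [div_neg]
      ring
    · congr 2
      simp [Complex.conj_ofNat]
  · have ha' : (a : ℂ) = (a.natAbs : ℂ) := by
      have : (a : ℤ) = (a.natAbs : ℤ) := by omega
      rw [← Int.cast_natCast, ← this]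
    rw [Int.sign_eq_one_of_pos hpos, ha', h]
    simp

instance neZero_natAbs_form [hne : Fact (∀ i, L.form (w i) (w i) ≠ 0)] (i : Fin n) :
    NeZero (L.form (w i) (w i)).natAbs := ⟨Int.natAbs_ne_zero.mpr (hne.out i)⟩

/-- The Gauss sum of the orthogonal sublattice `⨁ ℤ wᵢ`. -/
theorem sum_box_expQ [hne : Fact (∀ i, L.form (w i) (w i) ≠ 0)] (hn : n = Module.finrank ℤ Λ)
    (ho : ∀ i j, i ≠ j → L.form (w i) (w j) = 0) :
    ∑ x : ∀ i, ZMod (L.form (w i) (w i)).natAbs, L.expQ (L.orthDualVec w fun i => ((x i).val : ℤ))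
      = (∏ i, √((L.form (w i) (w i)).natAbs : ℝ) : ℝ) * cexp (π * I * L.sigma / 4) := by
  have h1 : ∀ k : Fin n → ℕ, L.expQ (L.orthDualVec w fun i => (k i : ℤ))
      = ∏ i, cexp (π * I * (k i : ℂ) ^ 2 / (L.form (w i) (w i))) := by
    intro k
    rw [expQ, L.formQ_orthDualVec ho hne.out, ← Complex.exp_sum, Rat.cast_sum, Finset.mul_sum]
    congr 1
    refine Finset.sum_congr rfl fun i _ => ?_
    push_cast
    ring
  have h2 := sum_box_prod (fun i => (L.form (w i) (w i)).natAbs)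
    (fun i k => cexp (π * I * (k : ℂ) ^ 2 / (L.form (w i) (w i))))
  have h3 : ∏ i, ∑ k ∈ Finset.range (L.form (w i) (w i)).natAbs,
      cexp (π * I * (k : ℂ) ^ 2 / (L.form (w i) (w i)))
      = ∏ i, ((√((L.form (w i) (w i)).natAbs : ℝ) : ℝ) : ℂ) *
        cexp (π * I * (L.form (w i) (w i)).sign / 4) :=
    Finset.prod_congr rfl fun i _ => gauss_sum_even_int (L.even (w i)) (hne.out i)
  rw [Finset.sum_congr rfl fun x _ => h1 fun i => (x i).val, h2, h3, Finset.prod_mul_distrib,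
    ← Complex.exp_sum, L.sigma_eq_sum_sign hn ho hne.out, Complex.ofReal_prod, Int.cast_sum,
    Finset.mul_sum, Finset.sum_div]

theorem sum_pow_eq_ite {ζ : ℂ} {N : ℕ} (h : ζ ^ N = 1) [Decidable (ζ = 1)] :
    ∑ r ∈ Finset.range N, ζ ^ r = if ζ = 1 then (N : ℂ) else 0 := by
  split_ifs with h1
  · simp [h1]
  · rw [geom_sum_eq h1, h]; simp

theorem mul_ite_and (P Q : Prop) [Decidable P] [Decidable Q] [Decidable (Q ∧ P)] (N E : ℂ) :
    N * (if Q ∧ P then E else 0) = (if P then E else 0) * (if Q then N else 0) := by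
  by_cases hP : P <;> by_cases hQ : Q <;> simp [hP, hQ, mul_comm]

set_option maxHeartbeats 800000 in
open Classical in
/-- Averaging over translations by `Λ` restricts the Gauss sum over `M^∨/M` to `Λ^∨/M`. -/
theorem sum_box_expQ_restrict [hne : Fact (∀ i, L.form (w i) (w i) ≠ 0)]
    (hn : n = Module.finrank ℤ Λ) (ho : ∀ i j, i ≠ j → L.form (w i) (w j) = 0) :
    ∑ x : ∀ i, ZMod (L.form (w i) (w i)).natAbs, L.expQ (L.orthDualVec w fun i => ((x i).val : ℤ))
      = ∑ x : ∀ i, ZMod (L.form (w i) (w i)).natAbs,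
        if L.orthDualVec w (fun i => ((x i).val : ℤ)) ∈ L.dual then
          L.expQ (L.orthDualVec w fun i => ((x i).val : ℤ)) else 0 := by
  let b := Module.Free.chooseBasis ℤ Λ
  have hper : ∀ k l : Fin n → ℤ, (∀ i, ((L.form (w i) (w i)).natAbs : ℤ) ∣ l i) →
      L.orthDualVec w l ∈ L.lat ∧ ∃ m : ℤ, L.formQ (L.orthDualVec w k) (L.orthDualVec w l) = m := by
    intro k l hl
    have hl' : ∀ i, L.form (w i) (w i) ∣ l i := fun i => Int.natAbs_dvd.mp (hl i)
    refine ⟨L.orthDualVec_mem_lat hne.out hl', ?_⟩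
    rw [L.formQ_orthDualVec ho hne.out]
    choose m hm using hl'
    refine ⟨∑ i, k i * m i, ?_⟩
    push_cast
    refine Finset.sum_congr rfl fun i _ => ?_
    have : (L.form (w i) (w i) : ℚ) ≠ 0 := by exact_mod_cast hne.out i
    rw [hm i]; push_cast; field_simp
  -- the conditions `⟨x, bⱼ⟩ ∈ ℤ` that define `Λ^∨` are imposed one basis vector at a time
  have key : ∀ t : Finset (Module.Free.ChooseBasisIndex ℤ Λ),
      ∑ x : ∀ i, ZMod (L.form (w i) (w i)).natAbs, L.expQ (L.orthDualVec w fun i => ((x i).val : ℤ))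
      = ∑ x : ∀ i, ZMod (L.form (w i) (w i)).natAbs,
        if ∀ j ∈ t, ∃ m : ℤ, L.formQ (L.orthDualVec w (fun i => ((x i).val : ℤ))) (1 ⊗ₜ b j) = m then
          L.expQ (L.orthDualVec w fun i => ((x i).val : ℤ)) else 0 := by
    intro t
    induction t using Finset.induction_on with
    | empty => simp
    | insert j t hj ih =>
      rw [ih]
      obtain ⟨c, hc⟩ := L.exists_orthDualVec_eq hn ho hne.out
        (L.lat_le_dual (⟨b j, rfl⟩ : (1 : ℚ) ⊗ₜ[ℤ] b j ∈ L.lat))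
      set N : ℕ := ∏ i, (L.form (w i) (w i)).natAbs with hN
      have hN0 : (N : ℂ) ≠ 0 := by
        rw [hN]
        exact_mod_cast Finset.prod_ne_zero_iff.mpr fun i _ => Int.natAbs_ne_zero.mpr (hne.out i)
      let g : (Fin n → ℤ) → ℂ := fun k =>
        if ∀ j ∈ t, ∃ m : ℤ, L.formQ (L.orthDualVec w k) (1 ⊗ₜ b j) = m then
          L.expQ (L.orthDualVec w k) else 0
      have hgadd : ∀ k l : Fin n → ℤ, L.orthDualVec w l ∈ L.lat →
          g (k + l) = g k * cexp (2 * π * I * L.formQ (L.orthDualVec w k) (L.orthDualVec w l)) := by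
        intro k l hl
        have hiff : ∀ j, (∃ m : ℤ, L.formQ (L.orthDualVec w (k + l)) (1 ⊗ₜ b j) = m) ↔
            (∃ m : ℤ, L.formQ (L.orthDualVec w k) (1 ⊗ₜ b j) = m) := by
          intro j
          obtain ⟨m, hm⟩ := L.lat_le_dual hl (1 ⊗ₜ b j) ⟨b j, rfl⟩
          rw [orthDualVec_add, map_add, LinearMap.add_apply, hm]
          constructor
          · rintro ⟨m', h⟩
            exact ⟨m' - m, by push_cast; linarith⟩
          · rintro ⟨m', h⟩
            exact ⟨m' + m, by push_cast; linarith⟩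
        simp only [g, hiff]
        split_ifs
        · rw [orthDualVec_add, L.expQ_add_lat hl]
        · simp
      have hgper : ∀ k l : Fin n → ℤ, (∀ i, ((L.form (w i) (w i)).natAbs : ℤ) ∣ l i) →
          g (k + l) = g k := by
        intro k l hl
        obtain ⟨h1, h2⟩ := hper k l hl
        rw [hgadd k l h1, (exp_two_pi_eq_one_iff _).mpr h2, mul_one]
      let ζ : (Fin n → ℤ) → ℂ := fun k => cexp (2 * π * I * L.formQ (L.orthDualVec w k) (1 ⊗ₜ b j))
      -- translation by `r bⱼ` multiplies the summand by `ζ ^ r`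
      have hr : ∀ r : ℕ, ∑ x : ∀ i, ZMod (L.form (w i) (w i)).natAbs, g (fun i => ((x i).val : ℤ))
          = ∑ x : ∀ i, ZMod (L.form (w i) (w i)).natAbs,
            g (fun i => ((x i).val : ℤ)) * ζ (fun i => ((x i).val : ℤ)) ^ r := by
        intro r
        have hrc : L.orthDualVec w ((r : ℤ) • c) = (r : ℚ) • ((1 : ℚ) ⊗ₜ[ℤ] b j) := by
          rw [← hc, orthDualVec, orthDualVec, Finset.smul_sum]
          refine Finset.sum_congr rfl fun i _ => ?_
          rw [smul_smul]
          congr 1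
          simp
          ring
        have hrl : L.orthDualVec w ((r : ℤ) • c) ∈ L.lat := by
          rw [hrc, Nat.cast_smul_eq_nsmul]
          exact nsmul_mem (⟨b j, rfl⟩ : (1 : ℚ) ⊗ₜ[ℤ] b j ∈ L.lat) r
        rw [← sum_box_shift (fun i => (L.form (w i) (w i)).natAbs) hgper ((r : ℤ) • c)]
        refine Finset.sum_congr rfl fun x _ => ?_
        rw [hgadd _ _ hrl, ← Complex.exp_nat_mul, hrc, map_smul]
        congr 2
        simp
        ring
      have hζN : ∀ k, ζ k ^ N = 1 := by
        intro k
        rw [← Complex.exp_nat_mul]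
        obtain ⟨m, hm⟩ : ∃ m : ℤ, (N : ℚ) * L.formQ (L.orthDualVec w k) (1 ⊗ₜ b j) = m := by
          have : ∀ i, L.form (w i) (w i) ∣ (N : ℤ) := fun i => by
            rw [← Int.natAbs_dvd]
            exact_mod_cast Finset.dvd_prod_of_mem (fun i => (L.form (w i) (w i)).natAbs)
              (Finset.mem_univ i)
          choose m hm using this
          refine ⟨∑ i, k i * c i * m i, ?_⟩
          rw [← hc, L.formQ_orthDualVec ho hne.out, Finset.mul_sum]
          push_cast
          refine Finset.sum_congr rfl fun i _ => ?_
          have h0 : (L.form (w i) (w i) : ℚ) ≠ 0 := by exact_mod_cast hne.out i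
          have h1 : (N : ℚ) = L.form (w i) (w i) * m i := by exact_mod_cast hm i
          rw [h1]; field_simp
        have := (exp_two_pi_eq_one_iff _).mpr ⟨m, hm⟩
        rw [← this]
        congr 1
        push_cast
        ring
      have hζ1 : ∀ k, ζ k = 1 ↔ ∃ m : ℤ, L.formQ (L.orthDualVec w k) (1 ⊗ₜ b j) = m :=
        fun k => exp_two_pi_eq_one_iff _
      have h1 : (N : ℂ) * ∑ x : ∀ i, ZMod (L.form (w i) (w i)).natAbs, g (fun i => ((x i).val : ℤ))
          = ∑ x : ∀ i, ZMod (L.form (w i) (w i)).natAbs, g (fun i => ((x i).val : ℤ)) *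
            if ζ (fun i => ((x i).val : ℤ)) = 1 then (N : ℂ) else 0 := by
        calc _ = ∑ r ∈ Finset.range N, ∑ x : ∀ i, ZMod (L.form (w i) (w i)).natAbs,
              g (fun i => ((x i).val : ℤ)) := by simp
          _ = ∑ r ∈ Finset.range N, ∑ x : ∀ i, ZMod (L.form (w i) (w i)).natAbs,
              g (fun i => ((x i).val : ℤ)) * ζ (fun i => ((x i).val : ℤ)) ^ r :=
            Finset.sum_congr rfl fun r _ => hr r
          _ = _ := by
            rw [Finset.sum_comm]
            refine Finset.sum_congr rfl fun x _ => ?_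
            rw [← Finset.mul_sum, sum_pow_eq_ite (hζN _)]
      refine mul_left_cancel₀ hN0 (h1.trans ?_)
      rw [Finset.mul_sum]
      refine Finset.sum_congr rfl fun x _ => ?_
      simp only [g, hζ1, Finset.forall_mem_insert]
      exact (mul_ite_and (∀ x_1 ∈ t, ∃ m : ℤ,
        L.formQ (L.orthDualVec w (fun i => ((x i).val : ℤ))) (1 ⊗ₜ b x_1) = m)
        (∃ m : ℤ, L.formQ (L.orthDualVec w (fun i => ((x i).val : ℤ))) (1 ⊗ₜ b j) = m) _ _).symm
  rw [key Finset.univ]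
  refine Finset.sum_congr rfl fun x _ => ?_
  simp only [L.mem_dual_iff_basis b, Finset.mem_univ, forall_const]

/-- The phase of the Gauss sum of the discriminant form: up to a positive factor it is the Gauss sum
of an orthogonal sublattice `M`, as the classes of `Λ^∨ / M` are equidistributed over `A_Λ`. -/
theorem exists_gaussSum_eq [Fintype L.DiscGroup] :
    ∃ r : ℝ, 0 < r ∧ L.gaussSum = r * cexp (π * I * L.sigma / 4) := by
  classical
  obtain ⟨w, ho, hne⟩ := L.exists_orthogonal
  have hne' : Fact (∀ i, L.form (w i) (w i) ≠ 0) := ⟨hne⟩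
  have h1 := (L.sum_box_expQ_restrict rfl ho).symm.trans (L.sum_box_expQ rfl ho)
  -- the number of elements of the box in a given class modulo `Λ` does not depend on the class
  let f : L.DiscGroup → (Fin (Module.finrank ℤ Λ) → ℤ) → ℂ := fun γ k =>
    if ∃ h : L.orthDualVec w k ∈ L.dual, (QuotientAddGroup.mk ⟨_, h⟩ : L.DiscGroup) = γ then 1 else 0
  let B := ∀ i, ZMod (L.form (w i) (w i)).natAbs
  have hshift : ∀ (γ : L.DiscGroup) (k l) (hl : L.orthDualVec w l ∈ L.dual),
      f (γ + QuotientAddGroup.mk ⟨_, hl⟩) (k + l) = f γ k := by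
    intro γ k l hl
    have : (∃ h : L.orthDualVec w (k + l) ∈ L.dual, (QuotientAddGroup.mk ⟨_, h⟩ : L.DiscGroup)
        = γ + QuotientAddGroup.mk ⟨_, hl⟩) ↔
        ∃ h : L.orthDualVec w k ∈ L.dual, (QuotientAddGroup.mk ⟨_, h⟩ : L.DiscGroup) = γ := by
      constructor
      · rintro ⟨h, e⟩
        have hk : L.orthDualVec w k ∈ L.dual := by
          have := sub_mem h hl
          rwa [orthDualVec_add, add_sub_cancel_right] at this
        refine ⟨hk, ?_⟩
        rw [← add_left_inj (QuotientAddGroup.mk ⟨_, hl⟩ : L.DiscGroup), ← e, ← QuotientAddGroup.mk_add]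
        congr 1
        exact Subtype.ext (L.orthDualVec_add k l).symm
      · rintro ⟨h, rfl⟩
        have hk : L.orthDualVec w (k + l) ∈ L.dual := by
          rw [orthDualVec_add]; exact add_mem h hl
        refine ⟨hk, ?_⟩
        rw [← QuotientAddGroup.mk_add]
        congr 1
        exact Subtype.ext (L.orthDualVec_add k l)
    simp only [f, this]
  have hper : ∀ γ, ∀ k l : Fin (Module.finrank ℤ Λ) → ℤ,
      (∀ i, ((L.form (w i) (w i)).natAbs : ℤ) ∣ l i) → f γ (k + l) = f γ k := by
    intro γ k l hl
    have hlat : L.orthDualVec w l ∈ L.lat :=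
      L.orthDualVec_mem_lat hne fun i => Int.natAbs_dvd.mp (hl i)
    have := hshift γ k l (L.lat_le_dual hlat)
    rwa [(QuotientAddGroup.eq_zero_iff _).mpr (AddSubgroup.mem_addSubgroupOf.mpr hlat), add_zero]
      at this
  have hcount : ∀ γ, ∑ x : B, f γ (fun i => ((x i).val : ℤ)) = ∑ x : B, f 0 (fun i => ((x i).val : ℤ)) := by
    intro γ
    induction γ using QuotientAddGroup.induction_on with | _ y
    obtain ⟨l, hl⟩ := L.exists_orthDualVec_eq rfl ho hne y.2
    have hl' : L.orthDualVec w l ∈ L.dual := by rw [hl]; exact y.2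
    rw [← sum_box_shift _ (hper _) l]
    refine Finset.sum_congr rfl fun x _ => ?_
    rw [← hshift 0 _ l hl', zero_add]
    congr 2
    exact Subtype.ext hl.symm
  let N : ℕ := (Finset.univ.filter fun x : B =>
    ∃ h : L.orthDualVec w (fun i => ((x i).val : ℤ)) ∈ L.dual,
      (QuotientAddGroup.mk ⟨_, h⟩ : L.DiscGroup) = 0).card
  have hN : ∑ x : B, f 0 (fun i => ((x i).val : ℤ)) = N := by
    simp only [f, N, Finset.sum_boole]
  have hN0 : 0 < N := by
    refine Finset.card_pos.mpr ⟨0, ?_⟩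
    rw [Finset.mem_filter]
    have h0 : L.orthDualVec w (fun i => (((0 : B) i).val : ℤ)) = 0 := by
      refine Finset.sum_eq_zero fun i _ => ?_
      have : ((((0 : B) i).val : ℤ) : ℚ) = 0 := by
        change (((0 : ZMod (L.form (w i) (w i)).natAbs).val : ℤ) : ℚ) = 0
        simp
      simp only [this, zero_div, zero_smul]
    refine ⟨Finset.mem_univ _, by rw [h0]; exact zero_mem _, ?_⟩
    rw [QuotientAddGroup.eq_zero_iff, AddSubgroup.mem_addSubgroupOf]
    change L.orthDualVec w _ ∈ L.lat
    rw [h0]; exact zero_mem _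
  have h2 : ∀ k : Fin (Module.finrank ℤ Λ) → ℤ,
      (if L.orthDualVec w k ∈ L.dual then L.expQ (L.orthDualVec w k) else 0)
        = ∑ γ, eHalf (L.q γ) * f γ k := by
    intro k
    split_ifs with h
    · rw [Finset.sum_eq_single (QuotientAddGroup.mk ⟨_, h⟩ : L.DiscGroup)]
      · simp only [f]
        rw [if_pos ⟨h, trivial⟩, mul_one, q_mk, eHalf_coe, expQ]
      · intro γ _ hγ
        simp only [f]
        rw [if_neg, mul_zero]
        rintro ⟨_, e⟩
        exact hγ e.symm
      · simp
    · symm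
      refine Finset.sum_eq_zero fun γ _ => ?_
      simp only [f]
      rw [if_neg, mul_zero]
      rintro ⟨h', _⟩
      exact h h'
  rw [Finset.sum_congr rfl fun x _ => h2 _, Finset.sum_comm] at h1
  simp_rw [← Finset.mul_sum] at h1
  rw [Finset.sum_congr rfl fun γ _ => by rw [hcount γ, hN], ← Finset.sum_mul] at h1
  refine ⟨(∏ i, √((L.form (w i) (w i)).natAbs : ℝ)) / N, ?_, ?_⟩
  · refine div_pos (Finset.prod_pos fun i _ => Real.sqrt_pos.mpr ?_) (by exact_mod_cast hN0)
    exact_mod_cast Int.natAbs_pos.mpr (hne i)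
  · have : (N : ℂ) ≠ 0 := by exact_mod_cast hN0.ne'
    rw [gaussSum, eq_comm, Complex.ofReal_div, Complex.ofReal_natCast, div_mul_eq_mul_div, ← h1]
    field_simp

/-- **Milgram's formula**; the absolute value comes from `gaussSum_mul_conj`. -/
theorem gaussSum_eq [Fintype L.DiscGroup] :
    L.gaussSum = √(Fintype.card L.DiscGroup : ℝ) * cexp (π * I * L.sigma / 4) := by
  obtain ⟨r, hr, h⟩ := L.exists_gaussSum_eq
  have h2 := L.gaussSum_mul_conj
  have hn : ‖cexp (π * I * L.sigma / 4)‖ = 1 := by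
    rw [Complex.norm_exp]; simp
  rw [Complex.mul_conj, Complex.normSq_eq_norm_sq, h, norm_mul, hn, Complex.norm_real, mul_one,
    Real.norm_of_nonneg hr.le] at h2
  have h3 : r ^ 2 = (Fintype.card L.DiscGroup : ℝ) := by exact_mod_cast h2
  rw [h, ← h3, Real.sqrt_sq hr.le]

end Milgram

end EvenLattice

/-! ### The Weil representation of a 2-elementary lattice -/

namespace EvenLattice

variable {Λ : Type*} [AddCommGroup Λ] {L : EvenLattice Λ}

theorem IsTwoElementary.finite (hL : L.IsTwoElementary) : Finite L.DiscGroup := by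
  obtain ⟨l, ⟨e⟩⟩ := hL
  exact Finite.of_equiv _ e.symm.toEquiv

theorem IsTwoElementary.add_self (hL : L.IsTwoElementary) (γ : L.DiscGroup) : γ + γ = 0 := by
  obtain ⟨l, ⟨e⟩⟩ := hL
  apply e.injective
  rw [map_add, map_zero]
  funext i
  exact CharTwo.add_self_eq_zero _

theorem IsTwoElementary.card_eq (hL : L.IsTwoElementary) : Nat.card L.DiscGroup = 2 ^ L.len := by
  obtain ⟨l, ⟨e⟩⟩ := hL
  rw [L.len_eq e, Nat.card_congr e.toEquiv]
  simp

theorem IsTwoElementary.neg_eq (hL : L.IsTwoElementary) (γ : L.DiscGroup) : -γ = γ :=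
  neg_eq_of_add_eq_zero_left (hL.add_self γ)

theorem IsTwoElementary.neg_b (hL : L.IsTwoElementary) (γ δ : L.DiscGroup) : -L.b γ δ = L.b γ δ := by
  have : L.b γ δ + L.b γ δ = 0 := by rw [← b_add_left, hL.add_self, b_zero_left]
  exact neg_eq_of_add_eq_zero_left this

theorem IsTwoElementary.eOne_b_sq (hL : L.IsTwoElementary) (γ δ : L.DiscGroup) :
    eOne (L.b γ δ) * eOne (L.b γ δ) = 1 := by
  rw [← eOne_add, ← b_add_left, hL.add_self, b_zero_left, eOne_zero]

variable (L) in
theorem eHalf_q_sq (γ : L.DiscGroup) : eHalf (L.q γ) ^ 2 = eOne (L.b γ γ) := by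
  induction γ using QuotientAddGroup.induction_on with | _ x
  rw [q_mk, b_mk, eHalf_coe, eOne_coe, ← Complex.exp_nat_mul]
  congr 1
  push_cast
  ring

/-- As `2γ = 0`, the numbers `e^{πiγ²}` are fourth roots of unity. -/
theorem IsTwoElementary.eHalf_q_pow_four (hL : L.IsTwoElementary) (γ : L.DiscGroup) :
    eHalf (L.q γ) ^ 4 = 1 := by
  rw [show 4 = 2 * 2 from rfl, pow_mul, eHalf_q_sq, pow_two, hL.eOne_b_sq]

section Construction

variable [Fintype L.DiscGroup]

variable (L) in
/-- The scalar `e^{-πiσ/4} / |A|^{1/2}` in the formula for `S`. -/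
def weilConst : ℂ := cexp (-(π * I * L.sigma / 4)) / (Real.sqrt (Nat.card L.DiscGroup) : ℂ)

variable (L) in
/-- The action of `T` on `ℂ[A_Λ]`. -/
def weilT : Module.End ℂ (L.DiscGroup → ℂ) where
  toFun u := fun γ => eHalf (L.q γ) * u γ
  map_add' u v := by funext γ; simp [mul_add]
  map_smul' c u := by funext γ; simp [mul_left_comm]

variable (L) in
/-- The action of `S` on `ℂ[A_Λ]`; for a 2-elementary lattice `e^{-2πi⟨γ,δ⟩} = e^{2πi⟨γ,δ⟩}`. -/
def weilS : Module.End ℂ (L.DiscGroup → ℂ) where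
  toFun u := fun δ => L.weilConst * ∑ γ, eOne (L.b γ δ) * u γ
  map_add' u v := by funext γ; simp [mul_add, Finset.sum_add_distrib]
  map_smul' c u := by
    funext γ
    simp only [Pi.smul_apply, smul_eq_mul, RingHom.id_apply, mul_left_comm _ c, ← Finset.mul_sum]

theorem weilConst_sq_mul_card [Module.Free ℤ Λ] [Module.Finite ℤ Λ] :
    L.weilConst ^ 2 * Fintype.card L.DiscGroup = cexp (-(π * I * L.sigma / 2)) := by
  have h0 : (0 : ℝ) < Fintype.card L.DiscGroup := by exact_mod_cast Fintype.card_pos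
  have hs : ((√(Fintype.card L.DiscGroup : ℝ) : ℝ) : ℂ) ^ 2 = Fintype.card L.DiscGroup := by
    rw [← Complex.ofReal_pow, Real.sq_sqrt h0.le]; simp
  have hne : (Fintype.card L.DiscGroup : ℂ) ≠ 0 := by exact_mod_cast h0.ne'
  rw [weilConst, Nat.card_eq_fintype_card, div_pow, hs, div_mul_cancel₀ _ hne, ← Complex.exp_nat_mul]
  congr 1
  push_cast
  ring

theorem weilConst_mul_gaussSum [Module.Free ℤ Λ] [Module.Finite ℤ Λ] :
    L.weilConst * L.gaussSum = 1 := by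
  have h0 : (0 : ℝ) < Fintype.card L.DiscGroup := by exact_mod_cast Fintype.card_pos
  have hne : ((√(Fintype.card L.DiscGroup : ℝ) : ℝ) : ℂ) ≠ 0 := by
    exact_mod_cast (Real.sqrt_pos.mpr h0).ne'
  rw [weilConst, gaussSum_eq, Nat.card_eq_fintype_card, div_mul_eq_mul_div, div_eq_one_iff_eq hne,
    mul_left_comm, ← Complex.exp_add]
  simp

/-- Completing the square in the Gauss sum. -/
theorem sum_eHalf_mul_eOne (x : L.DiscGroup) :
    ∑ δ, eHalf (L.q δ) * eOne (L.b δ x) = L.gaussSum * starRingEnd ℂ (eHalf (L.q x)) := by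
  have h : ∀ δ, eHalf (L.q δ) * eOne (L.b δ x)
      = eHalf (L.q (δ + x)) * starRingEnd ℂ (eHalf (L.q x)) := by
    intro δ
    rw [eHalf_q_add]
    linear_combination -(eHalf (L.q δ) * eOne (L.b δ x)) * eHalf_mul_conj (L.q x)
  rw [Finset.sum_congr rfl fun δ _ => h δ, ← Finset.sum_mul]
  congr 1
  exact Equiv.sum_comp (Equiv.addRight x) fun γ => eHalf (L.q γ)

variable [Module.Free ℤ Λ] [Module.Finite ℤ Λ]

theorem weilS_weilS (hL : L.IsTwoElementary) (u : L.DiscGroup → ℂ) :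
    L.weilS (L.weilS u) = cexp (-(π * I * L.sigma / 2)) • u := by
  classical
  funext ε
  simp only [weilS, LinearMap.coe_mk, AddHom.coe_mk, Pi.smul_apply, smul_eq_mul]
  have h1 : ∀ γ, ∑ δ, eOne (L.b δ ε) * (L.weilConst * (eOne (L.b γ δ) * u γ))
      = if γ = ε then L.weilConst * Fintype.card L.DiscGroup * u γ else 0 := by
    intro γ
    have : ∀ δ, eOne (L.b δ ε) * (L.weilConst * (eOne (L.b γ δ) * u γ))
        = L.weilConst * u γ * eOne (L.b δ (ε + γ)) := by
      intro δ
      rw [b_add_right, eOne_add, L.b_comm γ δ]; ring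
    rw [Finset.sum_congr rfl fun δ _ => this δ, ← Finset.mul_sum, sum_eOne_b]
    have h2 : ε + γ = 0 ↔ γ = ε := by
      rw [add_eq_zero_iff_eq_neg, hL.neg_eq, eq_comm]
    simp only [h2]
    split_ifs <;> ring
  simp_rw [Finset.mul_sum]
  rw [Finset.sum_comm]
  simp_rw [← Finset.mul_sum]
  simp_rw [h1]
  rw [Finset.sum_ite_eq' , if_pos (Finset.mem_univ _), ← weilConst_sq_mul_card]
  ring

/-- The braid relation for the operators, as a formula: completing the square reduces it to
Milgram's formula. -/
theorem weilS_weilT_weilS (hL : L.IsTwoElementary) (u : L.DiscGroup → ℂ) (ε : L.DiscGroup) :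
    L.weilS (L.weilT (L.weilS u)) ε
      = L.weilConst * ∑ γ, eOne (L.b γ ε) * (starRingEnd ℂ (eHalf (L.q ε)) *
        (starRingEnd ℂ (eHalf (L.q γ)) * u γ)) := by
  simp only [weilS, weilT, LinearMap.coe_mk, AddHom.coe_mk]
  simp_rw [Finset.mul_sum]
  rw [Finset.sum_comm]
  refine Finset.sum_congr rfl fun γ _ => ?_
  have h : ∀ δ, L.weilConst * (eOne (L.b δ ε) * (eHalf (L.q δ) * (L.weilConst * (eOne (L.b γ δ) * u γ))))
      = L.weilConst * L.weilConst * u γ * (eHalf (L.q δ) * eOne (L.b δ (γ + ε))) := by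
    intro δ
    rw [b_add_right, eOne_add, L.b_comm γ δ]; ring
  rw [Finset.sum_congr rfl fun δ _ => h δ, ← Finset.mul_sum, sum_eHalf_mul_eOne, eHalf_q_add]
  have hc : starRingEnd ℂ (eOne (L.b γ ε)) = eOne (L.b γ ε) := by
    rcases mul_self_eq_one_iff.mp (hL.eOne_b_sq γ ε) with h | h <;> rw [h] <;> simp
  rw [map_mul, map_mul, hc]
  linear_combination (L.weilConst * u γ * starRingEnd ℂ (eHalf (L.q γ)) *
    starRingEnd ℂ (eHalf (L.q ε)) * eOne (L.b γ ε)) * weilConst_mul_gaussSum (L := L)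

end Construction

theorem weilT_e [Fintype L.DiscGroup] (γ : L.DiscGroup) : L.weilT (L.e γ) = eHalf (L.q γ) • L.e γ := by
  funext δ
  simp only [weilT, e, LinearMap.coe_mk, AddHom.coe_mk, Pi.smul_apply, smul_eq_mul]
  split_ifs with h
  · rw [h]
  · simp

theorem weilS_e [Fintype L.DiscGroup] (hL : L.IsTwoElementary) (γ : L.DiscGroup) :
    L.weilS (L.e γ) = L.weilConst • (fun δ => eOne (-(L.b γ δ))) := by
  funext δ
  simp [weilS, e, hL.neg_b]

/-- The operators satisfy `S⁸ = 1`, as `S²` is the scalar `e^{-πiσ/2}`, and the braid relation, so the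
presentation of `Mp₂(ℤ)` applies. -/
theorem exists_isWeilRep [Module.Free ℤ Λ] [Module.Finite ℤ Λ] (hL : L.IsTwoElementary) :
    ∃ ρ, L.IsWeilRep ρ := by
  have := hL.finite
  have : Fintype L.DiscGroup := Fintype.ofFinite _
  set κ : ℂ := cexp (-(π * I * L.sigma / 2)) with hκ
  have hκ0 : κ ≠ 0 := Complex.exp_ne_zero _
  have hSS : L.weilS * L.weilS = κ • (1 : Module.End ℂ (L.DiscGroup → ℂ)) := by
    refine LinearMap.ext fun u => ?_
    exact weilS_weilS hL u
  let s : (Module.End ℂ (L.DiscGroup → ℂ))ˣ :=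
    { val := L.weilS
      inv := κ⁻¹ • L.weilS
      val_inv := by rw [mul_smul_comm, hSS, smul_smul, inv_mul_cancel₀ hκ0, one_smul]
      inv_val := by rw [smul_mul_assoc, hSS, smul_smul, inv_mul_cancel₀ hκ0, one_smul] }
  let ti : Module.End ℂ (L.DiscGroup → ℂ) :=
    { toFun := fun u γ => starRingEnd ℂ (eHalf (L.q γ)) * u γ
      map_add' := fun u v => by funext γ; simp [mul_add]
      map_smul' := fun c u => by funext γ; simp [mul_left_comm] }
  let t : (Module.End ℂ (L.DiscGroup → ℂ))ˣ :=
    { val := L.weilT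
      inv := ti
      val_inv := by
        refine LinearMap.ext fun u => funext fun γ => ?_
        change eHalf (L.q γ) * (starRingEnd ℂ (eHalf (L.q γ)) * u γ) = u γ
        rw [← mul_assoc, eHalf_mul_conj, one_mul]
      inv_val := by
        refine LinearMap.ext fun u => funext fun γ => ?_
        change starRingEnd ℂ (eHalf (L.q γ)) * (eHalf (L.q γ) * u γ) = u γ
        rw [← mul_assoc, mul_comm (starRingEnd ℂ _), eHalf_mul_conj, one_mul] }
  have h8 : s ^ 8 = 1 := by
    refine Units.ext ?_
    rw [Units.val_pow_eq_pow_val, show 8 = 2 * 4 from rfl, pow_mul, pow_two]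
    change (L.weilS * L.weilS) ^ 4 = 1
    rw [hSS, smul_pow, one_pow, hκ, ← Complex.exp_nat_mul]
    have : ((4 : ℕ) : ℂ) * -(π * I * L.sigma / 2) = (-L.sigma : ℤ) * (2 * π * I) := by
      push_cast; ring
    rw [this, Complex.exp_int_mul_two_pi_mul_I, one_smul]
  have hb : s * t * s = t⁻¹ * s * t⁻¹ := by
    refine Units.ext (LinearMap.ext fun u => funext fun ε => ?_)
    change L.weilS (L.weilT (L.weilS u)) ε = starRingEnd ℂ (eHalf (L.q ε)) *
      (L.weilConst * ∑ γ, eOne (L.b γ ε) * (starRingEnd ℂ (eHalf (L.q γ)) * u γ))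
    rw [weilS_weilT_weilS hL]
    simp only [Finset.mul_sum]
    exact Finset.sum_congr rfl fun γ _ => by ring
  obtain ⟨f, hS, hT⟩ := Mp2Z.exists_monoidHom s t h8 hb
  refine ⟨(Units.coeHom _).comp f, fun γ => ?_, fun γ => ?_⟩
  · rw [MonoidHom.comp_apply, hT]
    exact weilT_e γ
  · rw [MonoidHom.comp_apply, hS]
    exact weilS_e hL γ

theorem end_ext [Finite L.DiscGroup] {A B : Module.End ℂ (L.DiscGroup → ℂ)}
    (h : ∀ γ, A (L.e γ) = B (L.e γ)) : A = B := by
  classical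
  have : Fintype L.DiscGroup := Fintype.ofFinite _
  let b : Module.Basis L.DiscGroup ℂ (L.DiscGroup → ℂ) := Pi.basisFun ℂ L.DiscGroup
  refine Module.Basis.ext b fun γ => ?_
  have hγ : b γ = L.e γ := by
    funext δ
    simp [b, e, Pi.single_apply]
  rw [hγ, h γ]

theorem isWeilRep_unique (hL : L.IsTwoElementary) {ρ ρ' : Mp2Z →* Module.End ℂ (L.DiscGroup → ℂ)}
    (h : L.IsWeilRep ρ) (h' : L.IsWeilRep ρ') : ρ = ρ' := by
  have := hL.finite
  refine MonoidHom.eq_of_eqOn_dense Mp2Z.closure_S_T ?_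
  rintro x (rfl | hx)
  · exact end_ext fun γ => (h.2 γ).trans (h'.2 γ).symm
  · rw [Set.mem_singleton_iff] at hx; subst hx
    exact end_ext fun γ => (h.1 γ).trans (h'.1 γ).symm

theorem isWeilRep_weilRep [Module.Free ℤ Λ] [Module.Finite ℤ Λ] (hL : L.IsTwoElementary) :
    L.IsWeilRep L.weilRep := by
  have h := exists_isWeilRep hL
  rw [weilRep, dif_pos h]
  exact h.choose_spec

theorem weilRep_mul_apply (g h : Mp2Z) (u : L.DiscGroup → ℂ) :
    L.weilRep (g * h) u = L.weilRep g (L.weilRep h u) := by rw [map_mul]; rfl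

theorem weilRep_inv_eq_of_eq {g : Mp2Z} {u v : L.DiscGroup → ℂ} (h : L.weilRep g u = v) :
    L.weilRep g⁻¹ v = u := by
  rw [← h, ← weilRep_mul_apply, inv_mul_cancel, map_one]; rfl

section Values

variable [Module.Free ℤ Λ] [Module.Finite ℤ Λ]

theorem weilRep_T [Fintype L.DiscGroup] (hL : L.IsTwoElementary) : L.weilRep Mp2Z.T = L.weilT := by
  refine end_ext fun γ => ?_
  rw [(isWeilRep_weilRep hL).1 γ, weilT_e]

theorem weilRep_S [Fintype L.DiscGroup] (hL : L.IsTwoElementary) : L.weilRep Mp2Z.S = L.weilS := by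
  refine end_ext fun γ => ?_
  rw [(isWeilRep_weilRep hL).2 γ, weilS_e hL, weilConst]

theorem weilRep_S_sq (hL : L.IsTwoElementary) (u : L.DiscGroup → ℂ) :
    L.weilRep (Mp2Z.S ^ 2) u = cexp (-(π * I * L.sigma / 2)) • u := by
  have := hL.finite
  have : Fintype L.DiscGroup := Fintype.ofFinite _
  rw [pow_two, weilRep_mul_apply, weilRep_S hL, weilS_weilS hL]

theorem weilRep_T_apply (hL : L.IsTwoElementary) (u : L.DiscGroup → ℂ) :
    L.weilRep Mp2Z.T u = fun γ => eHalf (L.q γ) * u γ := by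
  have := hL.finite
  have : Fintype L.DiscGroup := Fintype.ofFinite _
  rw [weilRep_T hL]; rfl

theorem weilRep_T_pow_apply (hL : L.IsTwoElementary) (n : ℕ) (u : L.DiscGroup → ℂ) :
    L.weilRep (Mp2Z.T ^ n) u = fun γ => eHalf (L.q γ) ^ n * u γ := by
  induction n with
  | zero => simp
  | succ n ih =>
    rw [pow_succ', weilRep_mul_apply, ih, weilRep_T_apply hL]
    funext γ
    ring

theorem weilRep_T_pow_inv_apply (hL : L.IsTwoElementary) (n : ℕ) (u : L.DiscGroup → ℂ) :
    L.weilRep (Mp2Z.T ^ n)⁻¹ u = fun γ => (eHalf (L.q γ) ^ n)⁻¹ * u γ := by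
  refine weilRep_inv_eq_of_eq ?_
  rw [weilRep_T_pow_apply hL]
  funext γ
  have : eHalf (L.q γ) ≠ 0 := by
    rw [← norm_ne_zero_iff, norm_eHalf]; exact one_ne_zero
  field_simp

theorem weilRep_T_e_zero (hL : L.IsTwoElementary) : L.weilRep Mp2Z.T (L.e 0) = L.e 0 := by
  rw [(isWeilRep_weilRep hL).1, eHalf_q_zero, one_smul]

variable (L) in
/-- The scalar `e^{πiσ/4} / |A|^{1/2}` in the formula for `S⁻¹`. -/
def weilConstInv : ℂ := cexp (π * I * L.sigma / 4) / (Real.sqrt (Nat.card L.DiscGroup) : ℂ)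

theorem weilRep_S_inv_e_zero (hL : L.IsTwoElementary) :
    L.weilRep Mp2Z.S⁻¹ (L.e 0) = fun _ => L.weilConstInv := by
  have h1 := weilRep_S_sq hL (L.e 0)
  rw [pow_two, weilRep_mul_apply] at h1
  have h2 := weilRep_inv_eq_of_eq h1
  rw [map_smul] at h2
  have h3 : L.weilRep Mp2Z.S⁻¹ (L.e 0)
      = cexp (π * I * L.sigma / 2) • L.weilRep Mp2Z.S (L.e 0) := by
    rw [← h2, smul_smul, ← Complex.exp_add]; simp
  rw [h3, (isWeilRep_weilRep hL).2]
  funext δ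
  simp only [Pi.smul_apply, smul_eq_mul, b_zero_left, neg_zero, eOne_zero, mul_one, weilConstInv]
  rw [mul_div_assoc', ← Complex.exp_add]
  congr 2
  ring

theorem weilRep_ST_pow_inv_e_zero (hL : L.IsTwoElementary) (n : ℕ) :
    L.weilRep (Mp2Z.S * Mp2Z.T ^ n)⁻¹ (L.e 0)
      = fun δ => L.weilConstInv * (eHalf (L.q δ) ^ n)⁻¹ := by
  rw [mul_inv_rev, weilRep_mul_apply, weilRep_S_inv_e_zero hL, weilRep_T_pow_inv_apply hL]
  funext δ; ring

/-- The characteristic element appears because `⟨γ, 1_Λ⟩ ≡ γ²`: applying `S` to `e_{1_Λ}` gives a multiple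
of `∑_γ e^{2πiγ²} e_γ`. -/
theorem weilRep_STTS_inv_e_zero (hL : L.IsTwoElementary) :
    L.weilRep (Mp2Z.S * Mp2Z.T ^ 2 * Mp2Z.S)⁻¹ (L.e 0) = cexp (π * I * L.sigma / 2) • L.e L.one := by
  rw [mul_inv_rev, weilRep_mul_apply, weilRep_ST_pow_inv_e_zero hL]
  refine weilRep_inv_eq_of_eq ?_
  rw [map_smul, (isWeilRep_weilRep hL).2]
  funext δ
  have h1 := L.one_spec hL δ
  simp only [Pi.smul_apply, smul_eq_mul, eHalf_q_sq, hL.neg_b, L.b_comm L.one δ, h1, weilConstInv]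
  have h2 : (eOne (L.b δ δ))⁻¹ = eOne (L.b δ δ) := inv_eq_of_mul_eq_one_left (hL.eOne_b_sq δ δ)
  rw [h2, ← mul_assoc, mul_div_assoc', ← Complex.exp_add]
  congr 3
  ring

theorem weilRep_ST4S_e_zero (hL : L.IsTwoElementary) :
    L.weilRep (Mp2Z.S * Mp2Z.T ^ 4 * Mp2Z.S⁻¹) (L.e 0) = L.e 0 := by
  rw [weilRep_mul_apply, weilRep_mul_apply, weilRep_T_pow_apply hL]
  simp only [hL.eHalf_q_pow_four, one_mul]
  rw [← weilRep_mul_apply, mul_inv_cancel, map_one]; rfl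

/-! ### Arithmetic of the discriminant form -/

/-- `1_Λ² ≡ σ/2 mod 2`: shifting the Gauss sum by `1_Λ` conjugates it. -/
theorem eHalf_q_one (hL : L.IsTwoElementary) : eHalf (L.q L.one) = cexp (π * I * L.sigma / 2) := by
  have := hL.finite
  have : Fintype L.DiscGroup := Fintype.ofFinite _
  -- `(δ + 1_Λ)² ≡ δ² + 1_Λ² + 2⟨δ, 1_Λ⟩`, where `e^{2πi⟨δ, 1_Λ⟩} = e^{2πiδ²}` and `e^{3πiδ²} = e^{-πiδ²}`
  have h1 : L.gaussSum = eHalf (L.q L.one) * starRingEnd ℂ L.gaussSum := by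
    rw [gaussSum, map_sum, Finset.mul_sum, ← Equiv.sum_comp (Equiv.addRight L.one)]
    refine Finset.sum_congr rfl fun δ _ => ?_
    rw [Equiv.coe_addRight, eHalf_q_add, L.one_spec hL δ, ← eHalf_q_sq]
    have h4 := hL.eHalf_q_pow_four δ
    have hc := eHalf_mul_conj (L.q δ)
    linear_combination (eHalf (L.q L.one) * starRingEnd ℂ (eHalf (L.q δ))) * h4
      - eHalf (L.q L.one) * eHalf (L.q δ) ^ 3 * hc
  have h0 : (0 : ℝ) < Fintype.card L.DiscGroup := by exact_mod_cast Fintype.card_pos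
  have hne : ((√(Fintype.card L.DiscGroup : ℝ) : ℝ) : ℂ) ≠ 0 := by
    exact_mod_cast (Real.sqrt_pos.mpr h0).ne'
  rw [gaussSum_eq, map_mul, Complex.conj_ofReal, ← Complex.exp_conj, mul_left_comm] at h1
  have h2 := mul_left_cancel₀ hne h1
  have h3 : starRingEnd ℂ (π * I * L.sigma / 4) = -(π * I * L.sigma / 4) := by
    simp [Complex.conj_ofNat, neg_div]
  rw [h3, Complex.exp_neg] at h2
  have h4 := Complex.exp_ne_zero (π * I * L.sigma / 4)
  rw [show (π * I * L.sigma / 2 : ℂ) = π * I * L.sigma / 4 + π * I * L.sigma / 4 by ring,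
    Complex.exp_add]
  field_simp at h2
  linear_combination -h2

theorem even_of_sq_eq_two_pow {a : ℤ} {m : ℕ} (h : a ^ 2 = 2 ^ m) : Even m := by
  have h1 : a.natAbs ^ 2 = 2 ^ m := by
    zify
    rw [sq_abs, h]
  have h2 := congrArg (padicValNat 2) h1
  have ha : a.natAbs ≠ 0 := by
    intro h0
    rw [h0] at h1
    simp at h1
    exact absurd h1.symm (by positivity)
  rw [padicValNat.pow, padicValNat.prime_pow] at h2
  exact ⟨padicValNat 2 a.natAbs, by omega⟩

/-- `l(Λ) ≡ σ(Λ) mod 2`, as the Gauss sum is a Gaussian integer `a + bi` with `a² + b² = 2^l` and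
argument `πσ/4`: it lies on a coordinate axis for even `σ` and on a diagonal for odd `σ`. -/
theorem even_len_add_sigma (hL : L.IsTwoElementary) : Even ((L.len : ℤ) + L.sigma) := by
  have := hL.finite
  have : Fintype L.DiscGroup := Fintype.ofFinite _
  have hcard : Fintype.card L.DiscGroup = 2 ^ L.len := by
    rw [← Nat.card_eq_fintype_card, hL.card_eq]
  obtain ⟨a, b, hab⟩ : ∃ a b : ℤ, L.gaussSum = a + b * I := by
    have hγ : ∀ γ, ∃ a b : ℤ, eHalf (L.q γ) = a + b * I := by
      intro γ
      have h4 : (eHalf (L.q γ) ^ 2) ^ 2 = 1 := by rw [← pow_mul]; exact hL.eHalf_q_pow_four γ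
      have h5 : (eHalf (L.q γ) - 1) * (eHalf (L.q γ) + 1) *
          ((eHalf (L.q γ) - I) * (eHalf (L.q γ) + I)) = 0 := by
        linear_combination h4 + (1 - eHalf (L.q γ) ^ 2) * Complex.I_sq
      rcases mul_eq_zero.mp h5 with h | h <;> rcases mul_eq_zero.mp h with h | h
      · exact ⟨1, 0, by push_cast; linear_combination h⟩
      · exact ⟨-1, 0, by push_cast; linear_combination h⟩
      · exact ⟨0, 1, by push_cast; linear_combination h⟩
      · exact ⟨0, -1, by push_cast; linear_combination h⟩
    choose a b h using hγ
    refine ⟨∑ γ, a γ, ∑ γ, b γ, ?_⟩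
    rw [gaussSum, Finset.sum_congr rfl fun γ _ => h γ, Finset.sum_add_distrib, ← Finset.sum_mul]
    push_cast
    rfl
  have hsq : L.gaussSum ^ 2 = 2 ^ L.len * cexp (π * I * L.sigma / 2) := by
    have h0 : (0 : ℝ) ≤ Fintype.card L.DiscGroup := by positivity
    have hs : ((√(Fintype.card L.DiscGroup : ℝ) : ℝ) : ℂ) ^ 2 = 2 ^ L.len := by
      rw [← Complex.ofReal_pow, Real.sq_sqrt h0, hcard]; simp
    rw [gaussSum_eq, mul_pow, hs, ← Complex.exp_nat_mul]
    congr 2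
    push_cast
    ring
  have hnorm : a ^ 2 + b ^ 2 = 2 ^ L.len := by
    have h := L.gaussSum_mul_conj
    rw [hab, hcard] at h
    simp only [map_add, map_mul, Complex.conj_I, map_intCast] at h
    have : ((a ^ 2 + b ^ 2 : ℤ) : ℂ) = ((2 ^ L.len : ℤ) : ℂ) := by
      push_cast at h ⊢
      linear_combination h + (b : ℂ) ^ 2 * Complex.I_sq
    exact_mod_cast this
  rw [hab] at hsq
  rcases Int.even_or_odd L.sigma with hσ | hσ
  · obtain ⟨s, hs⟩ := hσ
    have he : cexp (π * I * L.sigma / 2) = (-1) ^ s := by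
      rw [← Complex.exp_pi_mul_I, ← Complex.exp_int_mul, hs]
      congr 1; push_cast; ring
    have hab0 : a * b = 0 := by
      have him := congrArg Complex.im hsq
      rw [he] at him
      have h1 : ((2 : ℂ) ^ L.len * (-1) ^ s).im = 0 := by
        have : ((2 : ℂ) ^ L.len * (-1) ^ s) = (((2 : ℝ) ^ L.len * (-1) ^ s : ℝ) : ℂ) := by push_cast; rfl
        rw [this, Complex.ofReal_im]
      rw [h1] at him
      simp [pow_two] at him
      have : (a : ℝ) * b = 0 := by linarith
      exact_mod_cast this
    have hl : Even L.len := by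
      rcases mul_eq_zero.mp hab0 with h | h
      · exact even_of_sq_eq_two_pow (a := b) (by rw [← hnorm, h]; ring)
      · exact even_of_sq_eq_two_pow (a := a) (by rw [← hnorm, h]; ring)
    exact Even.add (by exact_mod_cast hl) ⟨s, hs⟩
  · obtain ⟨s, hs⟩ := hσ
    have he : cexp (π * I * L.sigma / 2) = (-1) ^ s * I := by
      have h1 : (π * I * L.sigma / 2 : ℂ) = s * (π * I) + π / 2 * I := by
        rw [hs]; push_cast; ring
      rw [h1, Complex.exp_add, Complex.exp_int_mul, Complex.exp_pi_mul_I,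
        Complex.exp_pi_div_two_mul_I]
    have hab0 : a ^ 2 = b ^ 2 := by
      have hre := congrArg Complex.re hsq
      rw [he] at hre
      have h1 : ((2 : ℂ) ^ L.len * ((-1) ^ s * I)).re = 0 := by
        have : ((2 : ℂ) ^ L.len * ((-1) ^ s * I)) = (((2 : ℝ) ^ L.len * (-1) ^ s : ℝ) : ℂ) * I := by
          push_cast; ring
        rw [this, Complex.re_ofReal_mul]; simp
      rw [h1] at hre
      simp [pow_two] at hre
      have : (a : ℝ) ^ 2 = b ^ 2 := by linarith
      exact_mod_cast this
    have hl : ¬ Even L.len := by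
      intro hev
      rw [← hab0] at hnorm
      have hpos : L.len ≠ 0 := by
        intro h0
        rw [h0, pow_zero] at hnorm
        omega
      obtain ⟨m, hm⟩ := Nat.exists_eq_succ_of_ne_zero hpos
      have hpow : (2 : ℤ) ^ L.len = 2 ^ m * 2 := by rw [hm, pow_succ]
      have := even_of_sq_eq_two_pow (a := a) (m := m) (by linarith)
      rw [hm] at hev
      exact (Nat.even_add_one.mp hev) this
    have hodd : Odd (L.len : ℤ) := by
      exact_mod_cast Nat.not_even_iff_odd.mp hl
    exact hodd.add_odd ⟨s, hs⟩

/-- `l(Λ)` is at most the rank: the sums of distinct members of a dual basis exhaust `A_Λ`. -/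
theorem len_le_finrank (hL : L.IsTwoElementary) : L.len ≤ Module.finrank ℤ Λ := by
  classical
  have := hL.finite
  let b := Module.finBasis ℤ Λ
  let bas := b.baseChange ℚ
  let d := L.formQ.dualBasis L.formQ_nondegenerate bas
  have hbas : ∀ i, bas i = 1 ⊗ₜ b i := fun i => by simp [bas]
  have hd : ∀ i, d i ∈ L.dual := by
    intro i
    rw [L.mem_dual_iff_basis b]
    intro j
    refine ⟨if j = i then 1 else 0, ?_⟩
    rw [← hbas]
    simp [d, LinearMap.BilinForm.apply_dualBasis_left]
  let f : Finset (Fin (Module.finrank ℤ Λ)) → L.DiscGroup :=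
    fun s => ∑ i ∈ s, (QuotientAddGroup.mk ⟨d i, hd i⟩ : L.DiscGroup)
  have hf : Function.Surjective f := by
    intro γ
    induction γ using QuotientAddGroup.induction_on with | _ x
    choose m hm using fun i => x.2 (1 ⊗ₜ b i) ⟨b i, rfl⟩
    have hx : x = ∑ i, m i • (⟨d i, hd i⟩ : L.dual) := by
      refine Subtype.ext ?_
      have h0 : L.formQ ((x : ℚ ⊗[ℤ] Λ) - ∑ i, (m i : ℚ) • d i) = 0 := by
        refine bas.ext fun j => ?_
        rw [map_sub, LinearMap.sub_apply, hbas, hm, ← hbas, map_sum, LinearMap.sum_apply]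
        simp [d, LinearMap.BilinForm.apply_dualBasis_left]
      have h1 := sub_eq_zero.mp (L.formQ_nondegenerate.1 _ fun y => by rw [h0]; rfl)
      rw [h1]
      push_cast
      simp [Int.cast_smul_eq_zsmul]
    refine ⟨Finset.univ.filter fun i => Odd (m i), ?_⟩
    have hodd : ∀ (k : ℤ) (γ : L.DiscGroup), k • γ = if Odd k then γ else 0 := by
      intro k γ
      split_ifs with h
      · obtain ⟨r, rfl⟩ := h
        rw [add_zsmul, one_zsmul, mul_comm, mul_zsmul, two_zsmul, hL.add_self, zsmul_zero, zero_add]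
      · obtain ⟨r, rfl⟩ := Int.not_odd_iff_even.mp h
        rw [add_zsmul, hL.add_self]
    have hmk : (QuotientAddGroup.mk x : L.DiscGroup)
        = ∑ i, m i • (QuotientAddGroup.mk ⟨d i, hd i⟩ : L.DiscGroup) := by
      conv_lhs => rw [hx]
      exact map_sum (QuotientAddGroup.mk' _) _ _
    rw [hmk]
    simp only [f, Finset.sum_filter, hodd]
  have hc := Nat.card_le_card_of_surjective f hf
  rw [hL.card_eq, Nat.card_eq_fintype_card, Fintype.card_finset, Fintype.card_fin] at hc
  exact (Nat.pow_le_pow_iff_right (by norm_num)).mp hc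

end Values

end EvenLattice

/-! ### The Jacobi triple product -/

section TripleProduct

open Filter Topology

/-- The finite product `(x; x)_m = ∏_{j=1}^m (1 - x^j)`. -/
def qPoch (x : ℂ) (m : ℕ) : ℂ := ∏ j ∈ Finset.range m, (1 - x ^ (j + 1))

/-- Euler's product `∏_{j≥1} (1 - x^j)`. -/
def eulerProd (x : ℂ) : ℂ := ∏' j : ℕ, (1 - x ^ (j + 1))

theorem qPoch_succ (x : ℂ) (m : ℕ) : qPoch x (m + 1) = qPoch x m * (1 - x ^ (m + 1)) :=
  Finset.prod_range_succ _ _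

theorem one_sub_pow_ne_zero {x : ℂ} (hx : ‖x‖ < 1) (m : ℕ) : 1 - x ^ (m + 1) ≠ 0 := by
  intro h
  have h1 : ‖x ^ (m + 1)‖ < 1 := by
    rw [norm_pow]; exact pow_lt_one₀ (norm_nonneg _) hx (by omega)
  rw [← sub_eq_zero.mp h] at h1
  simp at h1

theorem qPoch_ne_zero {x : ℂ} (hx : ‖x‖ < 1) (m : ℕ) : qPoch x m ≠ 0 :=
  Finset.prod_ne_zero_iff.mpr fun j _ => one_sub_pow_ne_zero hx j

theorem tendsto_qPoch {x : ℂ} (hx : ‖x‖ < 1) : Tendsto (qPoch x) atTop (𝓝 (eulerProd x)) :=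
  (ModularForm.multipliable_one_sub_pow hx).hasProd.tendsto_prod_nat

theorem eulerProd_ne_zero {x : ℂ} (hx : ‖x‖ < 1) : eulerProd x ≠ 0 := by
  have h := tprod_one_add_ne_zero_of_summable (f := fun n : ℕ => -x ^ (n + 1))
    (fun i => by simpa [← sub_eq_add_neg] using one_sub_pow_ne_zero hx i)
    (by simpa using (summable_nat_add_iff 1).mpr (summable_geometric_of_lt_one (norm_nonneg _) hx))
  simpa [eulerProd, ← sub_eq_add_neg] using h

/-- The coefficient of `Q^{n²} zⁿ` in `∏_{j=1}^N (1 + z Q^{2j-1}) (1 + z⁻¹ Q^{2j-1})`, defined by the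
recursion in `N` and with `x = Q²`; it is a Gaussian binomial coefficient, see
`tripleCoeff_mul`. -/
def tripleCoeff (x : ℂ) : ℕ → ℤ → ℂ
  | 0, n => if n = 0 then 1 else 0
  | N + 1, n => (1 + x ^ (2 * N + 1)) * tripleCoeff x N n
      + x ^ (N + 1 - n).toNat * tripleCoeff x N (n - 1)
      + x ^ (N + 1 + n).toNat * tripleCoeff x N (n + 1)

theorem tripleCoeff_eq_zero (x : ℂ) {N : ℕ} {n : ℤ} (h : (N : ℤ) < |n|) : tripleCoeff x N n = 0 := by
  induction N generalizing n with
  | zero =>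
    have : n ≠ 0 := by rintro rfl; simp at h
    simp [tripleCoeff, this]
  | succ N ih =>
    push_cast at h
    rw [tripleCoeff, ih (by grind), ih (by grind), ih (by grind)]
    ring

/-- `tripleCoeff x N n` is the Gaussian binomial coefficient `[2N, N + n]_x`. -/
theorem tripleCoeff_mul (x : ℂ) (N a c : ℕ) (h : a + c = 2 * N) :
    tripleCoeff x N ((a : ℤ) - N) * (qPoch x a * qPoch x c) = qPoch x (2 * N) := by
  induction N generalizing a c with
  | zero =>
    obtain ⟨rfl, rfl⟩ : a = 0 ∧ c = 0 := by omega
    simp [tripleCoeff, qPoch]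
  | succ N ih =>
    -- the three terms of the recursion; `a - 1` truncates at `a = 0`, where the other factor vanishes
    have key : ∀ a c : ℕ, a + c = 2 * N + 2 →
        tripleCoeff x N ((a : ℤ) - N - 2) * (qPoch x a * qPoch x c)
          = (1 - x ^ a) * (1 - x ^ (a - 1)) * qPoch x (2 * N) := by
      intro a c hac
      match a, hac with
      | 0, _ => rw [tripleCoeff_eq_zero x (by grind)]; simp
      | 1, _ => rw [tripleCoeff_eq_zero x (by grind)]; simp
      | a + 2, hac =>
        rw [← ih a c (by omega), qPoch_succ, qPoch_succ]
        have : ((a + 2 : ℕ) : ℤ) - N - 2 = a - N := by push_cast; ring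
        rw [this, show a + 2 - 1 = a + 1 by omega]
        ring
    have key' : tripleCoeff x N ((a : ℤ) - N) * (qPoch x a * qPoch x c)
          = (1 - x ^ c) * (1 - x ^ (c - 1)) * qPoch x (2 * N) := by
      match c, h with
      | 0, _ => rw [tripleCoeff_eq_zero x (by grind)]; simp
      | 1, _ => rw [tripleCoeff_eq_zero x (by grind)]; simp
      | c + 2, hac =>
        rw [← ih a c (by omega), qPoch_succ, qPoch_succ, show c + 2 - 1 = c + 1 by omega]
        ring
    have key'' : tripleCoeff x N ((a : ℤ) - N - 1) * (qPoch x a * qPoch x c)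
          = (1 - x ^ a) * (1 - x ^ c) * qPoch x (2 * N) := by
      match a, c, h with
      | 0, _, _ => rw [tripleCoeff_eq_zero x (by grind)]; simp
      | _, 0, _ => rw [tripleCoeff_eq_zero x (by grind)]; simp
      | a + 1, c + 1, hac =>
        rw [← ih a c (by omega), qPoch_succ, qPoch_succ]
        have : ((a + 1 : ℕ) : ℤ) - N - 1 = a - N := by push_cast; ring
        rw [this]
        ring
    have e1 : ((a : ℤ) - (N + 1 : ℕ)) = a - N - 1 := by push_cast; ring
    have e2 : ((N : ℤ) + 1 - (a - N - 1)).toNat = c := by omega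
    have e3 : ((N : ℤ) + 1 + (a - N - 1)).toNat = a := by omega
    rw [e1, tripleCoeff, e2, e3, show ((a : ℤ) - N - 1 - 1) = a - N - 2 by ring,
      show ((a : ℤ) - N - 1 + 1) = a - N by ring, show 2 * (N + 1) = 2 * N + 1 + 1 by ring,
      qPoch_succ, qPoch_succ]
    have hk := key a c h
    have e4 : x ^ c * x ^ a = x ^ (2 * N + 2) := by rw [← pow_add]; congr 1; omega
    have e5 : x * x ^ (2 * N + 1) = x ^ (2 * N + 2) := by rw [← pow_succ']
    have e6 : x ^ c * ((1 - x ^ a) * (1 - x ^ (a - 1)))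
        = (1 - x ^ a) * (x ^ c - x ^ (2 * N + 1)) := by
      rcases Nat.eq_zero_or_pos a with rfl | ha
      · simp
      · have : x ^ c * x ^ (a - 1) = x ^ (2 * N + 1) := by rw [← pow_add]; congr 1; omega
        linear_combination -(1 - x ^ a) * this
    have e7 : x ^ a * ((1 - x ^ c) * (1 - x ^ (c - 1)))
        = (1 - x ^ c) * (x ^ a - x ^ (2 * N + 1)) := by
      rcases Nat.eq_zero_or_pos c with rfl | ha
      · simp
      · have : x ^ a * x ^ (c - 1) = x ^ (2 * N + 1) := by rw [← pow_add]; congr 1; omega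
        linear_combination -(1 - x ^ c) * this
    linear_combination (1 + x ^ (2 * N + 1)) * key'' + x ^ c * hk + x ^ a * key'
      + qPoch x (2 * N) * (e6 + e7) + qPoch x (2 * N) * (x ^ (2 * N + 1) - 1) * e4

/-- The finite form of the triple product; the sum has only finitely many non-zero terms. -/
theorem hasSum_tripleCoeff {Q z : ℂ} (hQ : Q ≠ 0) (hz : z ≠ 0) (N : ℕ) :
    HasSum (fun n : ℤ => Q ^ (n ^ 2) * z ^ n * tripleCoeff (Q ^ 2) N n)
      (∏ j ∈ Finset.range N, ((1 + z * Q ^ (2 * j + 1)) * (1 + z⁻¹ * Q ^ (2 * j + 1)))) := by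
  induction N with
  | zero =>
    have := hasSum_ite_eq (0 : ℤ) (1 : ℂ)
    simp only [Finset.range_zero, Finset.prod_empty]
    refine this.congr_fun ?_
    intro n
    by_cases h : n = 0 <;> simp [tripleCoeff, h]
  | succ N ih =>
    rw [Finset.prod_range_succ]
    have h1 := ih.mul_right (1 + Q ^ (4 * N + 2))
    have h2 := ((Equiv.addRight (-1 : ℤ)).hasSum_iff.mpr ih).mul_right (z * Q ^ (2 * N + 1))
    have h3 := ((Equiv.addRight (1 : ℤ)).hasSum_iff.mpr ih).mul_right (z⁻¹ * Q ^ (2 * N + 1))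
    have h4 := (h1.add h2).add h3
    convert! h4 using 1
    · funext n
      simp only [Function.comp_apply, Equiv.coe_addRight, tripleCoeff]
      have t2 : Q ^ (n ^ 2) * z ^ n * ((Q ^ 2) ^ (N + 1 - n).toNat * tripleCoeff (Q ^ 2) N (n - 1))
          = Q ^ ((n + -1) ^ 2) * z ^ (n + -1) * tripleCoeff (Q ^ 2) N (n + -1)
            * (z * Q ^ (2 * N + 1)) := by
        by_cases hn : n ≤ N + 1
        · have hm : ((N + 1 - n).toNat : ℤ) = N + 1 - n := by omega
          rw [zpow_add₀ hz, zpow_neg_one, ← pow_mul, ← sub_eq_add_neg]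
          have : Q ^ (n ^ 2) * Q ^ (2 * (N + 1 - n).toNat) = Q ^ ((n - 1) ^ 2) * Q ^ (2 * N + 1) := by
            rw [← zpow_natCast, ← zpow_natCast, ← zpow_add₀ hQ, ← zpow_add₀ hQ]
            congr 1
            push_cast
            rw [hm]
            ring
          have hzz : z⁻¹ * z = 1 := inv_mul_cancel₀ hz
          linear_combination (z ^ n * tripleCoeff (Q ^ 2) N (n - 1)) * this
            - (Q ^ ((n - 1) ^ 2) * Q ^ (2 * N + 1) * z ^ n * tripleCoeff (Q ^ 2) N (n - 1)) * hzz
        · rw [← sub_eq_add_neg, tripleCoeff_eq_zero _ (by grind)]; ring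
      have t3 : Q ^ (n ^ 2) * z ^ n * ((Q ^ 2) ^ (N + 1 + n).toNat * tripleCoeff (Q ^ 2) N (n + 1))
          = Q ^ ((n + 1) ^ 2) * z ^ (n + 1) * tripleCoeff (Q ^ 2) N (n + 1)
            * (z⁻¹ * Q ^ (2 * N + 1)) := by
        by_cases hn : -(N + 1 : ℤ) ≤ n
        · have hm : ((N + 1 + n).toNat : ℤ) = N + 1 + n := by omega
          rw [zpow_add₀ hz, zpow_one, ← pow_mul]
          have : Q ^ (n ^ 2) * Q ^ (2 * (N + 1 + n).toNat) = Q ^ ((n + 1) ^ 2) * Q ^ (2 * N + 1) := by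
            rw [← zpow_natCast, ← zpow_natCast, ← zpow_add₀ hQ, ← zpow_add₀ hQ]
            congr 1
            push_cast
            rw [hm]
            ring
          have hzz : z * z⁻¹ = 1 := mul_inv_cancel₀ hz
          linear_combination (z ^ n * tripleCoeff (Q ^ 2) N (n + 1)) * this
            - (Q ^ ((n + 1) ^ 2) * Q ^ (2 * N + 1) * z ^ n * tripleCoeff (Q ^ 2) N (n + 1)) * hzz
        · rw [tripleCoeff_eq_zero _ (by grind)]; ring
      rw [← t2, ← t3]
      ring
    · have hzz : z * z⁻¹ = 1 := mul_inv_cancel₀ hz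
      rw [← mul_add, ← mul_add]
      congr 1
      linear_combination (Q ^ (2 * N + 1)) ^ 2 * hzz

theorem norm_qPoch_le {x : ℂ} (hx : ‖x‖ < 1) :
    ∃ C : ℝ, ∀ a b c : ℕ, ‖qPoch x a / (qPoch x b * qPoch x c)‖ ≤ C := by
  obtain ⟨C₁, h1⟩ := (tendsto_qPoch hx).norm.bddAbove_range
  obtain ⟨C₂, h2⟩ := ((tendsto_qPoch hx).inv₀ (eulerProd_ne_zero hx)).norm.bddAbove_range
  have h1' : ∀ a, ‖qPoch x a‖ ≤ C₁ := fun a => h1 ⟨a, rfl⟩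
  have h2' : ∀ a, ‖(qPoch x a)⁻¹‖ ≤ C₂ := fun a => h2 ⟨a, rfl⟩
  refine ⟨C₁ * (C₂ * C₂), fun a b c => ?_⟩
  have hC2 : 0 ≤ C₂ := (norm_nonneg _).trans (h2' 0)
  rw [div_eq_mul_inv, mul_inv, norm_mul, norm_mul]
  gcongr
  · exact (norm_nonneg _).trans (h1' 0)
  all_goals first | exact h1' _ | exact h2' _

theorem summable_pow_sq_mul_zpow {Q z : ℂ} (hQ : Q ≠ 0) (hQ1 : ‖Q‖ < 1) (hz : z ≠ 0) :
    Summable fun n : ℤ => Q ^ (n ^ 2) * z ^ n := by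
  have hpi : (π * I : ℂ) ≠ 0 := mul_ne_zero (by exact_mod_cast Real.pi_ne_zero) I_ne_zero
  obtain ⟨u, hu⟩ : ∃ u : ℂ, cexp (π * I * u) = Q :=
    ⟨Complex.log Q / (π * I), by rw [mul_div_cancel₀ _ hpi, Complex.exp_log hQ]⟩
  obtain ⟨w, hw⟩ : ∃ w : ℂ, cexp (2 * π * I * w) = z :=
    ⟨Complex.log z / (2 * π * I), by rw [mul_div_cancel₀ _ two_pi_I_ne_zero, Complex.exp_log hz]⟩
  have hu0 : 0 < u.im := by
    rw [← hu, Complex.norm_exp, Real.exp_lt_one_iff] at hQ1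
    have : (π * I * u : ℂ).re = -(π * u.im) := by simp
    rw [this] at hQ1
    have hp := Real.pi_pos
    by_contra! h
    nlinarith
  refine ((summable_jacobiTheta₂_term_iff w u).mpr hu0).congr fun n => ?_
  rw [jacobiTheta₂_term, ← hu, ← hw, ← Complex.exp_int_mul, ← Complex.exp_int_mul, ← Complex.exp_add]
  congr 1
  push_cast
  ring

/-- The **Jacobi triple product** identity, as the limit of its finite form by dominated
convergence. -/
theorem hasSum_jacobi_triple_product {Q z P : ℂ} (hQ : Q ≠ 0) (hQ1 : ‖Q‖ < 1) (hz : z ≠ 0)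
    (hP : Tendsto (fun N => ∏ j ∈ Finset.range N,
      ((1 + z * Q ^ (2 * j + 1)) * (1 + z⁻¹ * Q ^ (2 * j + 1)))) atTop (𝓝 P)) :
    HasSum (fun n : ℤ => Q ^ (n ^ 2) * z ^ n) (eulerProd (Q ^ 2) * P) := by
  have hx : ‖Q ^ 2‖ < 1 := by rw [norm_pow]; exact pow_lt_one₀ (norm_nonneg _) hQ1 two_ne_zero
  have hsum := summable_pow_sq_mul_zpow hQ hQ1 hz
  obtain ⟨C, hC⟩ := norm_qPoch_le hx
  have hcoeff : ∀ (N : ℕ) (n : ℤ), |n| ≤ N → tripleCoeff (Q ^ 2) N n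
      = qPoch (Q ^ 2) (2 * N) / (qPoch (Q ^ 2) (N + n).toNat * qPoch (Q ^ 2) (N - n).toNat) := by
    intro N n hn
    rw [eq_div_iff (mul_ne_zero (qPoch_ne_zero hx _) (qPoch_ne_zero hx _)),
      ← tripleCoeff_mul (Q ^ 2) N (N + n).toNat (N - n).toNat (by grind)]
    congr 2
    grind
  have hC0 : 0 ≤ C := (norm_nonneg _).trans (hC 0 0 0)
  have hlim := tendsto_tsum_of_dominated_convergence (𝓕 := atTop)
    (f := fun (N : ℕ) (n : ℤ) => Q ^ (n ^ 2) * z ^ n * tripleCoeff (Q ^ 2) N n)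
    (g := fun n : ℤ => Q ^ (n ^ 2) * z ^ n * (eulerProd (Q ^ 2))⁻¹)
    (bound := fun n : ℤ => ‖Q ^ (n ^ 2) * z ^ n‖ * C) (hsum.norm.mul_right C) (fun n => by
      refine Tendsto.const_mul _ ?_
      have ht : Tendsto (fun N : ℕ => qPoch (Q ^ 2) (2 * N) /
          (qPoch (Q ^ 2) (N + n).toNat * qPoch (Q ^ 2) (N - n).toNat)) atTop
          (𝓝 (eulerProd (Q ^ 2) / (eulerProd (Q ^ 2) * eulerProd (Q ^ 2)))) := by
        have h1 := tendsto_qPoch hx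
        refine Tendsto.div (h1.comp ?_) ((h1.comp ?_).mul (h1.comp ?_)) ?_
        · exact tendsto_id.const_mul_atTop' two_pos
        · exact tendsto_atTop.mpr fun b => by
            filter_upwards [eventually_ge_atTop (b + n.natAbs)] with N hN; omega
        · exact tendsto_atTop.mpr fun b => by
            filter_upwards [eventually_ge_atTop (b + n.natAbs)] with N hN; omega
        · exact mul_ne_zero (eulerProd_ne_zero hx) (eulerProd_ne_zero hx)
      rw [div_mul_cancel_left₀ (eulerProd_ne_zero hx)] at ht
      refine ht.congr' ?_
      filter_upwards [eventually_ge_atTop n.natAbs] with N hN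
      rw [hcoeff N n (by grind)])
    (Eventually.of_forall fun N n => by
      rw [norm_mul]
      gcongr
      by_cases hn : |n| ≤ N
      · rw [hcoeff N n hn]; exact hC _ _ _
      · rw [tripleCoeff_eq_zero _ (not_le.mp hn), norm_zero]; exact hC0)
  have hlim' := hlim.congr fun N => (hasSum_tripleCoeff hQ hz N).tsum_eq
  have := tendsto_nhds_unique hP hlim'
  rw [this, tsum_mul_right, mul_left_comm, mul_inv_cancel₀ (eulerProd_ne_zero hx), mul_one]
  exact hsum.hasSum

end TripleProduct

/-! ### Theta constants and their transformation formulas -/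

/-- `ϑ₄(τ) = ∑_{n ∈ ℤ} (-1)ⁿ q^{n²/2}` with `q = e^{2πiτ}`. -/
def jacobiTheta4 (τ : ℂ) : ℂ := ∑' n : ℤ, (-1) ^ n * cexp (π * I * (n : ℂ) ^ 2 * τ)

theorem jacobiTheta3_eq (τ : ℂ) : jacobiTheta3 τ = jacobiTheta₂ 0 τ :=
  tsum_congr fun n => by simp [jacobiTheta₂_term]

theorem jacobiTheta4_eq (τ : ℂ) : jacobiTheta4 τ = jacobiTheta₂ (1 / 2) τ :=
  tsum_congr fun n => by
    rw [jacobiTheta₂_term, Complex.exp_add, ← Complex.exp_pi_mul_I, ← Complex.exp_int_mul]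
    congr 2
    ring

theorem jacobiTheta2_eq (τ : ℂ) : jacobiTheta2 τ = cexp (π * I * τ / 4) * jacobiTheta₂ (τ / 2) τ := by
  rw [jacobiTheta2, jacobiTheta₂, ← tsum_mul_left]
  refine tsum_congr fun n => ?_
  rw [jacobiTheta₂_term, ← Complex.exp_add]
  congr 1
  ring

theorem neg_one_zpow_sq (n : ℤ) : cexp (π * I * (n : ℂ) ^ 2) = (-1) ^ n := by
  have h : (π * I * (n : ℂ) ^ 2 : ℂ) = (n ^ 2 : ℤ) * (π * I) := by push_cast; ring
  rw [h, Complex.exp_int_mul, Complex.exp_pi_mul_I]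
  rcases Int.even_or_odd n with hn | hn
  · rw [hn.neg_one_zpow, (hn.pow_of_ne_zero two_ne_zero).neg_one_zpow]
  · rw [hn.neg_one_zpow, hn.pow.neg_one_zpow]

theorem jacobiTheta3_add_one (τ : ℂ) : jacobiTheta3 (τ + 1) = jacobiTheta4 τ :=
  tsum_congr fun n => by
    rw [mul_add, Complex.exp_add, mul_one, neg_one_zpow_sq, mul_comm]

theorem jacobiTheta4_add_one (τ : ℂ) : jacobiTheta4 (τ + 1) = jacobiTheta3 τ :=
  tsum_congr fun n => by
    rw [mul_add, Complex.exp_add, mul_one, neg_one_zpow_sq, mul_left_comm, ← mul_zpow]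
    simp

theorem jacobiTheta2_add_one (τ : ℂ) :
    jacobiTheta2 (τ + 1) = cexp (π * I / 4) * jacobiTheta2 τ := by
  rw [jacobiTheta2, jacobiTheta2, ← tsum_mul_left]
  refine tsum_congr fun n => ?_
  obtain ⟨r, hr⟩ := Int.even_mul_succ_self n
  have hr' : ((n : ℂ) * (n + 1)) = r + r := by exact_mod_cast hr
  rw [← Complex.exp_add, Complex.exp_eq_exp_iff_exists_int]
  exact ⟨r, by linear_combination π * I * hr'⟩

theorem jacobiTheta3_S (τ : ℂ) :
    jacobiTheta3 τ = 1 / (-I * τ) ^ (1 / 2 : ℂ) * jacobiTheta3 (-1 / τ) := by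
  rw [jacobiTheta3_eq, jacobiTheta3_eq, jacobiTheta₂_functional_equation]
  simp

theorem jacobiTheta4_S (τ : ℂ) :
    jacobiTheta4 τ = 1 / (-I * τ) ^ (1 / 2 : ℂ) * jacobiTheta2 (-1 / τ) := by
  rw [jacobiTheta4_eq, jacobiTheta2_eq, jacobiTheta₂_functional_equation, mul_assoc,
    ← jacobiTheta₂_neg_left (1 / 2 / τ), show -(1 / 2 / τ) = -1 / τ / 2 by ring,
    show -π * I * (1 / 2) ^ 2 / τ = π * I * (-1 / τ) / 4 by ring]

theorem jacobiTheta2_S {τ : ℂ} (hτ : τ ≠ 0) :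
    jacobiTheta2 τ = 1 / (-I * τ) ^ (1 / 2 : ℂ) * jacobiTheta4 (-1 / τ) := by
  rw [jacobiTheta4_eq, jacobiTheta2_eq, jacobiTheta₂_functional_equation,
    show τ / 2 / τ = 1 / 2 by field_simp]
  have : cexp (π * I * τ / 4) * cexp (-π * I * (τ / 2) ^ 2 / τ) = 1 := by
    rw [← Complex.exp_add, Complex.exp_eq_one_iff]
    exact ⟨0, by field_simp; push_cast; ring⟩
  linear_combination (1 / (-I * τ) ^ (1 / 2 : ℂ) * jacobiTheta₂ (1 / 2) (-1 / τ)) * this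

/-! ### Gauss' identities and eta products -/

section EtaProducts

open Filter Topology

/-- `∏_{j≥0} (1 - x^{2j+1})`, as a quotient of Euler products. -/
def oddProd (x : ℂ) : ℂ := eulerProd x / eulerProd (x ^ 2)

theorem norm_sq_lt_one {x : ℂ} (hx : ‖x‖ < 1) : ‖x ^ 2‖ < 1 := by
  rw [norm_pow]; exact pow_lt_one₀ (norm_nonneg _) hx two_ne_zero

theorem tendsto_oddProd {x : ℂ} (hx : ‖x‖ < 1) :
    Tendsto (fun N => ∏ j ∈ Finset.range N, (1 - x ^ (2 * j + 1))) atTop (𝓝 (oddProd x)) := by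
  have hx2 := norm_sq_lt_one hx
  have h := ((tendsto_qPoch hx).comp (tendsto_id.const_mul_atTop' two_pos)).div (tendsto_qPoch hx2)
    (eulerProd_ne_zero hx2)
  refine h.congr fun N => ?_
  simp only [Function.comp_apply, id, Pi.div_apply]
  rw [div_eq_iff (qPoch_ne_zero hx2 N)]
  induction N with
  | zero => simp [qPoch]
  | succ N ih =>
    rw [show 2 * (N + 1) = 2 * N + 1 + 1 by ring, qPoch_succ, qPoch_succ, ih, Finset.prod_range_succ,
      qPoch_succ, ← pow_mul, show 2 * (N + 1) = 2 * N + 1 + 1 by ring]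
    ring

theorem oddProd_ne_zero {x : ℂ} (hx : ‖x‖ < 1) : oddProd x ≠ 0 :=
  div_ne_zero (eulerProd_ne_zero hx) (eulerProd_ne_zero (norm_sq_lt_one hx))

theorem oddProd_mul_neg {x : ℂ} (hx : ‖x‖ < 1) : oddProd x * oddProd (-x) = oddProd (x ^ 2) := by
  have h1 := (tendsto_oddProd hx).mul (tendsto_oddProd (x := -x) (by rwa [norm_neg]))
  refine tendsto_nhds_unique h1 ((tendsto_oddProd (norm_sq_lt_one hx)).congr fun N => ?_)
  rw [← Finset.prod_mul_distrib]
  refine Finset.prod_congr rfl fun j _ => ?_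
  rw [Odd.neg_pow ⟨j, rfl⟩, ← pow_mul, mul_comm 2, pow_mul]
  ring

theorem tendsto_prod_one_add_pow {x : ℂ} (hx : ‖x‖ < 1) :
    Tendsto (fun N => ∏ j ∈ Finset.range N, (1 + x ^ (j + 1))) atTop
      (𝓝 (eulerProd (x ^ 2) / eulerProd x)) := by
  have hx2 := norm_sq_lt_one hx
  refine ((tendsto_qPoch hx2).div (tendsto_qPoch hx) (eulerProd_ne_zero hx)).congr fun N => ?_
  rw [Pi.div_apply, div_eq_iff (qPoch_ne_zero hx N), qPoch, qPoch, ← Finset.prod_mul_distrib]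
  refine Finset.prod_congr rfl fun j _ => ?_
  rw [← pow_mul, mul_comm 2, pow_mul]
  ring

/-- Gauss' identity for `∑ (-1)ⁿ Q^{n²}`. -/
theorem hasSum_gauss_alternating {Q : ℂ} (hQ : Q ≠ 0) (hQ1 : ‖Q‖ < 1) :
    HasSum (fun n : ℤ => Q ^ (n ^ 2) * (-1) ^ n) (eulerProd (Q ^ 2) * oddProd Q ^ 2) := by
  refine hasSum_jacobi_triple_product hQ hQ1 (by norm_num) ?_
  refine ((tendsto_oddProd hQ1).pow 2).congr fun N => ?_
  rw [← Finset.prod_pow]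
  refine Finset.prod_congr rfl fun j _ => ?_
  norm_num
  ring

/-- Gauss' identity for `∑ Q^{n²}`. -/
theorem hasSum_gauss {Q : ℂ} (hQ : Q ≠ 0) (hQ1 : ‖Q‖ < 1) :
    HasSum (fun n : ℤ => Q ^ (n ^ 2)) (eulerProd (Q ^ 2) * oddProd (-Q) ^ 2) := by
  have h := hasSum_jacobi_triple_product (z := 1) (P := oddProd (-Q) ^ 2) hQ hQ1 one_ne_zero ?_
  · simpa using h
  refine ((tendsto_oddProd (x := -Q) (by rwa [norm_neg])).pow 2).congr fun N => ?_
  rw [← Finset.prod_pow]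
  refine Finset.prod_congr rfl fun j _ => ?_
  rw [Odd.neg_pow ⟨j, rfl⟩]
  norm_num
  ring

/-- Gauss' identity for `∑ Q^{n² + n}`. -/
theorem hasSum_gauss_triangular {Q : ℂ} (hQ : Q ≠ 0) (hQ1 : ‖Q‖ < 1) :
    HasSum (fun n : ℤ => Q ^ (n ^ 2) * Q ^ n) (2 * (eulerProd (Q ^ 4) ^ 2 / eulerProd (Q ^ 2))) := by
  have hx := norm_sq_lt_one hQ1
  have h4 : Q ^ 4 = (Q ^ 2) ^ 2 := by ring
  have h := hasSum_jacobi_triple_product (z := Q)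
    (P := (eulerProd (Q ^ 4) / eulerProd (Q ^ 2)) * (2 * (eulerProd (Q ^ 4) / eulerProd (Q ^ 2))))
    hQ hQ1 hQ ?_
  · convert h using 1
    have := eulerProd_ne_zero hx
    field_simp
  -- the factor `1 + z⁻¹Q = 2` is split off, and the others are shifted by one
  rw [← tendsto_add_atTop_iff_nat 1]
  have t := tendsto_prod_one_add_pow hx
  rw [← h4] at t
  refine (((tendsto_add_atTop_iff_nat 1).mpr t).mul (t.const_mul 2)).congr fun N => ?_
  rw [Finset.prod_mul_distrib]
  congr 1
  · refine Finset.prod_congr rfl fun j _ => ?_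
    rw [← pow_mul]; ring
  · rw [Finset.prod_range_succ']
    have : ∀ j ∈ Finset.range N, 1 + Q⁻¹ * Q ^ (2 * (j + 1) + 1) = 1 + (Q ^ 2) ^ (j + 1) := by
      intro j _
      rw [pow_succ' Q (2 * (j + 1)), inv_mul_cancel_left₀ hQ, pow_mul]
    rw [Finset.prod_congr rfl this, mul_zero, zero_add, pow_one, inv_mul_cancel₀ hQ, mul_comm]
    norm_num

theorem norm_exp_two_pi_lt_one {τ : ℂ} (hτ : 0 < τ.im) : ‖cexp (2 * π * I * τ)‖ < 1 :=
  UpperHalfPlane.norm_exp_two_pi_I_lt_one ⟨τ, hτ⟩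

theorem eta_eq (τ : ℂ) :
    ModularForm.eta τ = cexp (2 * π * I * τ / 24) * eulerProd (cexp (2 * π * I * τ)) := by
  simp [ModularForm.eta, ModularForm.eta_q_eq_pow, eulerProd, Function.Periodic.qParam]

theorem exp_pi_sq_two_mul (τ : ℂ) (n : ℤ) :
    cexp (π * I * (n : ℂ) ^ 2 * (2 * τ)) = cexp (2 * π * I * τ) ^ (n ^ 2) := by
  rw [← Complex.exp_int_mul]
  congr 1
  push_cast
  ring

theorem hasSum_jacobiTheta4 {τ : ℂ} (hτ : 0 < τ.im) :
    HasSum (fun n : ℤ => (-1 : ℂ) ^ n * cexp (2 * π * I * τ) ^ (n ^ 2)) (jacobiTheta4 (2 * τ)) := by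
  have h := hasSum_gauss_alternating (Complex.exp_ne_zero _) (norm_exp_two_pi_lt_one hτ)
  have h2 : jacobiTheta4 (2 * τ) = ∑' n : ℤ, (-1 : ℂ) ^ n * cexp (2 * π * I * τ) ^ (n ^ 2) :=
    tsum_congr fun n => by rw [exp_pi_sq_two_mul]
  rw [h2]
  exact (h.summable.congr fun n => mul_comm _ _).hasSum

theorem hasSum_jacobiTheta3 {τ : ℂ} (hτ : 0 < τ.im) :
    HasSum (fun n : ℤ => cexp (2 * π * I * τ) ^ (n ^ 2)) (jacobiTheta3 (2 * τ)) := by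
  have h := hasSum_gauss (Complex.exp_ne_zero _) (norm_exp_two_pi_lt_one hτ)
  have h2 := h.summable.hasSum
  simp_rw [jacobiTheta3, exp_pi_sq_two_mul]
  exact h2

theorem hasSum_jacobiTheta2 {τ : ℂ} (hτ : 0 < τ.im) :
    HasSum (fun n : ℤ => cexp (2 * π * I * τ) ^ (n ^ 2) * cexp (2 * π * I * τ) ^ n)
      (cexp (-(π * I * τ / 2)) * jacobiTheta2 (2 * τ)) := by
  have h := (hasSum_gauss_triangular (Complex.exp_ne_zero _) (norm_exp_two_pi_lt_one hτ)).summable.hasSum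
  convert h using 1
  rw [jacobiTheta2, ← tsum_mul_left]
  refine tsum_congr fun n => ?_
  rw [← Complex.exp_int_mul, ← Complex.exp_int_mul, ← Complex.exp_add, ← Complex.exp_add]
  congr 1
  push_cast
  ring

theorem jacobiTheta4_two_mul {τ : ℂ} (hτ : 0 < τ.im) :
    jacobiTheta4 (2 * τ) = eulerProd (cexp (2 * π * I * τ) ^ 2) * oddProd (cexp (2 * π * I * τ)) ^ 2 :=
  (hasSum_jacobiTheta4 hτ).unique (by
    simpa only [mul_comm] using
      hasSum_gauss_alternating (Complex.exp_ne_zero _) (norm_exp_two_pi_lt_one hτ))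

theorem jacobiTheta3_two_mul {τ : ℂ} (hτ : 0 < τ.im) :
    jacobiTheta3 (2 * τ) = eulerProd (cexp (2 * π * I * τ) ^ 2) * oddProd (-cexp (2 * π * I * τ)) ^ 2 :=
  (hasSum_jacobiTheta3 hτ).unique
    (hasSum_gauss (Complex.exp_ne_zero _) (norm_exp_two_pi_lt_one hτ))

theorem jacobiTheta2_two_mul {τ : ℂ} (hτ : 0 < τ.im) :
    jacobiTheta2 (2 * τ) = cexp (π * I * τ / 2) * (2 * (eulerProd (cexp (2 * π * I * τ) ^ 4) ^ 2
      / eulerProd (cexp (2 * π * I * τ) ^ 2))) := by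
  rw [← (hasSum_jacobiTheta2 hτ).unique
    (hasSum_gauss_triangular (Complex.exp_ne_zero _) (norm_exp_two_pi_lt_one hτ)), ← mul_assoc,
    ← Complex.exp_add]
  simp

theorem im_half_pos {τ : ℂ} (hτ : 0 < τ.im) : 0 < (τ / 2).im := by
  simpa using hτ

theorem jacobiTheta2_ne_zero {τ : ℂ} (hτ : 0 < τ.im) : jacobiTheta2 τ ≠ 0 := by
  have h := norm_exp_two_pi_lt_one (im_half_pos hτ)
  rw [show τ = 2 * (τ / 2) by ring, jacobiTheta2_two_mul (im_half_pos hτ),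
    show cexp (2 * π * I * (τ / 2)) ^ 4 = (cexp (2 * π * I * (τ / 2)) ^ 2) ^ 2 by ring]
  exact mul_ne_zero (Complex.exp_ne_zero _) (mul_ne_zero two_ne_zero (div_ne_zero
    (pow_ne_zero _ (eulerProd_ne_zero (norm_sq_lt_one (norm_sq_lt_one h))))
    (eulerProd_ne_zero (norm_sq_lt_one h))))

theorem jacobiTheta3_ne_zero {τ : ℂ} (hτ : 0 < τ.im) : jacobiTheta3 τ ≠ 0 := by
  have h := norm_exp_two_pi_lt_one (im_half_pos hτ)
  rw [show τ = 2 * (τ / 2) by ring, jacobiTheta3_two_mul (im_half_pos hτ)]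
  exact mul_ne_zero (eulerProd_ne_zero (norm_sq_lt_one h))
    (pow_ne_zero _ (oddProd_ne_zero (by rwa [norm_neg])))

theorem jacobiTheta4_ne_zero {τ : ℂ} (hτ : 0 < τ.im) : jacobiTheta4 τ ≠ 0 := by
  rw [← jacobiTheta3_add_one]
  exact jacobiTheta3_ne_zero (by simpa using hτ)

theorem jacobiTheta2_mul_jacobiTheta4 {τ : ℂ} (hτ : 0 < τ.im) :
    jacobiTheta2 (2 * τ) * jacobiTheta4 (2 * τ)
      = 2 * (ModularForm.eta τ ^ 2 * ModularForm.eta (4 * τ) ^ 2 / ModularForm.eta (2 * τ) ^ 2) := by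
  have h := norm_exp_two_pi_lt_one hτ
  set Q := cexp (2 * π * I * τ) with hQ
  have h2 : cexp (2 * π * I * (2 * τ)) = Q ^ 2 := by
    rw [hQ, ← Complex.exp_nat_mul]; congr 1; push_cast; ring
  have h4 : cexp (2 * π * I * (4 * τ)) = Q ^ 4 := by
    rw [hQ, ← Complex.exp_nat_mul]; congr 1; push_cast; ring
  have he : cexp (2 * π * I * τ / 24) ^ 2 * cexp (2 * π * I * (4 * τ) / 24) ^ 2
      = cexp (2 * π * I * (2 * τ) / 24) ^ 2 * cexp (π * I * τ / 2) := by
    simp only [← Complex.exp_nat_mul, ← Complex.exp_add]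
    congr 1; push_cast; ring
  rw [jacobiTheta2_two_mul hτ, jacobiTheta4_two_mul hτ, eta_eq, eta_eq, eta_eq, h2, h4, ← hQ, oddProd]
  have n2 := eulerProd_ne_zero (norm_sq_lt_one h)
  have n1 := eulerProd_ne_zero h
  have e2 := Complex.exp_ne_zero (2 * π * I * (2 * τ) / 24)
  generalize cexp (2 * π * I * (2 * τ) / 24) = c at *
  generalize cexp (2 * π * I * (4 * τ) / 24) = d at *
  generalize cexp (2 * π * I * τ / 24) = a at *
  generalize cexp (π * I * τ / 2) = b at *
  have e1 : b = a ^ 2 * d ^ 2 / c ^ 2 := by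
    rw [eq_div_iff (pow_ne_zero 2 e2), he, mul_comm]
  rw [e1]
  field_simp

theorem jacobiTheta3_mul_jacobiTheta4 {τ : ℂ} (hτ : 0 < τ.im) :
    jacobiTheta3 (2 * τ) * jacobiTheta4 (2 * τ)
      = ModularForm.eta (2 * τ) ^ 4 / ModularForm.eta (4 * τ) ^ 2 := by
  have h := norm_exp_two_pi_lt_one hτ
  set Q := cexp (2 * π * I * τ) with hQ
  have h2 : cexp (2 * π * I * (2 * τ)) = Q ^ 2 := by
    rw [hQ, ← Complex.exp_nat_mul]; congr 1; push_cast; ring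
  have h4 : cexp (2 * π * I * (4 * τ)) = Q ^ 4 := by
    rw [hQ, ← Complex.exp_nat_mul]; congr 1; push_cast; ring
  have he : cexp (2 * π * I * (2 * τ) / 24) ^ 4 = cexp (2 * π * I * (4 * τ) / 24) ^ 2 := by
    simp only [← Complex.exp_nat_mul]
    congr 1; push_cast; ring
  have ho := oddProd_mul_neg h
  have h24 : Q ^ 4 = (Q ^ 2) ^ 2 := by ring
  rw [jacobiTheta3_two_mul hτ, jacobiTheta4_two_mul hτ, eta_eq, eta_eq, h2, h4, ← hQ, mul_pow,
    mul_pow, he, mul_div_mul_left _ _ (pow_ne_zero 2 (Complex.exp_ne_zero _))]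
  have n2 := eulerProd_ne_zero (norm_sq_lt_one h)
  have n4 : eulerProd (Q ^ 4) ≠ 0 := by
    rw [h24]; exact eulerProd_ne_zero (norm_sq_lt_one (norm_sq_lt_one h))
  have : eulerProd (Q ^ 2) ^ 4 / eulerProd (Q ^ 4) ^ 2
      = (eulerProd (Q ^ 2) * (oddProd Q * oddProd (-Q))) ^ 2 := by
    rw [ho, oddProd, ← h24]
    field_simp
  rw [this]
  ring

theorem eta_ne_zero' {τ : ℂ} (hτ : 0 < τ.im) : ModularForm.eta τ ≠ 0 := ModularForm.eta_ne_zero hτ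

/-- `f_k^{(0)}` in terms of theta constants, whose behaviour under `S` and `T` is known. -/
theorem f0_eq (k : ℤ) {τ : ℂ} (hτ : 0 < τ.im) :
    f0 k τ = 16 * jacobiTheta3 (2 * τ) ^ k / (jacobiTheta2 (2 * τ) * jacobiTheta4 (2 * τ)) ^ 4 := by
  have n1 := eta_ne_zero' hτ
  have n2 := eta_ne_zero' (τ := 2 * τ) (by simpa using hτ)
  have n4 := eta_ne_zero' (τ := 4 * τ) (by simpa using hτ)
  rw [f0, thetaA1, jacobiTheta2_mul_jacobiTheta4 hτ]
  generalize ModularForm.eta (4 * τ) = y at *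
  field_simp
  norm_num [mul_comm]

theorem f1_eq (k : ℤ) {τ : ℂ} (hτ : 0 < τ.im) :
    f1 k τ = -16 * jacobiTheta2 (2 * τ) ^ k / (jacobiTheta3 (2 * τ) * jacobiTheta4 (2 * τ)) ^ 4 := by
  have n2 := eta_ne_zero' (τ := 2 * τ) (by simpa using hτ)
  have n4 := eta_ne_zero' (τ := 4 * τ) (by simpa using hτ)
  rw [f1, thetaA1Half, jacobiTheta3_mul_jacobiTheta4 hτ]
  field_simp

theorem etaQuot_mul_thetaA1 (k : ℤ) (τ : ℂ) : etaQuot τ * thetaA1 τ ^ k = f0 k τ := by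
  rw [etaQuot, f0, zpow_neg, zpow_neg, div_eq_mul_inv, mul_inv]
  norm_cast
  ring

end EtaProducts

/-! ### Slash action on the scalar-valued functions -/

theorem f0_add_one (k : ℤ) {τ : ℂ} (hτ : 0 < τ.im) : f0 k (τ + 1) = f0 k τ := by
  rw [f0_eq k hτ, f0_eq k (by simpa using hτ), show 2 * (τ + 1) = 2 * τ + 1 + 1 by ring,
    jacobiTheta3_add_one, jacobiTheta4_add_one, jacobiTheta4_add_one, jacobiTheta3_add_one,
    jacobiTheta2_add_one, jacobiTheta2_add_one]
  have h : cexp (π * I / 4) ^ 8 = 1 := by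
    rw [← Complex.exp_nat_mul, Complex.exp_eq_one_iff]
    exact ⟨1, by push_cast; ring⟩
  congr 1
  linear_combination (jacobiTheta2 (2 * τ) * jacobiTheta4 (2 * τ)) ^ 4 * h

theorem neg_I_mul_cpow_half_ne_zero {w : ℂ} (hw : 0 < w.im) : (-I * w) ^ (1 / 2 : ℂ) ≠ 0 := by
  have hw0 : w ≠ 0 := by rintro rfl; simp at hw
  intro h
  have := cpow_half_sq (-I * w)
  rw [h] at this
  simp [hw0] at this

theorem neg_one_div_im_pos {w : ℂ} (hw : 0 < w.im) : 0 < (-1 / w).im := by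
  have hw0 : w ≠ 0 := by rintro rfl; simp at hw
  rw [neg_div, one_div, Complex.neg_im, Complex.inv_im, neg_div, neg_neg]
  exact div_pos hw (Complex.normSq_pos.mpr hw0)

theorem jacobiTheta3_neg_one_div {w : ℂ} (hw : 0 < w.im) :
    jacobiTheta3 (-1 / w) = (-I * w) ^ (1 / 2 : ℂ) * jacobiTheta3 w := by
  have := neg_I_mul_cpow_half_ne_zero hw
  rw [jacobiTheta3_S w, ← mul_assoc, mul_one_div_cancel this, one_mul]

theorem jacobiTheta2_neg_one_div {w : ℂ} (hw : 0 < w.im) :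
    jacobiTheta2 (-1 / w) = (-I * w) ^ (1 / 2 : ℂ) * jacobiTheta4 w := by
  have := neg_I_mul_cpow_half_ne_zero hw
  rw [jacobiTheta4_S w, ← mul_assoc, mul_one_div_cancel this, one_mul]

theorem jacobiTheta4_neg_one_div {w : ℂ} (hw : 0 < w.im) :
    jacobiTheta4 (-1 / w) = (-I * w) ^ (1 / 2 : ℂ) * jacobiTheta2 w := by
  have := neg_I_mul_cpow_half_ne_zero hw
  rw [jacobiTheta2_S (by rintro rfl; simp at hw), ← mul_assoc, mul_one_div_cancel this, one_mul]

theorem zpow_eight_add_div {s : ℂ} (hs : s ≠ 0) (m : ℤ) : s ^ (8 + m) / s ^ 8 = s ^ m := by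
  rw [zpow_add₀ hs, mul_comm]
  norm_cast
  rw [mul_div_cancel_right₀ _ (pow_ne_zero 8 hs)]

/-- The effect of `S` on `f^{(0)}`. -/
theorem f0_neg_one_div (m : ℤ) {τ : ℂ} (hτ : 0 < τ.im) :
    f0 (8 + m) (-1 / τ) = ((-I * (τ / 2)) ^ (1 / 2 : ℂ)) ^ m * f0 (8 + m) (τ / 4) := by
  have h2 : 0 < (τ / 2).im := im_half_pos hτ
  have h4 : 0 < (τ / 4).im := by simpa using hτ
  have hs := neg_I_mul_cpow_half_ne_zero h2
  rw [f0_eq _ (neg_one_div_im_pos hτ), f0_eq _ h4, show 2 * (-1 / τ) = -1 / (τ / 2) by field_simp,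
    show 2 * (τ / 4) = τ / 2 by ring, jacobiTheta3_neg_one_div h2, jacobiTheta2_neg_one_div h2,
    jacobiTheta4_neg_one_div h2, mul_zpow, ← zpow_eight_add_div hs m]
  have n2 := jacobiTheta2_ne_zero h2
  have n4 := jacobiTheta4_ne_zero h2
  field_simp

/-- The effect of `ST²S` on `f^{(0)}`: the shift by `2` exchanges `ϑ₃` and `ϑ₄` after `S`, which turns
`f^{(0)}` into `f^{(1)}`. -/
theorem f0_half_sub (m : ℤ) {τ : ℂ} (hτ : 0 < τ.im) :
    f0 (8 + m) ((-1 / τ + 2) / 4) = ((-I * (2 * τ)) ^ (1 / 2 : ℂ)) ^ m * f1 (8 + m) τ := by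
  have h2 : 0 < (2 * τ).im := by simpa using hτ
  have hs := neg_I_mul_cpow_half_ne_zero h2
  have hw := neg_one_div_im_pos h2
  have hτ0 : τ ≠ 0 := by rintro rfl; simp at hτ
  have hw' : 0 < ((-1 / τ + 2) / 4).im := by
    have : (-1 / τ + 2) / 4 = (-1 / (2 * τ) + 1) / 2 := by field_simp; ring
    rw [this]
    exact im_half_pos (by simpa using hw)
  rw [f0_eq _ hw', f1_eq _ hτ, show 2 * ((-1 / τ + 2) / 4) = -1 / (2 * τ) + 1 by field_simp; ring,
    jacobiTheta3_add_one, jacobiTheta4_add_one, jacobiTheta2_add_one,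
    jacobiTheta3_neg_one_div h2, jacobiTheta2_neg_one_div h2,
    jacobiTheta4_neg_one_div h2, mul_zpow, ← zpow_eight_add_div hs m]
  have n3 := jacobiTheta3_ne_zero h2
  have n4 := jacobiTheta4_ne_zero h2
  have h : cexp (π * I / 4) ^ 4 = -1 := by
    rw [← Complex.exp_nat_mul, ← Complex.exp_pi_mul_I]
    congr 1; push_cast; ring
  simp only [mul_pow, h]
  field_simp

/-- The constant `e^{-πi/4} / √2`, for which `√(-iτ/2) = slashConst · √τ`. -/
def slashConst : ℂ := cexp (-(π * I / 4)) / (Real.sqrt 2 : ℂ)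

theorem sqrt_two_sq : ((√2 : ℝ) : ℂ) ^ 2 = 2 := by
  rw [← Complex.ofReal_pow, Real.sq_sqrt (by norm_num)]; simp

theorem sqrt_two_ne_zero : ((√2 : ℝ) : ℂ) ≠ 0 := by
  intro h
  have := sqrt_two_sq
  rw [h] at this
  norm_num at this

theorem sqrt_two_mul_cpow_half {w : ℂ} (hw : 0 < w.im) :
    ((√2 : ℝ) : ℂ) * w ^ (1 / 2 : ℂ) = (2 * w) ^ (1 / 2 : ℂ) := by
  refine eq_of_sq_eq_of_im_pos ?_ ?_ (cpow_half_mem_quadrant (by simpa using hw)).2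
  · rw [mul_pow, cpow_half_sq, cpow_half_sq, sqrt_two_sq]
  · rw [Complex.im_ofReal_mul]
    exact mul_pos (Real.sqrt_pos.mpr two_pos) (cpow_half_mem_quadrant hw).2

theorem neg_I_mul_cpow_half' {w : ℂ} (hw : 0 < w.im) :
    (-I * w) ^ (1 / 2 : ℂ) = cexp (-(π * I / 4)) * w ^ (1 / 2 : ℂ) := by
  rw [neg_I_mul_cpow_half hw, ← mul_assoc, ← Complex.exp_add]
  simp

theorem neg_I_mul_half_cpow_half {τ : ℂ} (hτ : 0 < τ.im) :
    (-I * (τ / 2)) ^ (1 / 2 : ℂ) = slashConst * τ ^ (1 / 2 : ℂ) := by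
  have h := sqrt_two_mul_cpow_half (im_half_pos hτ)
  rw [mul_div_cancel₀ _ (two_ne_zero' ℂ)] at h
  rw [neg_I_mul_cpow_half' (im_half_pos hτ), slashConst, ← h]
  have := sqrt_two_ne_zero
  field_simp

theorem neg_I_mul_two_cpow_half {τ : ℂ} (hτ : 0 < τ.im) :
    slashConst * (-I * (2 * τ)) ^ (1 / 2 : ℂ) = -I * τ ^ (1 / 2 : ℂ) := by
  rw [neg_I_mul_cpow_half' (by simpa using hτ), slashConst, ← sqrt_two_mul_cpow_half hτ]
  have := sqrt_two_ne_zero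
  have he : cexp (-(π * I / 4)) ^ 2 = -I := by
    rw [← Complex.exp_nat_mul, show ((2 : ℕ) : ℂ) * -(π * I / 4) = -(π / 2 * I) by push_cast; ring,
      Complex.exp_neg, Complex.exp_pi_div_two_mul_I, Complex.inv_I]
  field_simp
  rw [he, neg_mul]

theorem slashMp_mul (m : ℤ) (φ : ℍ → ℂ) (g h : Mp2Z) :
    slashMp m φ (g * h) = slashMp m (slashMp m φ g) h := by
  funext τ
  simp only [slashMp, Mp2Z.mul_mat, Mp2Z.mul_j, mul_smul, mul_zpow]
  ring

theorem slashMp_one (m : ℤ) (φ : ℍ → ℂ) : slashMp m φ 1 = φ := by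
  funext τ; simp [slashMp]

theorem slashMp_const_mul (m : ℤ) (c : ℂ) (φ : ℍ → ℂ) (g : Mp2Z) :
    slashMp m (fun τ => c * φ τ) g = fun τ => c * slashMp m φ g τ := by
  funext τ; simp only [slashMp]; ring

theorem slashMp_T_pow (m : ℤ) (φ : ℍ → ℂ) (n : ℕ) (τ : ℍ) :
    slashMp m φ (Mp2Z.T ^ n) τ = φ ((n : ℝ) +ᵥ τ) := by
  induction n generalizing τ with
  | zero => rw [pow_zero, slashMp_one]; simp
  | succ n ih =>
    rw [pow_succ, slashMp_mul, slashMp, ih, Mp2Z.T_j, one_zpow, mul_one]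
    congr 1
    ext
    simp only [UpperHalfPlane.coe_vadd, Mp2Z.T_smul_coe]
    push_cast
    ring

section FZero

variable (m : ℤ)

/-- The function `f_{8+m}^{(0)}` on the upper half-plane, a form of weight `m / 2` for `MΓ₀(4)`
with a character. -/
def f0H (τ : ℍ) : ℂ := f0 (8 + m) τ

theorem f0H_slash_T : slashMp m (f0H m) Mp2Z.T = f0H m := by
  funext τ
  have := slashMp_T_pow m (f0H m) 1 τ
  rw [pow_one] at this
  rw [this, f0H, f0H, UpperHalfPlane.coe_vadd, Nat.cast_one, Complex.ofReal_one,
    add_comm (1 : ℂ), f0_add_one (8 + m) τ.2]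

theorem f0H_slash_S (τ : ℍ) :
    slashMp m (f0H m) Mp2Z.S τ = slashConst ^ m * f0 (8 + m) ((τ : ℂ) / 4) := by
  have hj := Mp2Z.S.j_ne_zero τ
  rw [Mp2Z.S_j] at hj
  rw [slashMp, f0H, Mp2Z.S_smul_coe, Mp2Z.S_j, ← one_div, ← neg_div, f0_neg_one_div m τ.2,
    neg_I_mul_half_cpow_half τ.2, mul_zpow, zpow_neg]
  have := zpow_ne_zero m hj
  field_simp

theorem f0H_slash_ST_pow (n : ℕ) (τ : ℍ) :
    slashMp m (f0H m) (Mp2Z.S * Mp2Z.T ^ n) τ = slashConst ^ m * f0 (8 + m) (((τ : ℂ) + n) / 4) := by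
  rw [slashMp_mul, slashMp_T_pow, f0H_slash_S, UpperHalfPlane.coe_vadd, Complex.ofReal_natCast,
    add_comm (n : ℂ)]

theorem f0H_slash_STTS (τ : ℍ) :
    slashMp m (f0H m) (Mp2Z.S * Mp2Z.T ^ 2 * Mp2Z.S) τ = (-I) ^ m * f1 (8 + m) τ := by
  have hj := Mp2Z.S.j_ne_zero τ
  rw [Mp2Z.S_j] at hj
  rw [slashMp_mul, slashMp, f0H_slash_ST_pow, Mp2Z.S_smul_coe, Mp2Z.S_j, ← one_div, ← neg_div]
  push_cast
  rw [f0_half_sub m τ.2, ← mul_assoc, ← mul_zpow, neg_I_mul_two_cpow_half τ.2, mul_zpow, zpow_neg]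
  have := zpow_ne_zero m hj
  field_simp

theorem f0H_slash_S_sq (τ : ℍ) : slashMp m (f0H m) (Mp2Z.S ^ 2) τ = I ^ (-m) * f0H m τ := by
  rw [slashMp, Mp2Z.S_sq_j, Mp2Z.S_sq_mat, Mp2Z.SL_neg_one_smul, mul_comm]

theorem f0H_slash_ST4S : slashMp m (f0H m) (Mp2Z.S * Mp2Z.T ^ 4 * Mp2Z.S⁻¹) = f0H m := by
  have h : slashMp m (f0H m) (Mp2Z.S * Mp2Z.T ^ 4) = slashMp m (f0H m) Mp2Z.S := by
    funext τ
    rw [f0H_slash_ST_pow, f0H_slash_S]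
    push_cast
    rw [add_div, div_self (by norm_num), f0_add_one _ (by simpa using τ.2)]
  rw [slashMp_mul, h, ← slashMp_mul, mul_inv_cancel, slashMp_one]

end FZero

/-! ### The induced function -/

namespace EvenLattice

variable {Λ : Type*} [AddCommGroup Λ] {L : EvenLattice Λ}

variable (L) in
/-- The summand of the induced function at a group element. -/
def indTerm (τ : ℍ) (g : Mp2Z) : L.DiscGroup → ℂ :=
  slashMp L.sigma (f0H L.sigma) g τ • L.weilRep g⁻¹ (L.e 0)

variable (L) in
/-- `h` acts on `e_0` through `ρ_Λ` and on `f^{(0)}` through the slash action by the same scalar, so the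
scalar cancels in `indTerm`, where `h⁻¹` acts on `e_0`. -/
def IsStab (h : Mp2Z) : Prop := ∃ χ : ℂ, χ ≠ 0 ∧ L.weilRep h (L.e 0) = χ • L.e 0 ∧
  slashMp L.sigma (f0H L.sigma) h = fun τ => χ * f0H L.sigma τ

theorem exp_pi_div_two_mul_int (m : ℤ) : cexp (π * I * m / 2) = I ^ m := by
  rw [show (π * I * m / 2 : ℂ) = m * (π / 2 * I) by ring, Complex.exp_int_mul,
    Complex.exp_pi_div_two_mul_I]

/-- It suffices to look at the generators `T`, `ST⁴S⁻¹` and `S²` of `MΓ₀(4)`. -/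
theorem isStab_of_mem [Module.Free ℤ Λ] [Module.Finite ℤ Λ] (hL : L.IsTwoElementary) {h : Mp2Z}
    (hh : h ∈ MGamma04) : L.IsStab h := by
  rw [Mp2Z.MGamma04_eq, Mp2Z.gammaGen] at hh
  induction hh using Subgroup.closure_induction with
  | mem x hx =>
    rcases hx with rfl | rfl | hx
    · exact ⟨1, one_ne_zero, by rw [weilRep_T_e_zero hL, one_smul], by simp [f0H_slash_T]⟩
    · exact ⟨1, one_ne_zero, by rw [weilRep_ST4S_e_zero hL, one_smul], by simp [f0H_slash_ST4S]⟩
    · rw [Set.mem_singleton_iff] at hx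
      subst hx
      refine ⟨I ^ (-L.sigma), zpow_ne_zero _ I_ne_zero, ?_, funext fun τ => f0H_slash_S_sq _ _⟩
      rw [weilRep_S_sq hL, ← exp_pi_div_two_mul_int]
      congr 2
      push_cast
      ring
  | one => exact ⟨1, one_ne_zero, by simp, by simp [slashMp_one]⟩
  | mul x y _ _ hx hy =>
    obtain ⟨a, ha, ha1, ha2⟩ := hx
    obtain ⟨b, hb, hb1, hb2⟩ := hy
    refine ⟨a * b, mul_ne_zero ha hb, ?_, ?_⟩
    · rw [weilRep_mul_apply, hb1, map_smul, ha1, smul_smul, mul_comm]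
    · rw [slashMp_mul, ha2, slashMp_const_mul, hb2]
      funext τ; ring
  | inv x _ hx =>
    obtain ⟨a, ha, ha1, ha2⟩ := hx
    refine ⟨a⁻¹, inv_ne_zero ha, ?_, ?_⟩
    · have := weilRep_inv_eq_of_eq ha1
      rw [map_smul] at this
      rw [eq_inv_smul_iff₀ ha, this]
    · have h1 := slashMp_mul L.sigma (f0H L.sigma) x x⁻¹
      rw [mul_inv_cancel, slashMp_one, ha2, slashMp_const_mul] at h1
      funext τ
      rw [congrFun h1 τ, inv_mul_cancel_left₀ ha]

/-- The summand depends only on the coset. -/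
theorem indTerm_mul_left [Module.Free ℤ Λ] [Module.Finite ℤ Λ] (hL : L.IsTwoElementary) {h : Mp2Z}
    (hh : h ∈ MGamma04) (τ : ℍ) (g : Mp2Z) : L.indTerm τ (h * g) = L.indTerm τ g := by
  obtain ⟨a, ha, ha1, ha2⟩ := isStab_of_mem hL hh
  have h1 := weilRep_inv_eq_of_eq ha1
  rw [map_smul] at h1
  rw [indTerm, indTerm, slashMp_mul, ha2, slashMp_const_mul, mul_inv_rev, weilRep_mul_apply]
  conv_rhs => rw [← h1, map_smul, smul_smul]
  rw [mul_comm _ a]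

theorem indTerm_eq_of_mk_eq [Module.Free ℤ Λ] [Module.Finite ℤ Λ] (hL : L.IsTwoElementary)
    {g g' : Mp2Z} (h : (Quotient.mk _ g : Cosets) = Quotient.mk _ g') (τ : ℍ) :
    L.indTerm τ g = L.indTerm τ g' := by
  have h1 := QuotientGroup.rightRel_apply.mp (Quotient.exact h)
  have := indTerm_mul_left hL h1 τ g
  rwa [inv_mul_cancel_right, eq_comm] at this

theorem indTerm_mul_right (τ : ℍ) (h g : Mp2Z) :
    L.indTerm (g.mat • τ) h = g.j τ ^ L.sigma • L.weilRep g (L.indTerm τ (h * g)) := by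
  have h1 : slashMp L.sigma (f0H L.sigma) h (g.mat • τ)
      = g.j τ ^ L.sigma * slashMp L.sigma (f0H L.sigma) (h * g) τ := by
    rw [slashMp_mul]
    conv_rhs => rw [slashMp, zpow_neg]
    have := zpow_ne_zero L.sigma (g.j_ne_zero τ)
    field_simp
  rw [indTerm, indTerm, h1, map_smul, mul_inv_rev, weilRep_mul_apply, ← weilRep_mul_apply g,
    mul_inv_cancel, map_one, smul_smul]
  rfl

instance : Finite Cosets := Finite.of_surjective _ Mp2Z.cosetRep_bijective.surjective

/-- Right multiplication by `g` on `MΓ₀(4) \ Mp₂(ℤ)`. -/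
def cosetMulRight (g : Mp2Z) : Cosets → Cosets :=
  Quotient.map (· * g) fun a b h => by
    rw [← Quotient.eq_iff_equiv, Quotient.eq''] at h
    have h := QuotientGroup.rightRel_apply.mp h
    refine QuotientGroup.rightRel_apply.mpr ?_
    simpa [mul_assoc] using h

theorem cosetMulRight_bijective (g : Mp2Z) : Function.Bijective (cosetMulRight g) := by
  refine Function.bijective_iff_has_inverse.mpr ⟨cosetMulRight g⁻¹, fun c => ?_, fun c => ?_⟩ <;>
  · induction c using Quotient.inductionOn with | _ a
    simp [cosetMulRight]

variable (L) in
/-- The summand of the induced function as a function on the cosets. -/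
def indCoset (τ : ℍ) (c : Cosets) : L.DiscGroup → ℂ := L.indTerm τ c.out

theorem indTerm_eq_indCoset [Module.Free ℤ Λ] [Module.Finite ℤ Λ] (hL : L.IsTwoElementary)
    (τ : ℍ) (g : Mp2Z) : L.indTerm τ g = L.indCoset τ (Quotient.mk _ g) :=
  indTerm_eq_of_mk_eq hL (Quotient.out_eq _).symm τ

variable (L) in
/-- The induced function `𝓑_Λ[f^{(0)}]`, as a sum over cosets. -/
def indFun (τ : ℍ) : L.DiscGroup → ℂ := ∑ᶠ c, L.indCoset τ c

theorem induced_eq_indFun [Module.Free ℤ Λ] [Module.Finite ℤ Λ] (hL : L.IsTwoElementary)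
    (s : Cosets → Mp2Z) (hs : ∀ c, (Quotient.mk _ (s c) : Cosets) = c) (τ : ℍ) :
    L.induced s L.sigma (fun z : ℍ => etaQuot z * thetaA1 z ^ (8 + L.sigma)) τ = L.indFun τ := by
  rw [induced, indFun]
  refine finsum_congr fun c => ?_
  have h : (fun z : ℍ => etaQuot z * thetaA1 z ^ (8 + L.sigma)) = f0H L.sigma :=
    funext fun z => etaQuot_mul_thetaA1 _ _
  rw [h]
  have := indTerm_eq_indCoset hL τ (s c)
  rwa [hs c] at this

/-- The induced function is modular, as right multiplication by `g` permutes the cosets. -/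
theorem indFun_smul [Module.Free ℤ Λ] [Module.Finite ℤ Λ] (hL : L.IsTwoElementary)
    (g : Mp2Z) (τ : ℍ) :
    L.indFun (g.mat • τ) = g.j τ ^ L.sigma • L.weilRep g (L.indFun τ) := by
  have h1 : L.indFun τ = ∑ᶠ c, L.indCoset τ (cosetMulRight g c) :=
    (finsum_comp _ (cosetMulRight_bijective g)).symm
  rw [h1, indFun]
  have hsum : ∑ᶠ c, L.indCoset (g.mat • τ) c
      = ∑ᶠ c, (g.j τ ^ L.sigma • L.weilRep g) (L.indCoset τ (cosetMulRight g c)) := by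
    refine finsum_congr fun c => ?_
    induction c using Quotient.inductionOn with | _ a
    rw [← indTerm_eq_indCoset hL, indTerm_mul_right]
    have : cosetMulRight g (Quotient.mk _ a) = Quotient.mk _ (a * g) := rfl
    rw [this, ← indTerm_eq_indCoset hL]
    rfl
  rw [hsum, ← LinearMap.smul_apply]
  exact ((g.j τ ^ L.sigma • L.weilRep g).toAddMonoidHom.map_finsum (Set.toFinite _)).symm

/-- The induced function over the six cosets `1`, `STʲ` for `0 ≤ j < 4`, and `ST²S`. -/
theorem indFun_apply [Module.Free ℤ Λ] [Module.Finite ℤ Λ] (hL : L.IsTwoElementary) (τ : ℍ)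
    (δ : L.DiscGroup) :
    L.indFun τ δ = f0 (8 + L.sigma) τ * L.e 0 δ
      + slashConst ^ L.sigma * L.weilConstInv * ∑ j ∈ Finset.range 4,
          (eHalf (L.q δ) ^ j)⁻¹ * f0 (8 + L.sigma) (((τ : ℂ) + j) / 4)
      + f1 (8 + L.sigma) τ * L.e L.one δ := by
  have h0 : L.indFun τ = ∑ i : Fin 6, L.indTerm τ (Mp2Z.cosetRep i) := by
    rw [indFun, ← finsum_comp _ Mp2Z.cosetRep_bijective, finsum_eq_sum_of_fintype]
    exact Finset.sum_congr rfl fun i _ => (indTerm_eq_indCoset hL τ _).symm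
  have hST : ∀ n : ℕ, L.indTerm τ (Mp2Z.S * Mp2Z.T ^ n) δ
      = slashConst ^ L.sigma * L.weilConstInv *
        ((eHalf (L.q δ) ^ n)⁻¹ * f0 (8 + L.sigma) (((τ : ℂ) + n) / 4)) := by
    intro n
    rw [indTerm, Pi.smul_apply, f0H_slash_ST_pow, weilRep_ST_pow_inv_e_zero hL, smul_eq_mul]
    ring
  have h5 : L.indTerm τ (Mp2Z.S * Mp2Z.T ^ 2 * Mp2Z.S) δ = f1 (8 + L.sigma) τ * L.e L.one δ := by
    rw [indTerm, Pi.smul_apply, f0H_slash_STTS, weilRep_STTS_inv_e_zero hL, Pi.smul_apply,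
      exp_pi_div_two_mul_int, smul_eq_mul, smul_eq_mul]
    have : (-I) ^ L.sigma * I ^ L.sigma = 1 := by rw [← mul_zpow]; simp
    linear_combination (f1 (8 + L.sigma) τ * L.e L.one δ) * this
  have h1 : L.indTerm τ 1 δ = f0 (8 + L.sigma) τ * L.e 0 δ := by
    rw [indTerm, slashMp_one]; simp [f0H]
  have hT2 : Mp2Z.S * Mp2Z.T * Mp2Z.T = Mp2Z.S * Mp2Z.T ^ 2 := by rw [pow_two, mul_assoc]
  have hT3 : Mp2Z.S * Mp2Z.T ^ 2 * Mp2Z.T = Mp2Z.S * Mp2Z.T ^ 3 := by rw [pow_succ _ 2, mul_assoc]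
  have a0 := hST 0
  have a1 := hST 1
  rw [pow_zero, mul_one] at a0
  rw [pow_one] at a1
  rw [h0, Finset.sum_apply, Fin.sum_univ_six, Finset.sum_range_succ, Finset.sum_range_succ,
    Finset.sum_range_succ, Finset.sum_range_succ, Finset.sum_range_zero]
  simp only [Mp2Z.cosetRep, Matrix.cons_val]
  rw [hT2, hT3, h1, h5, hST 2, hST 3, a0, a1]
  simp only [pow_zero, pow_one]
  ring

/-- The scalar in front of the functions `g^{(i)}` in `F_Λ`. -/
theorem slashConst_mul_weilConstInv (hL : L.IsTwoElementary) :
    4 * (slashConst ^ L.sigma * L.weilConstInv)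
      = (((2 : ℝ) ^ (((4 - L.sigma - L.len : ℤ) : ℝ) / 2) : ℝ) : ℂ) := by
  have h1 : slashConst ^ L.sigma = cexp (-(π * I * L.sigma / 4)) / ((√2 : ℝ) : ℂ) ^ L.sigma := by
    rw [slashConst, div_zpow, ← Complex.exp_int_mul]
    congr 2
    ring
  have h2 : (√2 : ℝ) = (2 : ℝ) ^ (1 / 2 : ℝ) := Real.sqrt_eq_rpow 2
  have h3 : √((Nat.card L.DiscGroup : ℕ) : ℝ) = (2 : ℝ) ^ ((L.len : ℝ) / 2) := by
    rw [hL.card_eq, Real.sqrt_eq_rpow]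
    push_cast
    rw [← Real.rpow_natCast, ← Real.rpow_mul (by norm_num)]
    congr 1
    ring
  have h4 : ((√2 : ℝ) : ℂ) ^ L.sigma = (((2 : ℝ) ^ ((L.sigma : ℝ) / 2) : ℝ) : ℂ) := by
    rw [← Complex.ofReal_zpow, h2, ← Real.rpow_intCast, ← Real.rpow_mul (by norm_num)]
    congr 2
    ring
  have h5 : (2 : ℝ) ^ (((4 - L.sigma - L.len : ℤ) : ℝ) / 2)
      = 4 / ((2 : ℝ) ^ ((L.sigma : ℝ) / 2) * (2 : ℝ) ^ ((L.len : ℝ) / 2)) := by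
    rw [← Real.rpow_add (by norm_num), eq_div_iff (Real.rpow_pos_of_pos (by norm_num) _).ne',
      ← Real.rpow_add (by norm_num)]
    push_cast
    rw [show ((4 - (L.sigma : ℝ) - L.len) / 2 + ((L.sigma : ℝ) / 2 + (L.len : ℝ) / 2)) = (2 : ℕ) by
      push_cast; ring, Real.rpow_natCast]
    norm_num
  rw [h1, weilConstInv, h3, h4, h5, Complex.exp_neg]
  push_cast
  have e := Complex.exp_ne_zero (π * I * L.sigma / 4)
  field_simp

end EvenLattice

/-! ### Power series with integral coefficients -/

/-- `f` is given by the power series with coefficients `a` on the open unit disc. -/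
def HasSeries (f : ℂ → ℂ) (a : ℕ → ℂ) : Prop :=
  ∀ q : ℂ, ‖q‖ < 1 → HasSum (fun n => a n * q ^ n) (f q)

/-- `f` is given by a power series with integral coefficients on the open unit disc. -/
def IsIntSeries (f : ℂ → ℂ) : Prop := ∃ a : ℕ → ℤ, HasSeries f (fun n => (a n : ℂ))

/-- The coefficients of a power series are Fourier integrals over the line `Im τ = 1`. -/
theorem HasSeries.integral_eq {f : ℂ → ℂ} {a : ℕ → ℂ} (h : HasSeries f a) (l : ℤ) :
    ∫ x in (0 : ℝ)..1, f (cexp (2 * π * I * ((x : ℂ) + I))) * cexp (-(2 * π * I * l * ((x : ℂ) + I)))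
      = if 0 ≤ l then a l.toNat else 0 := by
  set r : ℝ := Real.exp (-(2 * π)) with hr
  have hr0 : 0 < r := Real.exp_pos _
  have hr1 : r < 1 := by
    rw [hr, Real.exp_lt_one_iff]
    linarith [Real.pi_pos]
  have hnorm : ∀ x : ℝ, ‖cexp (2 * π * I * ((x : ℂ) + I))‖ = r := by
    intro x
    rw [Complex.norm_exp, hr]
    congr 1
    simp
  have hnorm' : ∀ x : ℝ, ‖cexp (-(2 * π * I * l * ((x : ℂ) + I)))‖ = Real.exp (2 * π * l) := by
    intro x
    rw [Complex.norm_exp]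
    congr 1
    simp
  have hsum : Summable fun n => ‖a n‖ * r ^ n := by
    have := (h (r : ℂ) (by rwa [Complex.norm_real, Real.norm_of_nonneg hr0.le])).summable.norm
    simpa [abs_of_pos hr0] using this
  have hs := intervalIntegral.hasSum_integral_of_dominated_convergence (μ := MeasureTheory.volume)
    (a := 0) (b := 1)
    (F := fun n (x : ℝ) => a n * cexp (2 * π * I * ((x : ℂ) + I)) ^ n *
      cexp (-(2 * π * I * l * ((x : ℂ) + I))))
    (f := fun x : ℝ => f (cexp (2 * π * I * ((x : ℂ) + I))) *
      cexp (-(2 * π * I * l * ((x : ℂ) + I))))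
    (fun n _ => ‖a n‖ * r ^ n * Real.exp (2 * π * l))
    (fun n => (Continuous.aestronglyMeasurable (by fun_prop)))
    (fun n => Filter.Eventually.of_forall fun x _ => by
      rw [norm_mul, norm_mul, norm_pow, hnorm, hnorm'])
    (Filter.Eventually.of_forall fun x _ => hsum.mul_right _)
    (by simp)
    (Filter.Eventually.of_forall fun x _ =>
      (h _ (by rw [hnorm]; exact hr1)).mul_right _)
  have hint : ∀ n : ℕ, ∫ x in (0 : ℝ)..1, a n * cexp (2 * π * I * ((x : ℂ) + I)) ^ n *
      cexp (-(2 * π * I * l * ((x : ℂ) + I))) = if (n : ℤ) = l then a n else 0 := by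
    intro n
    have e1 : ∀ x : ℝ, a n * cexp (2 * π * I * ((x : ℂ) + I)) ^ n *
        cexp (-(2 * π * I * l * ((x : ℂ) + I)))
        = a n * cexp (-(2 * π * (n - l))) * cexp (2 * π * I * (n - l) * x) := by
      intro x
      rw [← Complex.exp_nat_mul, mul_assoc (a n), mul_assoc (a n), ← Complex.exp_add,
        ← Complex.exp_add]
      congr 2
      linear_combination (2 * π * (n - l)) * I_sq
    simp_rw [e1]
    rw [intervalIntegral.integral_const_mul]
    split_ifs with hn
    · have : (l : ℂ) = n := by rw [← hn]; simp
      simp [this]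
    · have hc : (2 * π * I * (n - l) : ℂ) ≠ 0 := by
        refine mul_ne_zero two_pi_I_ne_zero ?_
        rw [sub_ne_zero]
        exact_mod_cast hn
      rw [integral_exp_mul_complex hc]
      have : cexp (2 * π * I * (n - l) * (1 : ℝ)) = 1 := by
        rw [Complex.exp_eq_one_iff]
        exact ⟨n - l, by push_cast; ring⟩
      rw [this]
      simp
  simp_rw [hint] at hs
  refine hs.unique ?_
  split_ifs with hl
  · have := hasSum_ite_eq l.toNat (a l.toNat)
    refine this.congr_fun ?_
    intro n
    have : (n : ℤ) = l ↔ n = l.toNat := by omega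
    simp only [this]
    split_ifs with hn
    · rw [hn]
    · rfl
  · have : ∀ n : ℕ, ¬ (n : ℤ) = l := by intro n; omega
    simp only [this, if_false]
    exact hasSum_zero

theorem HasSeries.unique {f : ℂ → ℂ} {a b : ℕ → ℂ} (ha : HasSeries f a) (hb : HasSeries f b) :
    a = b := by
  funext n
  have h1 := ha.integral_eq n
  rw [hb.integral_eq n] at h1
  simpa using h1.symm

theorem HasSeries.mul {f g : ℂ → ℂ} {a b : ℕ → ℂ} (ha : HasSeries f a) (hb : HasSeries g b) :
    HasSeries (fun q => f q * g q) (fun n => ∑ p ∈ Finset.HasAntidiagonal.antidiagonal n, a p.1 * b p.2) := by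
  intro q hq
  have h1 := ha q hq
  have h2 := hb q hq
  have hs := (summable_norm_sum_mul_antidiagonal_of_summable_norm h1.summable.norm
    h2.summable.norm).of_norm
  have ht := tsum_mul_tsum_eq_tsum_sum_antidiagonal_of_summable_norm h1.summable.norm
    h2.summable.norm
  rw [h1.tsum_eq, h2.tsum_eq] at ht
  have := hs.hasSum
  rw [← ht] at this
  convert! this using 1
  funext n
  rw [Finset.sum_mul]
  refine Finset.sum_congr rfl fun p hp => ?_
  rw [← Finset.HasAntidiagonal.mem_antidiagonal.mp hp, pow_add]
  ring

theorem HasSeries.apply_zero {f : ℂ → ℂ} {a : ℕ → ℂ} (h : HasSeries f a) : f 0 = a 0 := by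
  have h1 := h 0 (by simp)
  refine h1.unique ?_
  have := hasSum_single (f := fun n => a n * (0 : ℂ) ^ n) 0 (fun n hn => by simp [hn])
  simpa using this

theorem HasSeries.differentiableOn {f : ℂ → ℂ} {a : ℕ → ℂ} (h : HasSeries f a) :
    DifferentiableOn ℂ f (Metric.ball 0 1) := by
  have hp : HasFPowerSeriesOnBall f (FormalMultilinearSeries.ofScalars ℂ a) 0 1 := by
    refine ⟨?_, one_pos, fun {y} hy => ?_⟩
    · refine ENNReal.le_of_forall_nnreal_lt fun r hr => ?_
      refine FormalMultilinearSeries.le_radius_of_summable _ ?_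
      have hr' : (r : ℝ) < 1 := by exact_mod_cast hr
      have := (h (r : ℂ) (by simpa using hr')).summable.norm
      simpa using this
    · have hy' : ‖y‖ < 1 := by
        simpa [← ENNReal.ofReal_one, Metric.eball_ofReal] using hy
      have := h y hy'
      simpa [FormalMultilinearSeries.ofScalars_apply_eq, mul_comm] using this
  have := hp.differentiableOn
  rwa [← ENNReal.ofReal_one, Metric.eball_ofReal] at this

theorem IsIntSeries.differentiableOn {f : ℂ → ℂ} (h : IsIntSeries f) :
    DifferentiableOn ℂ f (Metric.ball 0 1) := by
  obtain ⟨a, ha⟩ := h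
  exact ha.differentiableOn

theorem IsIntSeries.mul {f g : ℂ → ℂ} (hf : IsIntSeries f) (hg : IsIntSeries g) :
    IsIntSeries (fun q => f q * g q) := by
  obtain ⟨a, ha⟩ := hf
  obtain ⟨b, hb⟩ := hg
  exact ⟨fun n => ∑ p ∈ Finset.HasAntidiagonal.antidiagonal n, a p.1 * b p.2, by simpa using ha.mul hb⟩

theorem isIntSeries_one : IsIntSeries (fun _ => 1) := by
  refine ⟨fun n => if n = 0 then 1 else 0, fun q _ => ?_⟩
  have := hasSum_single (f := fun n : ℕ => ((if n = 0 then 1 else 0 : ℤ) : ℂ) * q ^ n) 0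
    (fun n hn => by simp [hn])
  simpa using this

theorem IsIntSeries.add {f g : ℂ → ℂ} (hf : IsIntSeries f) (hg : IsIntSeries g) :
    IsIntSeries (fun q => f q + g q) := by
  obtain ⟨a, ha⟩ := hf
  obtain ⟨b, hb⟩ := hg
  exact ⟨fun n => a n + b n, fun q hq => by simpa [add_mul] using (ha q hq).add (hb q hq)⟩

theorem IsIntSeries.pow {f : ℂ → ℂ} (hf : IsIntSeries f) (n : ℕ) :
    IsIntSeries (fun q => f q ^ n) := by
  induction n with
  | zero => simpa using isIntSeries_one
  | succ n ih => simpa only [pow_succ] using ih.mul hf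

theorem IsIntSeries.comp_neg {f : ℂ → ℂ} (hf : IsIntSeries f) : IsIntSeries (fun q => f (-q)) := by
  obtain ⟨a, ha⟩ := hf
  refine ⟨fun n => (-1) ^ n * a n, fun q hq => ?_⟩
  have := ha (-q) (by rwa [norm_neg])
  convert! this using 1
  funext n
  rw [neg_pow]
  push_cast
  ring

/-- The reciprocal of a nowhere vanishing function on the disc has an expansion by
holomorphy, and its coefficients are integral by the recursion that determines them. -/
theorem IsIntSeries.inv {f : ℂ → ℂ} (hf : IsIntSeries f) (h0 : f 0 = 1)
    (hne : ∀ q : ℂ, ‖q‖ < 1 → f q ≠ 0) : IsIntSeries (fun q => (f q)⁻¹) := by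
  have hd : DifferentiableOn ℂ (fun q => (f q)⁻¹) (Metric.ball 0 1) :=
    hf.differentiableOn.inv fun q hq => hne q (by simpa using hq)
  obtain ⟨a, ha⟩ := hf
  obtain ⟨c, hc⟩ : ∃ c : ℕ → ℂ, HasSeries (fun q => (f q)⁻¹) c := by
    refine ⟨fun n => (n.factorial : ℂ)⁻¹ * iteratedDeriv n (fun q => (f q)⁻¹) 0, fun q hq => ?_⟩
    have := Complex.hasSum_taylorSeries_on_ball hd (z := q) (by simpa using hq)
    convert! this using 1
    funext n
    simp only [sub_zero, smul_eq_mul]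
    ring
  obtain ⟨e, he⟩ := isIntSeries_one
  have h1 : HasSeries (fun _ => 1) (fun n => ∑ p ∈ Finset.HasAntidiagonal.antidiagonal n, (a p.1 : ℂ) * c p.2) := by
    intro q hq
    have := ha.mul hc q hq
    simpa [mul_inv_cancel₀ (hne q hq)] using this
  have h2 := h1.unique he
  have ha0 : (a 0 : ℂ) = 1 := by rw [← h0, ha.apply_zero]
  have hint : ∀ n, ∃ m : ℤ, c n = m := by
    intro n
    induction n using Nat.strong_induction_on with
    | _ n ih =>
      have h3 := congrFun h2 n
      rw [Finset.Nat.sum_antidiagonal_eq_sum_range_succ_mk, Finset.sum_range_succ'] at h3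
      simp only [ha0, one_mul, Nat.sub_zero] at h3
      have h4 : ∃ m : ℤ, ∑ k ∈ Finset.range n, (a (k + 1) : ℂ) * c (n - (k + 1)) = m := by
        have h5 : ∀ k, ∃ m : ℤ, k ∈ Finset.range n → c (n - (k + 1)) = m := by
          intro k
          by_cases hk : k ∈ Finset.range n
          · obtain ⟨m, hm⟩ := ih (n - (k + 1)) (by have := Finset.mem_range.mp hk; omega)
            exact ⟨m, fun _ => hm⟩
          · exact ⟨0, fun h => absurd h hk⟩
        choose m hm using h5
        refine ⟨∑ k ∈ Finset.range n, a (k + 1) * m k, ?_⟩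
        push_cast
        exact Finset.sum_congr rfl fun k hk => by rw [hm k hk]
      obtain ⟨m, hm⟩ := h4
      rw [hm] at h3
      exact ⟨e n - m, by push_cast; linear_combination h3⟩
  choose d hd using hint
  refine ⟨d, ?_⟩
  have : c = fun n => (d n : ℂ) := funext hd
  rwa [← this]

theorem IsIntSeries.zpow {f : ℂ → ℂ} (hf : IsIntSeries f) (h0 : f 0 = 1)
    (hne : ∀ q : ℂ, ‖q‖ < 1 → f q ≠ 0) (k : ℤ) : IsIntSeries (fun q => f q ^ k) := by
  cases k with
  | ofNat k => simpa using hf.pow k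
  | negSucc k => simpa [zpow_negSucc] using ((hf.pow (k + 1)).inv (by simp [h0])
      fun q hq => pow_ne_zero _ (hne q hq))

theorem isIntSeries_tsum_pow {e : ℕ → ℕ} (he : Function.Injective e) :
    IsIntSeries (fun q => ∑' n, q ^ e n) := by
  classical
  refine ⟨Function.extend e (fun _ => 1) 0, fun q hq => ?_⟩
  have hs : Summable fun n => q ^ e n :=
    (summable_geometric_of_norm_lt_one hq).comp_injective he
  refine (he.hasSum_iff ?_).mp ?_
  · intro n hn
    simp only
    rw [Function.extend_apply' _ _ _ (by simpa using hn)]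
    simp
  · convert! hs.hasSum using 1
    funext n
    simp [he.extend_apply]

/-! ### The expansions of the theta constants -/

/-- `∑_{n ∈ ℤ} q^{n²}`. -/
def squareSeries (q : ℂ) : ℂ := 1 + (∑' n : ℕ, q ^ ((n + 1) ^ 2) + ∑' n : ℕ, q ^ ((n + 1) ^ 2))

/-- `∑_{n ≥ 0} q^{n(n+1)}`. -/
def pronicSeries (q : ℂ) : ℂ := ∑' n : ℕ, q ^ (n ^ 2 + n)

theorem isIntSeries_squareSeries : IsIntSeries squareSeries := by
  have h : IsIntSeries fun q => ∑' n : ℕ, q ^ ((n + 1) ^ 2) :=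
    isIntSeries_tsum_pow fun a b hab => by
      have := Nat.pow_left_injective (n := 2) (by norm_num) hab
      omega
  exact isIntSeries_one.add (h.add h)

theorem isIntSeries_pronicSeries : IsIntSeries pronicSeries :=
  isIntSeries_tsum_pow (StrictMono.injective fun a b hab => by
    have : a ^ 2 < b ^ 2 := Nat.pow_lt_pow_left hab two_ne_zero
    change a ^ 2 + a < b ^ 2 + b; omega)

theorem squareSeries_zero : squareSeries 0 = 1 := by
  simp [squareSeries]

theorem pronicSeries_zero : pronicSeries 0 = 1 := by
  rw [pronicSeries, tsum_eq_single 0 fun n hn => by simp [hn]]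
  simp

theorem jacobiTheta3_eq_squareSeries {τ : ℂ} (hτ : 0 < τ.im) :
    jacobiTheta3 (2 * τ) = squareSeries (cexp (2 * π * I * τ)) := by
  have h := hasSum_nat_jacobiTheta (τ := 2 * τ) (by simpa using hτ)
  have h2 : ∀ n : ℕ, cexp (π * I * ((n : ℂ) + 1) ^ 2 * (2 * τ)) = cexp (2 * π * I * τ) ^ ((n + 1) ^ 2) := by
    intro n
    rw [← Complex.exp_nat_mul]
    congr 1
    push_cast
    ring
  simp_rw [h2] at h
  rw [squareSeries, h.tsum_eq]
  change jacobiTheta (2 * τ) = _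
  ring

theorem jacobiTheta4_eq_squareSeries {τ : ℂ} (hτ : 0 < τ.im) :
    jacobiTheta4 (2 * τ) = squareSeries (-cexp (2 * π * I * τ)) := by
  rw [← jacobiTheta3_add_one, show 2 * τ + 1 = 2 * (τ + 1 / 2) by ring,
    jacobiTheta3_eq_squareSeries (by simpa using hτ), mul_add, Complex.exp_add,
    show 2 * π * I * (1 / 2) = π * I by ring, Complex.exp_pi_mul_I, mul_neg_one]

theorem jacobiTheta2_eq_pronicSeries {τ : ℂ} (hτ : 0 < τ.im) :
    jacobiTheta2 (2 * τ) = 2 * cexp (π * I * τ / 2) * pronicSeries (cexp (2 * π * I * τ)) := by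
  have h := (hasSum_jacobiTheta2 hτ).nat_add_neg_add_one
  have hQ := Complex.exp_ne_zero (2 * π * I * τ)
  have h2 : ∀ n : ℕ, cexp (2 * π * I * τ) ^ ((n : ℤ) ^ 2) * cexp (2 * π * I * τ) ^ (n : ℤ)
      + cexp (2 * π * I * τ) ^ ((-((n : ℤ) + 1)) ^ 2) * cexp (2 * π * I * τ) ^ (-((n : ℤ) + 1))
      = 2 * cexp (2 * π * I * τ) ^ (n ^ 2 + n) := by
    intro n
    rw [← zpow_add₀ hQ, ← zpow_add₀ hQ, ← zpow_natCast,
      show (-((n : ℤ) + 1)) ^ 2 + -((n : ℤ) + 1) = (n : ℤ) ^ 2 + n by ring]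
    push_cast
    ring
  simp_rw [h2] at h
  have h3 := h.tsum_eq
  rw [tsum_mul_left] at h3
  rw [pronicSeries, mul_right_comm, h3, mul_right_comm, ← Complex.exp_add]
  simp

/-- Every point of the punctured disc is `e^{2πiτ}`; this transfers the non-vanishing of theta constants
to their power series. -/
theorem exists_exp_eq {q : ℂ} (hq : ‖q‖ < 1) (h0 : q ≠ 0) :
    ∃ τ : ℂ, 0 < τ.im ∧ cexp (2 * π * I * τ) = q := by
  have hu : cexp (2 * π * I * (Complex.log q / (2 * π * I))) = q := by
    rw [mul_div_cancel₀ _ two_pi_I_ne_zero, Complex.exp_log h0]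
  refine ⟨Complex.log q / (2 * π * I), ?_, hu⟩
  generalize Complex.log q / (2 * π * I) = u at hu
  rw [← hu, Complex.norm_exp, Real.exp_lt_one_iff] at hq
  have : (2 * π * I * u : ℂ).re = -(2 * π * u.im) := by simp
  rw [this] at hq
  have hp := Real.pi_pos
  by_contra! h
  nlinarith

theorem squareSeries_ne_zero {q : ℂ} (hq : ‖q‖ < 1) : squareSeries q ≠ 0 := by
  by_cases h0 : q = 0
  · rw [h0, squareSeries_zero]; exact one_ne_zero
  obtain ⟨τ, hτ, rfl⟩ := exists_exp_eq hq h0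
  rw [← jacobiTheta3_eq_squareSeries hτ]
  exact jacobiTheta3_ne_zero (by simpa using hτ)

theorem pronicSeries_ne_zero {q : ℂ} (hq : ‖q‖ < 1) : pronicSeries q ≠ 0 := by
  by_cases h0 : q = 0
  · rw [h0, pronicSeries_zero]; exact one_ne_zero
  obtain ⟨τ, hτ, rfl⟩ := exists_exp_eq hq h0
  have := jacobiTheta2_ne_zero (τ := 2 * τ) (by simpa using hτ)
  rw [jacobiTheta2_eq_pronicSeries hτ] at this
  exact right_ne_zero_of_mul this

/-- The power series with `f_k^{(0)}(τ) = q⁻¹ P_k(q)`. -/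
def f0Series (k : ℤ) (q : ℂ) : ℂ :=
  squareSeries q ^ k * (pronicSeries q ^ (-4 : ℤ) * squareSeries (-q) ^ (-4 : ℤ))

/-- The power series with `f_k^{(1)}(τ) = -2^{4+k} q^{k/4} H_k(q)`. -/
def f1Series (k : ℤ) (q : ℂ) : ℂ :=
  pronicSeries q ^ k * (squareSeries q ^ (-4 : ℤ) * squareSeries (-q) ^ (-4 : ℤ))

theorem isIntSeries_f0Series (k : ℤ) : IsIntSeries (f0Series k) :=
  (isIntSeries_squareSeries.zpow squareSeries_zero (fun _ => squareSeries_ne_zero) k).mul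
    ((isIntSeries_pronicSeries.zpow pronicSeries_zero (fun _ => pronicSeries_ne_zero) (-4)).mul
      (isIntSeries_squareSeries.zpow squareSeries_zero (fun _ => squareSeries_ne_zero) (-4)).comp_neg)

theorem isIntSeries_f1Series (k : ℤ) : IsIntSeries (f1Series k) :=
  (isIntSeries_pronicSeries.zpow pronicSeries_zero (fun _ => pronicSeries_ne_zero) k).mul
    ((isIntSeries_squareSeries.zpow squareSeries_zero (fun _ => squareSeries_ne_zero) (-4)).mul
      (isIntSeries_squareSeries.zpow squareSeries_zero (fun _ => squareSeries_ne_zero) (-4)).comp_neg)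

theorem f0_eq_series (k : ℤ) {τ : ℂ} (hτ : 0 < τ.im) :
    f0 k τ = cexp (-(2 * π * I * τ)) * f0Series k (cexp (2 * π * I * τ)) := by
  have hq := norm_exp_two_pi_lt_one hτ
  have h1 := squareSeries_ne_zero (q := -cexp (2 * π * I * τ)) (by rwa [norm_neg])
  have h2 := pronicSeries_ne_zero hq
  rw [f0_eq k hτ, jacobiTheta3_eq_squareSeries hτ, jacobiTheta4_eq_squareSeries hτ,
    jacobiTheta2_eq_pronicSeries hτ, f0Series, zpow_neg, zpow_neg, Complex.exp_neg]
  have he : cexp (2 * π * I * τ) = cexp (π * I * τ / 2) ^ 4 := by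
    rw [← Complex.exp_nat_mul]; congr 1; push_cast; ring
  have h3 := Complex.exp_ne_zero (π * I * τ / 2)
  generalize hX : squareSeries (cexp (2 * π * I * τ)) = X
  generalize hY : squareSeries (-cexp (2 * π * I * τ)) = Y at *
  generalize hZ : pronicSeries (cexp (2 * π * I * τ)) = Z at *
  rw [he]
  norm_cast
  field_simp
  norm_num [mul_comm]

theorem f1_eq_series (k : ℤ) {τ : ℂ} (hτ : 0 < τ.im) :
    f1 k τ = (-(16 * 2 ^ k)) * (cexp (2 * π * I * (k / 4) * τ) * f1Series k (cexp (2 * π * I * τ))) := by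
  have hq := norm_exp_two_pi_lt_one hτ
  have h1 := squareSeries_ne_zero (q := -cexp (2 * π * I * τ)) (by rwa [norm_neg])
  have h2 := squareSeries_ne_zero hq
  rw [f1_eq k hτ, jacobiTheta3_eq_squareSeries hτ, jacobiTheta4_eq_squareSeries hτ,
    jacobiTheta2_eq_pronicSeries hτ, f1Series, zpow_neg, zpow_neg, mul_zpow, mul_zpow]
  have he : cexp (2 * π * I * (k / 4) * τ) = cexp (π * I * τ / 2) ^ k := by
    rw [← Complex.exp_int_mul]; congr 1; ring
  rw [he]
  generalize squareSeries (cexp (2 * π * I * τ)) = X at *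
  generalize squareSeries (-cexp (2 * π * I * τ)) = Y at *
  generalize pronicSeries (cexp (2 * π * I * τ)) = Z at *
  have hX : X ^ (4 : ℤ) = X ^ 4 := by norm_cast
  have hY : Y ^ (4 : ℤ) = Y ^ 4 := by norm_cast
  rw [hX, hY]
  field_simp

/-! ### Fourier coefficients of `f^{(0)}` -/

/-- The index is shifted by `1` because `f^{(0)}` has the leading term `q⁻¹`. -/
theorem c0_eq (k : ℤ) {a : ℕ → ℂ} (ha : HasSeries (f0Series k) a) (l : ℤ) :
    c0 k l = if -1 ≤ l then a (l + 1).toNat else 0 := by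
  have h := ha.integral_eq (l + 1)
  have h2 : 0 ≤ l + 1 ↔ -1 ≤ l := by omega
  simp only [h2] at h
  rw [← h, c0]
  refine intervalIntegral.integral_congr fun x _ => ?_
  rw [f0_eq_series k (by simp), mul_right_comm, ← Complex.exp_add, mul_comm]
  congr 2
  push_cast
  ring

theorem c0_int (k l : ℤ) : ∃ n : ℤ, c0 k l = n := by
  obtain ⟨a, ha⟩ := isIntSeries_f0Series k
  rw [c0_eq k ha]
  split_ifs
  · exact ⟨_, rfl⟩
  · exact ⟨0, by simp⟩

theorem c0_eq_zero {k l : ℤ} (h : l < -1) : c0 k l = 0 := by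
  obtain ⟨a, ha⟩ := isIntSeries_f0Series k
  rw [c0_eq k ha, if_neg (by omega)]

theorem hasSum_f0 (k : ℤ) {τ : ℂ} (hτ : 0 < τ.im) :
    HasSum (fun l : ℤ => c0 k l * cexp (2 * π * I * l * τ)) (f0 k τ) := by
  obtain ⟨a, ha⟩ := isIntSeries_f0Series k
  have h := (ha _ (norm_exp_two_pi_lt_one hτ)).mul_left (cexp (-(2 * π * I * τ)))
  rw [← f0_eq_series k hτ] at h
  have hinj : Function.Injective (fun n : ℕ => (n : ℤ) - 1) := fun a b hab => by
    simp only at hab; omega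
  refine (hinj.hasSum_iff ?_).mp ?_
  · intro l hl
    rw [c0_eq_zero, zero_mul]
    by_contra! hl'
    exact hl ⟨(l + 1).toNat, by simp only; omega⟩
  · convert! h using 1
    funext n
    simp only [Function.comp_apply]
    rw [c0_eq k ha, if_pos (by omega), show ((n : ℤ) - 1 + 1).toNat = n by omega,
      mul_left_comm, ← Complex.exp_nat_mul, ← Complex.exp_add]
    congr 2
    push_cast
    ring

/-- Averaging `f^{(0)}((τ + j)/4)` over `j` modulo `4` extracts `g^{(i)}`. -/
theorem hasSum_gFun (k : ℤ) (i : ℕ) {τ : ℂ} (hτ : 0 < τ.im) :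
    HasSum (fun l : {l : ℤ // l ≡ i [ZMOD 4]} => c0 k l * cexp (2 * π * I * ((l : ℤ) / 4) * τ))
      (1 / 4 * ∑ j ∈ Finset.range 4, cexp (-(π * I * j * (i / 2))) * f0 k ((τ + j) / 4)) := by
  have h : ∀ j : ℕ, HasSum (fun l : ℤ => cexp (-(π * I * j * (i / 2))) *
      (c0 k l * cexp (2 * π * I * l * ((τ + j) / 4))))
      (cexp (-(π * I * j * (i / 2))) * f0 k ((τ + j) / 4)) := fun j =>
    (hasSum_f0 k (by simpa using hτ)).mul_left _
  have h2 := (hasSum_sum (s := Finset.range 4) fun j _ => h j).mul_left (1 / 4)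
  have h3 : ∀ l : ℤ, 1 / 4 * ∑ j ∈ Finset.range 4, cexp (-(π * I * j * (i / 2))) *
      (c0 k l * cexp (2 * π * I * l * ((τ + j) / 4)))
      = {l : ℤ | l ≡ i [ZMOD 4]}.indicator
        (fun l => c0 k l * cexp (2 * π * I * ((l : ℤ) / 4) * τ)) l := by
    intro l
    set ζ : ℂ := cexp (2 * π * I * ((l - i : ℤ) / 4)) with hζ
    have hζ4 : ζ ^ 4 = 1 := by
      rw [hζ, ← Complex.exp_nat_mul, Complex.exp_eq_one_iff]
      exact ⟨l - i, by push_cast; ring⟩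
    have hterm : ∀ j : ℕ, cexp (-(π * I * j * (i / 2))) *
        (c0 k l * cexp (2 * π * I * l * ((τ + j) / 4)))
        = c0 k l * cexp (2 * π * I * ((l : ℤ) / 4) * τ) * ζ ^ j := by
      intro j
      rw [hζ, ← Complex.exp_nat_mul, mul_left_comm, ← Complex.exp_add, mul_assoc (c0 k l),
        ← Complex.exp_add]
      congr 2
      push_cast
      ring
    simp_rw [hterm, ← Finset.mul_sum]
    have hiff : l ≡ i [ZMOD 4] ↔ ζ = 1 := by
      rw [hζ, Complex.exp_eq_one_iff, Int.modEq_comm, Int.modEq_iff_dvd]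
      constructor
      · rintro ⟨c, hc⟩
        refine ⟨c, ?_⟩
        rw [hc]; push_cast; ring
      · rintro ⟨c, hc⟩
        refine ⟨c, ?_⟩
        have : ((l - i : ℤ) : ℂ) = (4 * c : ℤ) := by
          apply mul_left_cancel₀ two_pi_I_ne_zero
          push_cast at hc ⊢
          linear_combination 4 * hc
        exact_mod_cast this
    by_cases hl : l ≡ i [ZMOD 4]
    · rw [Set.indicator_of_mem (by exact hl), hiff.mp hl]
      simp only [one_pow, Finset.sum_const, Finset.card_range, nsmul_eq_mul]
      push_cast
      ring
    · rw [Set.indicator_of_notMem (by exact hl)]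
      have hne : ζ - 1 ≠ 0 := sub_ne_zero.mpr fun h => hl (hiff.mpr h)
      have : ∑ j ∈ Finset.range 4, ζ ^ j = 0 := by
        apply mul_left_cancel₀ hne
        rw [mul_comm, geom_sum_mul, hζ4]
        simp
      rw [this]
      simp
  simp_rw [h3] at h2
  exact hasSum_subtype_iff_indicator.mpr h2

theorem gFun_eq (k : ℤ) (i : ℕ) {τ : ℂ} (hτ : 0 < τ.im) :
    gFun k i τ = 1 / 4 * ∑ j ∈ Finset.range 4, cexp (-(π * I * j * (i / 2))) * f0 k ((τ + j) / 4) :=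
  (hasSum_gFun k i hτ).tsum_eq

/-! ### Fourier expansions in fractional powers of `q` -/

/-- `u(τ) = ∑_{n ∈ ℤ} c(n) e^{2πi(n/N)τ}` with coefficients in the subring `R` of `ℂ` that vanish
for `n ≪ 0`. -/
def HasQExp (N : ℕ) (R : Subring ℂ) (u : ℍ → ℂ) : Prop :=
  ∃ c : ℤ → ℂ, (∀ n, c n ∈ R) ∧ (∃ M : ℤ, ∀ n < M, c n = 0) ∧
    ∀ τ : ℍ, HasSum (fun n : ℤ => c n * cexp (2 * π * I * (n / N) * τ)) (u τ)

theorem HasQExp.add {N : ℕ} {R : Subring ℂ} {u w : ℍ → ℂ} (hu : HasQExp N R u)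
    (hw : HasQExp N R w) : HasQExp N R (fun τ => u τ + w τ) := by
  obtain ⟨c, hc, ⟨M, hM⟩, hs⟩ := hu
  obtain ⟨c', hc', ⟨M', hM'⟩, hs'⟩ := hw
  refine ⟨fun n => c n + c' n, fun n => R.add_mem (hc n) (hc' n), ⟨min M M', fun n hn => ?_⟩,
    fun τ => ?_⟩
  · simp only
    rw [hM n (lt_of_lt_of_le hn (min_le_left _ _)), hM' n (lt_of_lt_of_le hn (min_le_right _ _)),
      add_zero]
  · simpa only [add_mul] using (hs τ).add (hs' τ)

theorem HasQExp.const_mul {N : ℕ} {R : Subring ℂ} {u : ℍ → ℂ} (hu : HasQExp N R u) {a : ℂ}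
    (ha : a ∈ R) : HasQExp N R (fun τ => a * u τ) := by
  obtain ⟨c, hc, ⟨M, hM⟩, hs⟩ := hu
  refine ⟨fun n => a * c n, fun n => R.mul_mem ha (hc n), ⟨M, fun n hn => by simp [hM n hn]⟩,
    fun τ => ?_⟩
  simpa only [mul_assoc] using (hs τ).mul_left a

theorem HasQExp.of_hasSum {ι : Type*} {N : ℕ} {R : Subring ℂ} {u : ℍ → ℂ} {e : ι → ℤ}
    (he : Function.Injective e) {d : ι → ℂ} (hd : ∀ i, d i ∈ R) {M : ℤ}
    (hM : ∀ i, e i < M → d i = 0)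
    (hs : ∀ τ : ℍ, HasSum (fun i => d i * cexp (2 * π * I * ((e i : ℂ) / N) * τ)) (u τ)) :
    HasQExp N R u := by
  classical
  refine ⟨Function.extend e d 0, fun n => ?_, ⟨M, fun n hn => ?_⟩, fun τ => ?_⟩
  · by_cases h : ∃ i, e i = n
    · obtain ⟨i, rfl⟩ := h
      rw [he.extend_apply]; exact hd i
    · rw [Function.extend_apply' _ _ _ h]; exact R.zero_mem
  · by_cases h : ∃ i, e i = n
    · obtain ⟨i, rfl⟩ := h
      rw [he.extend_apply]; exact hM i hn
    · rw [Function.extend_apply' _ _ _ h]; rfl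
  · refine (he.hasSum_iff ?_).mp ?_
    · intro n hn
      rw [Function.extend_apply' _ _ _ (by simpa using hn)]
      simp
    · convert! hs τ using 1
      funext i
      simp [he.extend_apply]

theorem c0_mem (R : Subring ℂ) (k l : ℤ) : c0 k l ∈ R := by
  obtain ⟨n, hn⟩ := c0_int k l
  rw [hn]; exact intCast_mem R n

theorem hasQExp_f0 {N : ℕ} (hN : 0 < N) (R : Subring ℂ) (k : ℤ) :
    HasQExp N R (fun τ => f0 k τ) := by
  have hN' : (N : ℂ) ≠ 0 := by exact_mod_cast hN.ne'
  refine HasQExp.of_hasSum (e := fun l : ℤ => N * l) (d := c0 k) (M := -N) (fun a b h => ?_)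
    (c0_mem R k) (fun l hl => c0_eq_zero ?_) (fun τ => ?_)
  · exact mul_left_cancel₀ (by exact_mod_cast hN.ne') h
  · have : (0 : ℤ) < N := by exact_mod_cast hN
    by_contra! h
    nlinarith
  · convert! hasSum_f0 k τ.2 using 1
    funext l
    push_cast
    rw [mul_div_cancel_left₀ _ hN']

theorem hasQExp_gFun {N : ℕ} (hN : 0 < N) (R : Subring ℂ) (k : ℤ) {i : ℕ} (hi : (4 : ℤ) ∣ N * i) :
    HasQExp N R (fun τ => gFun k i τ) := by
  have hN' : (N : ℂ) ≠ 0 := by exact_mod_cast hN.ne'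
  have hdvd : ∀ l : {l : ℤ // l ≡ i [ZMOD 4]}, ∃ e : ℤ, (N : ℤ) * l = 4 * e := by
    rintro ⟨l, hl⟩
    obtain ⟨c, hc⟩ := Int.modEq_iff_dvd.mp hl.symm
    obtain ⟨d, hd⟩ := hi
    exact ⟨d + N * c, by linear_combination hd + N * hc⟩
  choose e he using hdvd
  have hNpos : (0 : ℤ) < N := by exact_mod_cast hN
  refine HasQExp.of_hasSum (e := e) (d := fun l => c0 k l) (M := -N) (fun a b h => ?_)
    (fun l => c0_mem R k l) (fun l hl => c0_eq_zero ?_) (fun τ => ?_)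
  · have h1 := he a
    rw [h, ← he b] at h1
    exact Subtype.ext (mul_left_cancel₀ hNpos.ne' h1)
  · have := he l
    by_contra! h
    nlinarith
  · rw [gFun_eq k i τ.2]
    convert! hasSum_gFun k i τ.2 using 1
    funext l
    have h1 : ((N : ℂ) * (l : ℤ)) = 4 * e l := by exact_mod_cast he l
    have h2 : (e l : ℂ) / N = (l : ℤ) / 4 := by
      rw [div_eq_div_iff hN' (by norm_num)]
      linear_combination -h1
    rw [h2]

theorem hasQExp_f1 {N : ℕ} (hN : 0 < N) (R : Subring ℂ) (k : ℤ) (hk : (4 : ℤ) ∣ N * k)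
    (hR : (2 : ℂ) ^ (4 + k) ∈ R) : HasQExp N R (fun τ => f1 k τ) := by
  have hN' : (N : ℂ) ≠ 0 := by exact_mod_cast hN.ne'
  have hNpos : (0 : ℤ) < N := by exact_mod_cast hN
  obtain ⟨r, hr⟩ := hk
  obtain ⟨a, ha⟩ := isIntSeries_f1Series k
  have h16 : (16 * 2 ^ k : ℂ) = 2 ^ (4 + k) := by
    rw [zpow_add₀ two_ne_zero]; norm_num
  have hr' : (N : ℂ) * k = 4 * r := by exact_mod_cast hr
  have hmain : HasQExp N R (fun τ => cexp (2 * π * I * (k / 4) * τ) *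
      f1Series k (cexp (2 * π * I * τ))) := by
    refine HasQExp.of_hasSum (e := fun n : ℕ => N * n + r) (d := fun n => (a n : ℂ)) (M := r)
      (fun a b h => ?_) (fun n => intCast_mem R _) (fun n hn => ?_) (fun τ => ?_)
    · simp only at h
      have := mul_left_cancel₀ hNpos.ne' (add_right_cancel h)
      exact_mod_cast this
    · exfalso
      have : (0 : ℤ) ≤ N * n := by positivity
      omega
    · have h := (ha _ (norm_exp_two_pi_lt_one τ.2)).mul_left (cexp (2 * π * I * (k / 4) * τ))
      convert! h using 1
      funext n
      have h2 : (r : ℂ) / N = k / 4 := by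
        rw [div_eq_div_iff hN' (by norm_num)]
        linear_combination -hr'
      push_cast
      rw [add_div, mul_div_cancel_left₀ _ hN', h2, mul_left_comm, ← Complex.exp_nat_mul,
        ← Complex.exp_add]
      congr 2
      ring
  have hfin := hmain.const_mul (R.neg_mem hR)
  convert! hfin using 1
  funext τ
  rw [f1_eq_series k τ.2, h16]

/-! ### Holomorphy -/

theorem differentiableOn_exp_series {P : ℂ → ℂ} (hP : IsIntSeries P) :
    DifferentiableOn ℂ (fun τ => P (cexp (2 * π * I * τ))) {z | 0 < z.im} :=
  hP.differentiableOn.comp (by fun_prop) fun z hz => by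
    simpa using norm_exp_two_pi_lt_one hz

theorem differentiableOn_f0 (k : ℤ) : DifferentiableOn ℂ (f0 k) {z | 0 < z.im} := by
  refine DifferentiableOn.congr ?_ fun z hz => f0_eq_series k hz
  exact (by fun_prop : DifferentiableOn ℂ (fun τ => cexp (-(2 * π * I * τ))) _).mul
    (differentiableOn_exp_series (isIntSeries_f0Series k))

theorem differentiableOn_f1 (k : ℤ) : DifferentiableOn ℂ (f1 k) {z | 0 < z.im} := by
  refine DifferentiableOn.congr ?_ fun z hz => f1_eq_series k hz
  exact ((by fun_prop : DifferentiableOn ℂ (fun τ => cexp (2 * π * I * (k / 4) * τ)) _).mul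
    (differentiableOn_exp_series (isIntSeries_f1Series k))).const_mul _

namespace EvenLattice

variable {Λ : Type*} [AddCommGroup Λ] {L : EvenLattice Λ}

/-! ### The components of `F_Λ` -/

theorem IsTwoElementary.exists_q_eq (hL : L.IsTwoElementary) (γ : L.DiscGroup) :
    ∃ i < 4, L.q γ = (((i : ℕ) : ℚ) / 2 : ℚ) := by
  have h4 := hL.eHalf_q_pow_four γ
  induction γ using QuotientAddGroup.induction_on with | _ x
  rw [q_mk, eHalf_coe, ← Complex.exp_nat_mul, Complex.exp_eq_one_iff] at h4
  obtain ⟨n, hn⟩ := h4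
  have h1 : ((L.formQ x x : ℚ) : ℂ) = (n / 2 : ℚ) := by
    apply mul_left_cancel₀ two_pi_I_ne_zero
    push_cast at hn ⊢
    linear_combination hn / 2
  have h2 : L.formQ x x = (n / 2 : ℚ) := by exact_mod_cast h1
  refine ⟨(n % 4).toNat, by omega, ?_⟩
  rw [q_mk, h2, ← sub_eq_zero, ← AddCircle.coe_sub, AddCircle.coe_eq_zero_iff]
  refine ⟨n / 4, ?_⟩
  have h3 : (((n % 4).toNat : ℕ) : ℤ) = n - 4 * (n / 4) := by omega
  have h4 : (((n % 4).toNat : ℕ) : ℚ) = n - 4 * ((n / 4 : ℤ) : ℚ) := by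
    rw [← Int.cast_natCast, h3]; push_cast; ring
  rw [h4, zsmul_eq_mul]
  ring

theorem half_eq_half_iff {i j : ℤ} :
    (((i : ℚ) / 2 : ℚ) : AddCircle (2 : ℚ)) = (((j : ℚ) / 2 : ℚ) : AddCircle (2 : ℚ)) ↔
      (4 : ℤ) ∣ i - j := by
  rw [← sub_eq_zero, ← AddCircle.coe_sub, AddCircle.coe_eq_zero_iff]
  constructor
  · rintro ⟨n, hn⟩
    refine ⟨n, ?_⟩
    rw [zsmul_eq_mul] at hn
    have : ((i - j : ℤ) : ℚ) = (4 * n : ℤ) := by push_cast; linarith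
    exact_mod_cast this
  · rintro ⟨n, hn⟩
    refine ⟨n, ?_⟩
    have : ((i - j : ℤ) : ℚ) = (4 * n : ℤ) := by rw [hn]
    push_cast at this
    rw [zsmul_eq_mul]
    linarith

theorem sum_gFun_smul_v {δ : L.DiscGroup} {i : ℕ} (hi : i < 4)
    (hq : L.q δ = ((i : ℚ) / 2 : ℚ)) (u : ℕ → ℂ) :
    (∑ l ∈ Finset.range 4, u l • L.v l) δ = u i := by
  classical
  have hv : ∀ l ∈ Finset.range 4, (u l • L.v l) δ = if l = i then u l else 0 := by
    intro l hl
    rw [Finset.mem_range] at hl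
    have : L.q δ = (((l : ℚ) / 2 : ℚ) : AddCircle (2 : ℚ)) ↔ l = i := by
      rw [hq]
      have h := half_eq_half_iff (i := i) (j := l)
      push_cast at h
      rw [h]
      omega
    simp only [Pi.smul_apply, v, this, smul_eq_mul]
    split_ifs <;> simp
  rw [Finset.sum_apply, Finset.sum_congr rfl hv, Finset.sum_ite_eq', if_pos (by simpa using hi)]

theorem F_apply {δ : L.DiscGroup} {i : ℕ} (hi : i < 4) (hq : L.q δ = ((i : ℚ) / 2 : ℚ)) (τ : ℍ) :
    L.F τ δ = f0 (8 + L.sigma) τ * L.e 0 δ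
      + (((2 : ℝ) ^ (((4 - L.sigma - L.len : ℤ) : ℝ) / 2) : ℝ) : ℂ) * gFun (8 + L.sigma) i τ
      + f1 (8 + L.sigma) τ * L.e L.one δ := by
  rw [F, Pi.add_apply, Pi.add_apply, Pi.smul_apply, Pi.smul_apply, Pi.smul_apply,
    sum_gFun_smul_v hi hq (fun l => gFun (8 + L.sigma) l τ)]
  rfl

/-- The average over the cosets of `STʲ` is the one that extracts `g^{(i)}`, where `γ² ≡ i/2 mod 2`. -/
theorem F_eq_indFun [Module.Free ℤ Λ] [Module.Finite ℤ Λ] (hL : L.IsTwoElementary) (τ : ℍ) :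
    L.F τ = L.indFun τ := by
  funext δ
  obtain ⟨i, hi, hq⟩ := hL.exists_q_eq δ
  rw [F_apply hi hq, indFun_apply hL, ← slashConst_mul_weilConstInv hL, gFun_eq _ _ τ.2]
  have h : ∀ j : ℕ, (eHalf (L.q δ) ^ j)⁻¹ = cexp (-(π * I * j * (i / 2))) := by
    intro j
    rw [hq, eHalf_coe, ← Complex.exp_nat_mul, ← Complex.exp_neg]
    congr 1
    push_cast
    ring
  simp_rw [h]
  ring

theorem mdifferentiable_F [Module.Free ℤ Λ] [Module.Finite ℤ Λ] (hL : L.IsTwoElementary)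
    (δ : L.DiscGroup) : MDifferentiable 𝓘(ℂ) 𝓘(ℂ) (fun τ => L.F τ δ) := by
  rw [UpperHalfPlane.mdifferentiable_iff]
  have hd : DifferentiableOn ℂ (fun z : ℂ => f0 (8 + L.sigma) z * L.e 0 δ
      + slashConst ^ L.sigma * L.weilConstInv * ∑ j ∈ Finset.range 4,
          (eHalf (L.q δ) ^ j)⁻¹ * f0 (8 + L.sigma) ((z + j) / 4)
      + f1 (8 + L.sigma) z * L.e L.one δ) {z | 0 < z.im} := by
    refine DifferentiableOn.add (DifferentiableOn.add ?_ ?_) ?_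
    · exact (differentiableOn_f0 _).mul_const _
    · refine DifferentiableOn.const_mul (DifferentiableOn.fun_sum fun j _ => ?_) _
      refine DifferentiableOn.const_mul ?_ _
      refine (differentiableOn_f0 _).comp (g := f0 (8 + L.sigma)) (f := fun z : ℂ => (z + j) / 4)
        (by fun_prop) fun z hz => ?_
      simpa using hz
    · exact (differentiableOn_f1 _).mul_const _
  refine hd.congr fun z hz => ?_
  simp only [Function.comp_apply]
  rw [F_eq_indFun hL, indFun_apply hL, ofComplex_apply_of_im_pos hz]

/-! ### The level -/

/-- `4` is a possible value of `N`, so the infimum defining the level is attained. -/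
theorem level_spec (hL : L.IsTwoElementary) :
    0 < L.level ∧ ∀ x ∈ L.dual, ∃ m : ℤ, (L.level : ℚ) * L.formQ x x / 2 = m := by
  have hne : {l : ℕ | 0 < l ∧ ∀ x ∈ L.dual, ∃ m : ℤ, (l : ℚ) * L.formQ x x / 2 = m}.Nonempty := by
    refine ⟨4, by norm_num, fun x hx => ?_⟩
    obtain ⟨i, -, hi⟩ := hL.exists_q_eq (QuotientAddGroup.mk ⟨x, hx⟩)
    rw [q_mk, ← sub_eq_zero, ← AddCircle.coe_sub, AddCircle.coe_eq_zero_iff] at hi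
    obtain ⟨n, hn⟩ := hi
    rw [zsmul_eq_mul] at hn
    refine ⟨i + 4 * n, ?_⟩
    push_cast
    linarith
  exact Nat.sInf_mem hne

theorem four_dvd_level_mul (hL : L.IsTwoElementary) {γ : L.DiscGroup} {i : ℤ}
    (hq : L.q γ = ((i : ℚ) / 2 : ℚ)) : (4 : ℤ) ∣ L.level * i := by
  induction γ using QuotientAddGroup.induction_on with | _ x
  obtain ⟨m, hm⟩ := (level_spec hL).2 x x.2
  rw [q_mk, ← sub_eq_zero, ← AddCircle.coe_sub, AddCircle.coe_eq_zero_iff] at hq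
  obtain ⟨n, hn⟩ := hq
  rw [zsmul_eq_mul] at hn
  refine ⟨m - L.level * n, ?_⟩
  have : ((L.level * i : ℤ) : ℚ) = (4 * (m - L.level * n) : ℤ) := by
    push_cast
    linear_combination 4 * hm + 2 * L.level * hn
  exact_mod_cast this

/-- As `1_Λ² ≡ σ/2`, the exponents of `f^{(1)}` lie in `(1/N) ℤ`. -/
theorem four_dvd_level_mul_sigma [Module.Free ℤ Λ] [Module.Finite ℤ Λ] (hL : L.IsTwoElementary) :
    (4 : ℤ) ∣ L.level * (8 + L.sigma) := by
  obtain ⟨i, -, hq⟩ := hL.exists_q_eq L.one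
  have h1 := eHalf_q_one hL
  rw [hq, eHalf_coe, Complex.exp_eq_exp_iff_exists_int] at h1
  obtain ⟨n, hn⟩ := h1
  have h2 : ((i : ℤ) : ℂ) = (L.sigma + 4 * n : ℤ) := by
    apply mul_left_cancel₀ two_pi_I_ne_zero
    push_cast at hn ⊢
    linear_combination 4 * hn
  have h3 : (i : ℤ) = L.sigma + 4 * n := by exact_mod_cast h2
  obtain ⟨r, hr⟩ := four_dvd_level_mul hL (i := i) (by simpa using hq)
  exact ⟨r + L.level * (2 - n), by linear_combination hr - L.level * h3⟩

/-! ### Fourier expansion of `F_Λ` -/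

theorem hasQExp_F [Module.Free ℤ Λ] [Module.Finite ℤ Λ] (hL : L.IsTwoElementary) (R : Subring ℂ)
    (h1 : (((2 : ℝ) ^ (((4 - L.sigma - L.len : ℤ) : ℝ) / 2) : ℝ) : ℂ) ∈ R)
    (h2 : (2 : ℂ) ^ (4 + (8 + L.sigma)) ∈ R) (δ : L.DiscGroup) :
    HasQExp L.level R (fun τ => L.F τ δ) := by
  obtain ⟨i, hi, hq⟩ := hL.exists_q_eq δ
  have hN := (level_spec hL).1
  have he : ∀ γ, L.e γ δ ∈ R := by
    intro γ
    rw [e]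
    split_ifs
    · exact R.one_mem
    · exact R.zero_mem
  have hg := (hasQExp_gFun hN R (8 + L.sigma) (four_dvd_level_mul hL (i := i)
    (by simpa using hq))).const_mul h1
  have hf0 := (hasQExp_f0 hN R (8 + L.sigma)).const_mul (he 0)
  have hf1 := (hasQExp_f1 hN R (8 + L.sigma) (four_dvd_level_mul_sigma hL) h2).const_mul (he L.one)
  convert! (hf0.add hg).add hf1 using 1
  funext τ
  rw [F_apply hi hq]
  ring

theorem exists_hasFourierExpansion (hL : L.IsTwoElementary) (R : Subring ℂ)
    (h : ∀ δ, HasQExp L.level R (fun τ => L.F τ δ)) :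
    ∃ c : L.DiscGroup → ℤ → ℂ, (∀ γ n, c γ n ∈ R) ∧ L.HasFourierExpansion L.F c := by
  have := hL.finite
  choose c hc hM hs using h
  choose M hM using hM
  obtain ⟨N, hN⟩ := (Set.finite_range M).bddBelow
  exact ⟨c, hc, ⟨N, fun γ n hn => hM γ n (lt_of_lt_of_le hn (hN ⟨γ, rfl⟩))⟩, fun τ γ => hs γ τ⟩

theorem isModularFormOfType_F [Module.Free ℤ Λ] [Module.Finite ℤ Λ] (hL : L.IsTwoElementary) :
    L.IsModularFormOfType L.sigma L.F where
  holo := mdifferentiable_F hL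
  transform g τ := by rw [F_eq_indFun hL, F_eq_indFun hL, indFun_smul hL]
  fourier := by
    obtain ⟨c, -, hc⟩ := exists_hasFourierExpansion hL ⊤
      (hasQExp_F hL ⊤ (Subring.mem_top _) (Subring.mem_top _))
    exact ⟨c, hc⟩

/-- For `b⁺ ≤ 2` the exponent `(4 - σ - l) / 2` is a natural number, as `l` is at most the rank
and has the parity of `σ`. -/
theorem two_rpow_mem [Module.Free ℤ Λ] [Module.Finite ℤ Λ] (hL : L.IsTwoElementary)
    (hb : L.bPlus ≤ 2) (R : Subring ℂ) :
    (((2 : ℝ) ^ (((4 - L.sigma - L.len : ℤ) : ℝ) / 2) : ℝ) : ℂ) ∈ R := by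
  obtain ⟨s, hs⟩ := even_len_add_sigma hL
  have h1 := len_le_finrank hL
  have h2 := L.bPlus_add_bMinus
  have h3 : L.sigma = (L.bPlus : ℤ) - L.bMinus := rfl
  obtain ⟨n, hn⟩ : ∃ n : ℕ, (4 - L.sigma - L.len : ℤ) = 2 * n := ⟨(2 - s).toNat, by omega⟩
  rw [hn]
  push_cast
  rw [mul_div_cancel_left₀ _ (two_ne_zero' ℝ), Real.rpow_natCast]
  push_cast
  exact R.pow_mem (ofNat_mem R 2) n

theorem hasIntegralFourierCoefficients_F [Module.Free ℤ Λ] [Module.Finite ℤ Λ]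
    (hL : L.IsTwoElementary) (hb : L.bPlus ≤ 2) (hσ : -12 ≤ L.sigma) :
    L.HasIntegralFourierCoefficients L.F := by
  have h2 : (2 : ℂ) ^ (4 + (8 + L.sigma)) ∈ (Int.castRingHom ℂ).range := by
    obtain ⟨n, hn⟩ : ∃ n : ℕ, 4 + (8 + L.sigma) = n := ⟨(12 + L.sigma).toNat, by omega⟩
    rw [hn, zpow_natCast]
    exact Subring.pow_mem _ (by simp) n
  obtain ⟨c, hc, hF⟩ := exists_hasFourierExpansion hL _
    (hasQExp_F hL (Int.castRingHom ℂ).range (two_rpow_mem hL hb _) h2)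
  choose d hd using fun γ n => RingHom.mem_range.mp (hc γ n)
  refine ⟨d, ?_⟩
  have : c = fun γ n => (d γ n : ℂ) := funext fun γ => funext fun n => (hd γ n).symm
  rwa [← this]

/-! ### Invariance under the orthogonal group -/

theorem q_disc (g : L.O) (γ : L.DiscGroup) : L.q (L.disc g γ) = L.q γ := by
  induction γ using QuotientAddGroup.induction_on with | _ x
  rw [disc_mk, q_mk, q_mk]
  exact congrArg _ (L.formQ_extend g x x)

theorem b_disc (g : L.O) (γ δ : L.DiscGroup) : L.b (L.disc g γ) (L.disc g δ) = L.b γ δ := by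
  induction γ using QuotientAddGroup.induction_on with | _ x
  induction δ using QuotientAddGroup.induction_on with | _ y
  rw [disc_mk, disc_mk, b_mk, b_mk]
  exact congrArg _ (L.formQ_extend g x y)

theorem disc_one [Module.Free ℤ Λ] [Module.Finite ℤ Λ] (hL : L.IsTwoElementary) (g : L.O) :
    L.disc g L.one = L.one := by
  refine (L.existsUnique_isCharacteristic hL).unique (fun γ => ?_) (L.one_spec hL)
  rw [← L.disc_symm g γ, b_disc, b_disc]
  exact L.one_spec hL _

theorem e_disc (g : L.O) {γ : L.DiscGroup} (hγ : ∀ g : L.O, L.disc g γ = γ) (δ : L.DiscGroup) :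
    L.e γ (L.disc g δ) = L.e γ δ := by
  have : L.disc g δ = γ ↔ δ = γ :=
    ⟨fun h => by rw [← hγ g.symm, ← h]; exact (L.disc_symm g.symm δ).symm, fun h => by rw [h, hγ]⟩
  classical
  exact if_congr this rfl rfl

/-- `F_Λ(γ)` depends only on `γ²` and on whether `γ` is `0` or `1_Λ`, all invariant under isometries. -/
theorem autSet_F [Module.Free ℤ Λ] [Module.Finite ℤ Λ] (hL : L.IsTwoElementary) :
    L.autSet L.F = Set.univ := by
  refine Set.eq_univ_of_forall fun g τ => funext fun δ => ?_
  obtain ⟨i, hi, hq⟩ := hL.exists_q_eq δ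
  change L.F τ (L.disc g.symm δ) = L.F τ δ
  rw [F_apply hi hq, F_apply hi (by rw [q_disc, hq]), e_disc _ (fun g => map_zero _),
    e_disc _ (disc_one hL)]

end EvenLattice

theorem theorem7p7 {Λ : Type*} [AddCommGroup Λ] [Module.Free ℤ Λ] [Module.Finite ℤ Λ]
    (L : EvenLattice Λ) (hL : L.IsTwoElementary) :
    -- the formulas for `S` and `T` define the Weil representation
    (L.IsWeilRep L.weilRep ∧ ∀ ρ, L.IsWeilRep ρ → ρ = L.weilRep) ∧
    -- `F_Λ` is the induced function, for every choice of coset representatives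
    (∀ s : Cosets → Mp2Z, (∀ c, (Quotient.mk _ (s c) : Cosets) = c) →
      ∀ τ : ℍ, L.F τ =
        L.induced s L.sigma (fun z : ℍ => etaQuot z * thetaA1 z ^ (8 + L.sigma)) τ) ∧
    -- `F_Λ` is a modular form of type `ρ_Λ` and weight `σ(Λ) / 2`
    L.IsModularFormOfType L.sigma L.F ∧
    -- `Aut(Λ, F_Λ) = O(Λ)`
    L.autSet L.F = Set.univ ∧
    -- integrality
    (L.bPlus ≤ 2 → -12 ≤ L.sigma → L.HasIntegralFourierCoefficients L.F) := by
  refine ⟨⟨EvenLattice.isWeilRep_weilRep hL, fun ρ hρ =>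
    EvenLattice.isWeilRep_unique hL hρ (EvenLattice.isWeilRep_weilRep hL)⟩, fun s hs τ => ?_,
    EvenLattice.isModularFormOfType_F hL, EvenLattice.autSet_F hL,
    EvenLattice.hasIntegralFourierCoefficients_F hL⟩
  rw [EvenLattice.induced_eq_indFun hL s hs, EvenLattice.F_eq_indFun hL]

end
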